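/- **Setting.** For $s\ge 1$, an $s$-shape is a right-angled triangle with legs $\ell$ and $s\ell$ ($\ell>0$) or, if $s=1$, possibly a square. The capacity of a region is the largest $a$ such that every finite set of circles of total area at most $a$ can be packed into it (inside the region, without overlaps). Requests arrive online: insert a new circle, or delete a circle that is present. An online algorithm may reallocate circles while serving a request, at a cost equal to the total area of the circles that are reallocated (a newly placed circle included). It has packing density $A$ if it keeps the present circles validly packed after every request of every finite request sequence for which the total area of the present circles never exceeds $A$. It has amortised reallocation cost $f$ if, for every such sequence, the total cost is at most $\sum f(c)$ over all inserted circles, $c$ being the area (deletions are charged nothing). **The Online Split Packing Algorithm.** The algorithm keeps an infinite binary tree of shapes with the given shape $S$ as root; only the right child of a node on the right spine is split further on the spine, and the circles of a left child are packed by Split Packing. *Children.* A triangle of capacity $a$ has ideal capacities $a_{lg}^*=\frac{s^2}{1+s^2}a$, $a_{sh}^*=\frac1{1+s^2}a$; its left (long) and right (short) children of capacities $a_L$, $a_R=a-a_L$ are the similar triangles of these capacities at its smaller and larger acute corner (corner of the long leg, corner of the short leg), with right angles on the hypotenuse and hypotenuses along the legs. The children of a square are isosceles right triangles of capacities $a_L,a_R$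 at two opposite corners, with legs along its sides. *Split Packing of $C$ into a triangle.* A single circle is centred at the incentre. Otherwise go through $C$ by decreasing area, giving the next circle to the short part if (sum of short part)$/1<$ (sum of long part)$/s^2$, else to the long part; pack the two parts recursively into the long and short children whose capacities are the sums of the parts. *Repack of $C$ into a shape of capacity $a$.* Choose $C_L$, $C_R=C\setminus C_L$ and $a_L$; then Split-Pack $C_L$ into the left child and Repack $C_R$ into the right child. Unless stated otherwise $a_L$ is the total area of $C_L$. Triangle: (1) if some circle is larger than $a_{lg}^*$, $C_L$ is the largest circle; (2) else, if the total of $C$ is at most $a_{lg}^*$, then $C_L=C$, $a_L=a_{lg}^*$; (3) else fill $C_L$ greedily by decreasing area, keeping its total at most $a_{lg}^*$, and accept this if the total is $a_{lg}^*-\delta a$ with $\delta<\delta_{sh}:=\bigl(1-\frac1{2\sqrt{1+s^2}-1}\bigr)^2$; (4) otherwise $C_L$ consists of the two largest circles. Square: if the total of $C$ exceeds $a/2$, start with $C_L=C$ and go through the circles by decreasing area, removing one whenever the total of $C_L$ stays at least $a/2$; else $C_L=C$, $a_L=a/2$. *Basic insertion of a circle of area $c$.* Initially the tree is the Repack of no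 circles. At a spine node (starting at the root), if its left child is exactly filled, or if (total of the right child)$\,+\,c$ is less than the capacity of the right child, go on to the right child; otherwise Repack the node with all its circles and the new one, which reallocates exactly these circles. *Deletions with slack.* A deleted circle is only marked inactive. To insert $x$: if the area of $x$ plus that of all circles in the tree (active or inactive) is less than the capacity of $S$, use basic insertion; otherwise remove all inactive circles and put all active circles, including $x$, into the positions they would get by basic insertion one by one into the empty tree, which reallocates each of them once. **Theorem.** There is an absolute constant $K$ such that for every $s\ge1$ and every $s$-shape $S$ the following holds. The capacity $a$ of $S$ is the area of the incircle if $S$ is a triangle, and the combined area of the incircles of the two halves cut out by a diagonal if $S$ is a square. For every $\epsilon>0$, the Online Split Packing Algorithm for insertions and deletions (which does not depend on $\epsilon$) has packing density $(1-\epsilon)a$ on $S$, and, over all request sequences that keep the total area of the present circles at most $(1-\epsilon)a$, it has an amortised reallocation cost $f(c)$ for inserting a circle of area $c$ with $$f(c)\le K\,c\Bigl((1+s^2)\log_{1+s^2}\frac ac+\frac1\epsilon\Bigr)\qquad(0<c\le a),$$ $$f(c)\le K\,c\Bigl((1+s^2)\log_{1+s^2}\frac 1c+\frac1\epsilon\Bigr)\qquad(0<c\le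 \min(a,1/a));$$ the second bound thus holds for all $c\le a$ if $a\le1$, and as $c\to0$ for every $a$. If $S$ is a square, then moreover $f(c)\le K\,c(\log_2\frac ac+\frac1\epsilon)$ for $0<c\le a$ and $f(c)\le K\,c(\log_2\frac1c+\frac1\epsilon)$ for $0<c\le\min(a,1/a)$. -/

import Mathlib

open scoped Classical

noncomputable section

namespace OnlineSplitPacking

/-! ### Circles, packings, capacity -/

/-- The Euclidean plane. -/
abbrev Plane : Type := EuclideanSpace ℝ (Fin 2)

/-- A circle to be packed: its size is its area; the label tells circles of equal size apart. -/
structure Disc where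
  id : ℕ
  area : ℝ

/-- The radius of a circle, determined by its area. -/
def Disc.radius (c : Disc) : ℝ := Real.sqrt (c.area / Real.pi)

/-- Total area of a list of circles. -/
def total (C : List Disc) : ℝ := (C.map Disc.area).sum

/-- `pos` assigns centres to the circles in `C` so that every circle lies in the region `R` and
no two of them overlap (touching is allowed). -/
def IsPacking (R : Set Plane) (C : Set Disc) (pos : Disc → Plane) : Prop :=
  (∀ c ∈ C, Metric.closedBall (pos c) c.radius ⊆ R) ∧
  (∀ c ∈ C, ∀ d ∈ C, c ≠ d →
    Disjoint (Metric.ball (pos c) c.radius) (Metric.ball (pos d) d.radius))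

/-- `a` is the capacity (critical density) of `R`: the largest number such that every finite set
of circles of total area at most `a` can be packed into `R`. -/
def IsCapacity (R : Set Plane) (a : ℝ) : Prop :=
  IsGreatest {A : ℝ | ∀ C : Finset Disc, (∀ c ∈ C, 0 < c.area) → ∑ c ∈ C, c.area ≤ A →
    ∃ pos : Disc → Plane, IsPacking R (C : Set Disc) pos} a

/-! ### Online requests and online packing algorithms -/

/-- A request: insert a circle, or delete a circle. -/
inductive Request where
  | insert (c : Disc)
  | delete (c : Disc)

/-- `Admissible A ω act`: the finite request sequence `ω` (in chronological order) inserts only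
new circles of positive area, deletes only circles that are present, keeps the total area of the
present circles at most `A` at all times, and ends with the circles `act` present
(listed in order of insertion). -/
inductive Admissible (A : ℝ) : List Request → List Disc → Prop where
  | nil : Admissible A [] []
  | insert {ω : List Request} {act : List Disc} (c : Disc) (h : Admissible A ω act)
      (hpos : 0 < c.area) (hnew : ∀ d : Disc, Request.insert d ∈ ω → d.id ≠ c.id)
      (htot : total (act ++ [c]) ≤ A) :
      Admissible A (ω ++ [Request.insert c]) (act ++ [c])
  | delete {ω : List Request} {act : List Disc} (c : Disc) (h : Admissible A ω act)
      (hmem : c ∈ act) :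
      Admissible A (ω ++ [Request.delete c]) (act.filter (fun d => d.id ≠ c.id))

/-- An online packing algorithm: it serves the requests one at a time; `pos` gives the current
centres of the circles, and `moved σ r` is the set of circles that are (re)allocated when request
`r` is served in state `σ`. -/
structure OnlineAlgorithm where
  State : Type
  init : State
  step : State → Request → State
  pos : State → Disc → Plane
  moved : State → Request → List Disc

/-- The state after serving a sequence of requests. -/
def OnlineAlgorithm.run (alg : OnlineAlgorithm) (ω : List Request) : alg.State :=
  ω.foldl alg.step alg.init

/-- Total reallocation cost (area of the circles reallocated) of serving `ω` from state `σ`. -/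
def OnlineAlgorithm.costFrom (alg : OnlineAlgorithm) : alg.State → List Request → ℝ
  | _, [] => 0
  | σ, r :: ω => total (alg.moved σ r) + OnlineAlgorithm.costFrom alg (alg.step σ r) ω

/-- The algorithm has packing density `A` on `R`: for every request sequence that keeps the total
area of the present circles at most `A`, the present circles are validly packed after every
request, and a request changes the positions only of circles that are declared (and paid for) as
reallocated; a newly inserted circle is always among those. -/
def HasPackingDensity (alg : OnlineAlgorithm) (R : Set Plane) (A : ℝ) : Prop :=
  (∀ (ω : List Request) (act : List Disc), Admissible A ω act →
    IsPacking R {c | c ∈ act} (alg.pos (alg.run ω))) ∧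
  (∀ (ω : List Request) (r : Request) (act act' : List Disc),
    Admissible A ω act → Admissible A (ω ++ [r]) act' →
      ∀ c ∈ act', c ∉ alg.moved (alg.run ω) r →
        c ∈ act ∧ alg.pos (alg.run (ω ++ [r])) c = alg.pos (alg.run ω) c)

/-- What a request contributes to the budget when inserting area `c` is charged `f c`
and deletions are free. -/
def Request.charge (f : ℝ → ℝ) : Request → ℝ
  | .insert c => f c.area
  | .delete _ => 0

/-- Amortised reallocation cost `f c` per insertion of a circle of area `c`, over all request
sequences that keep the total area of the present circles at most `A`. -/
def HasAmortisedCost (alg : OnlineAlgorithm) (A : ℝ) (f : ℝ → ℝ) : Prop :=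
  ∀ (ω : List Request) (act : List Disc), Admissible A ω act →
    alg.costFrom alg.init ω ≤ (ω.map (Request.charge f)).sum

/-! ### Triangles and squares -/

/-- A right-angled triangle: right angle at `Q`, long leg `L Q`, short leg `Q H`. -/
structure Triangle where
  L : Plane
  Q : Plane
  H : Plane

namespace Triangle

/-- Capacity: the area of the incircle (its radius is half of the sum of the legs minus the
hypotenuse). -/
def capacity (T : Triangle) : ℝ :=
  Real.pi * ((dist T.L T.Q + dist T.Q T.H - dist T.L T.H) / 2) ^ 2

/-- The incentre. -/
def incenter (T : Triangle) : Plane :=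
  (dist T.Q T.H + dist T.L T.H + dist T.L T.Q)⁻¹ •
    (dist T.Q T.H • T.L + dist T.L T.H • T.Q + dist T.L T.Q • T.H)

/-- The long child of capacity `a₁` of an `s`-right-angled triangle of capacity `a`: the similar
triangle of capacity `a₁` at the corner `L`, with its right angle on the line `L H` and its
hypotenuse along the ray `L Q`. -/
def longChild (s a a₁ : ℝ) (T : Triangle) : Triangle where
  L := T.L
  Q := T.L + (Real.sqrt (a₁ / a) * (s / Real.sqrt (1 + s ^ 2))) • (T.H - T.L)
  H := T.L + (Real.sqrt (a₁ / a) / (s / Real.sqrt (1 + s ^ 2))) • (T.Q - T.L)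

/-- The short child of capacity `a₂`: the similar triangle of capacity `a₂` at the corner `H`,
with its right angle on the line `L H` and its hypotenuse along the ray `H Q`. -/
def shortChild (s a a₂ : ℝ) (T : Triangle) : Triangle where
  L := T.H + (Real.sqrt (a₂ / a) / (1 / Real.sqrt (1 + s ^ 2))) • (T.Q - T.H)
  Q := T.H + (Real.sqrt (a₂ / a) * (1 / Real.sqrt (1 + s ^ 2))) • (T.L - T.H)
  H := T.H

end Triangle

/-- A node on the right spine of the tree is a square, with corner `O`, adjacent corners `X`, `Y`
and opposite corner `X + Y - O`, or it is a (possibly rounded) triangle. Rounding the corners of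
a triangle changes neither its capacity nor anything the algorithm does, so the underlying
triangle is all that is recorded. -/
inductive Shape where
  | square (O X Y : Plane)
  | triangle (T : Triangle)

namespace Shape

/-- The region occupied by a square or a full triangle. -/
def region : Shape → Set Plane
  | square O X Y => convexHull ℝ {O, X, X + Y - O, Y}
  | triangle T => convexHull ℝ {T.L, T.Q, T.H}

/-- The capacity; for a square it is the combined area of the incircles of the two halves into
which a diagonal cuts it. -/
def capacity : Shape → ℝ
  | square O X Y => 2 * Triangle.capacity ⟨X, O, Y⟩
  | triangle T => T.capacity

/-- `s`-shapes: right-angled triangles with legs `ℓ`, `s ℓ` (`s ≥ 1`, `ℓ > 0`), and,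
for `s = 1`, also squares. -/
def IsSShape (s : ℝ) : Shape → Prop
  | square O X Y => s = 1 ∧ 0 < dist O X ∧ dist O Y = dist O X ∧ inner ℝ (X - O) (Y - O) = 0
  | triangle T => 1 ≤ s ∧ 0 < dist T.Q T.H ∧ dist T.L T.Q = s * dist T.Q T.H ∧
      inner ℝ (T.L - T.Q) (T.H - T.Q) = 0

/-- The shape is a square. -/
def IsSquare : Shape → Prop
  | square _ _ _ => True
  | triangle _ => False

/-- Left child of capacity `aL` of an `s`-shape of capacity `a` (long child of a triangle; for a
square, the isosceles right-angled triangle of capacity `aL` at the corner `O`). -/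
def leftChild (s a aL : ℝ) : Shape → Triangle
  | square O X Y =>
      ⟨O + Real.sqrt (aL / (a / 2)) • (X - O), O, O + Real.sqrt (aL / (a / 2)) • (Y - O)⟩
  | triangle T => T.longChild s a aL

/-- Right child of capacity `aR` of an `s`-shape of capacity `a` (short child of a triangle; for a
square, the isosceles right-angled triangle of capacity `aR` at the corner opposite to `O`). -/
def rightChild (s a aR : ℝ) : Shape → Triangle
  | square O X Y =>
      ⟨(X + Y - O) + Real.sqrt (aR / (a / 2)) • (O - Y), X + Y - O,
        (X + Y - O) + Real.sqrt (aR / (a / 2)) • (O - X)⟩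
  | triangle T => T.shortChild s a aR

end Shape

/-! ### Offline Split Packing (used for left children) -/

/-- The circles sorted by decreasing area. -/
def sortDesc (C : List Disc) : List Disc := C.insertionSort (fun c d => d.area ≤ c.area)

/-- The greedy partition with ideal split key `(f₁, f₂)`, on circles listed in decreasing order;
`C₁`, `C₂` are the parts built so far. -/
def splitLoop (f₁ f₂ : ℝ) : List Disc → List Disc → List Disc → List Disc × List Disc
  | [], C₁, C₂ => (C₁, C₂)
  | c :: C, C₁, C₂ =>
      if total C₁ / f₁ < total C₂ / f₂ then splitLoop f₁ f₂ C (C₁ ++ [c]) C₂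
      else splitLoop f₁ f₂ C C₁ (C₂ ++ [c])

/-- Partition of `C` into the circles for the short child and those for the long child, by the
ideal ratio `1 : s²` of their capacities. The largest circle goes to the long child. -/
def split (s : ℝ) (C : List Disc) : List Disc × List Disc :=
  splitLoop 1 (s ^ 2) (sortDesc C) [] []

/-- Centre of the circle `c ∈ C` when `C` is packed by Split Packing into an `s`-right-angled
triangle `T` of capacity `a`: a single circle is centred at the incentre; otherwise `C` is split,
and the two parts are packed recursively into the long and the short child whose capacities are
their total areas. The first argument bounds the depth of the recursion; `C.length` is always
enough, as both parts of a split of at least two circles are nonempty. -/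
def splitPack (s : ℝ) : ℕ → Triangle → ℝ → List Disc → Disc → Plane
  | 0, T, _, _, _ => T.incenter
  | n + 1, T, a, C, c =>
      if C.length ≤ 1 then T.incenter
      else
        let Csh := (split s C).1
        let Clg := (split s C).2
        if c ∈ Clg then splitPack s n (T.longChild s a (total Clg)) (total Clg) Clg c
        else splitPack s n (T.shortChild s a (total Csh)) (total Csh) Csh c

/-! ### The Repack operation -/

/-- Outcome of the decision step of Repack: capacity of the left child, and the circles for the
left and for the right child. The right child has the remaining capacity. -/
structure Choice where
  capL : ℝ
  left : List Disc
  right : List Disc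

/-- Greedy filling: go through the list and keep a circle if the total kept so far (`t`) does not
exceed `m` with it. Returns the circles kept and those not kept. -/
def greedyFill (m : ℝ) : ℝ → List Disc → List Disc × List Disc
  | _, [] => ([], [])
  | t, c :: C =>
      if t + c.area ≤ m then
        (c :: (greedyFill m (t + c.area) C).1, (greedyFill m (t + c.area) C).2)
      else ((greedyFill m t C).1, c :: (greedyFill m t C).2)

/-- Greedy removal: go through the list and remove a circle if the remaining total (currently `t`)
stays at least `m`. Returns the circles kept and those removed. -/
def greedyTrim (m : ℝ) : ℝ → List Disc → List Disc × List Disc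
  | _, [] => ([], [])
  | t, c :: C =>
      if m ≤ t - c.area then
        ((greedyTrim m (t - c.area) C).1, c :: (greedyTrim m (t - c.area) C).2)
      else (c :: (greedyTrim m t C).1, (greedyTrim m t C).2)

/-- Ideal capacity of the long side of an `s`-right-angled triangle of capacity `a`. -/
def idealLong (s a : ℝ) : ℝ := a * (s ^ 2 / (1 + s ^ 2))

/-- The threshold `δ_sh` between the third and the fourth case. -/
def deltaShort (s : ℝ) : ℝ := (1 - 1 / (2 * Real.sqrt (1 + s ^ 2) - 1)) ^ 2

/-- Decision step of Repack on a triangle of capacity `a`. -/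
def chooseTriangle (s a : ℝ) (C : List Disc) : Choice :=
  let D := sortDesc C
  let G := greedyFill (idealLong s a) 0 D
  if ∃ c ∈ C, idealLong s a < c.area then ⟨total (D.take 1), D.take 1, D.drop 1⟩
  else if total C ≤ idealLong s a then ⟨idealLong s a, C, []⟩
  else if (idealLong s a - total G.1) / a < deltaShort s then ⟨total G.1, G.1, G.2⟩
  else ⟨total (D.take 2), D.take 2, D.drop 2⟩

/-- Decision step of Repack on a square of capacity `a`. -/
def chooseSquare (a : ℝ) (C : List Disc) : Choice :=
  let G := greedyTrim (a / 2) (total C) (sortDesc C)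
  if a / 2 < total C then ⟨total G.1, G.1, G.2⟩ else ⟨a / 2, C, []⟩

/-- Decision step of Repack. -/
def choose (s : ℝ) (S : Shape) (a : ℝ) (C : List Disc) : Choice :=
  match S with
  | .square _ _ _ => chooseSquare a C
  | .triangle _ => chooseTriangle s a C

/-- The rightmost node at one level of the tree: its shape and capacity, the circles it contains,
the capacity of its left child, and the circles in the left child. The right child is the
rightmost node of the next level. -/
structure Level where
  shape : Shape
  cap : ℝ
  contents : List Disc
  capL : ℝ
  left : List Disc

/-- The packing tree: the infinite sequence of rightmost nodes, one for each level. (The left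
children are packed by Split Packing, which is determined by the data of the level.) -/
abbrev Tree : Type := ℕ → Level

/-- Repack `C` into the shape `S` of capacity `a`: the rebuilt subtree. -/
def repack (s : ℝ) : Shape → ℝ → List Disc → Tree
  | S, a, C, 0 => ⟨S, a, C, (choose s S a C).capL, (choose s S a C).left⟩
  | S, a, C, n + 1 =>
      repack s (.triangle (S.rightChild s a (a - (choose s S a C).capL)))
        (a - (choose s S a C).capL) (choose s S a C).right n

/-! ### Insertion -/

/-- A tight shape: the circles in the left child fill its capacity exactly. -/
def Level.Tight (l : Level) : Prop := total l.left = l.capL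

/-- Inserting `c` at level `k` recurses into the right child. -/
def Descends (t : Tree) (c : Disc) (k : ℕ) : Prop :=
  (t k).Tight ∨ total (t (k + 1)).contents + c.area < (t (k + 1)).cap

/-- The tree after inserting `c`: descend along the right spine to the first level where the
insertion does not recurse, and repack the node there together with `c`. (If the recursion never
stopped, nothing would be done.) -/
def insertCircle (s : ℝ) (t : Tree) (c : Disc) : Tree :=
  if h : ∃ k, ¬ Descends t c k then
    fun j =>
      if j < Nat.find h then { t j with contents := c :: (t j).contents }
      else repack s (t (Nat.find h)).shape (t (Nat.find h)).cap
        (c :: (t (Nat.find h)).contents) (j - Nat.find h)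
  else t

/-- The circles that are reallocated when inserting `c`: all circles of the repacked node, with the
new one. -/
def insertMoved (t : Tree) (c : Disc) : List Disc :=
  if h : ∃ k, ¬ Descends t c k then c :: (t (Nat.find h)).contents else []

/-- The centre of a circle in the tree: the place that Split Packing gives it in the left child
that contains it. -/
def Tree.pos (s : ℝ) (t : Tree) (c : Disc) : Plane :=
  if h : ∃ k, c ∈ (t k).left then
    splitPack s (t (Nat.find h)).left.length
      ((t (Nat.find h)).shape.leftChild s (t (Nat.find h)).cap (t (Nat.find h)).capL)
      (t (Nat.find h)).capL (t (Nat.find h)).left c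
  else 0

/-! ### Insertions and deletions with slack -/

/-- The tree that contains all circles that have not been physically removed (active and
inactive), and the list of the active circles in order of insertion. -/
structure PackState where
  tree : Tree
  active : List Disc

/-- The initial tree: Repack without circles. -/
def emptyTree (s : ℝ) (S : Shape) : Tree := repack s S S.capacity []

/-- Inserting `x` would exhaust the space: the area of `x` and of all circles in the tree, active
or not, is at least the capacity. -/
def NeedsRebuild (S : Shape) (σ : PackState) (x : Disc) : Prop :=
  S.capacity ≤ x.area + total (σ.tree 0).contents

/-- Serve a request. A deletion only marks the circle as inactive. An insertion uses
`insertCircle`, except that when space runs out the inactive circles are removed and all active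
circles, including the new one, are put into the positions that they would have if they were
inserted one by one. -/
def serve (s : ℝ) (S : Shape) (σ : PackState) : Request → PackState
  | .insert x =>
      if NeedsRebuild S σ x then
        ⟨(σ.active ++ [x]).foldl (insertCircle s) (emptyTree s S), σ.active ++ [x]⟩
      else ⟨insertCircle s σ.tree x, σ.active ++ [x]⟩
  | .delete x => ⟨σ.tree, σ.active.filter (fun d => d.id ≠ x.id)⟩

/-- The circles reallocated when serving a request. -/
def serveMoved (S : Shape) (σ : PackState) : Request → List Disc
  | .insert x =>
      if NeedsRebuild S σ x then σ.active ++ [x] else insertMoved σ.tree x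
  | .delete _ => []

/-- The Online Split Packing Algorithm for insertions and deletions into the `s`-shape `S`. -/
def onlineSplitPacking (s : ℝ) (S : Shape) : OnlineAlgorithm where
  State := PackState
  init := ⟨emptyTree s S, []⟩
  step := serve s S
  pos := fun σ c => Tree.pos s σ.tree c
  moved := serveMoved S

end OnlineSplitPacking

end

open OnlineSplitPacking

/-! Geometry. A right-angled triangle of capacity `a` contains two similar triangles at its acute
corners, and when their capacities sum to at most `a`, a line orthogonal to the hypotenuse separates
them; this is Cauchy–Schwarz (`Triangle.IsRight.add_le_dist`). When the capacities differ from the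
ideal ones, one child sticks out of the parent across a leg. That does no harm if the circles cannot
enter the protruding corner. For the left child each single circle has to be large enough for the
excess (`fits_of_cornerChild`). The right child of a spine node holds circles of all sizes, of which
only one is known to be large, so more is needed: Split Packing, which gives its largest circle to
the long part, keeps every circle off the region near the corner `L` that the largest one alone
would leave free. This is expressed by `ClearHyp` and `ClearLeg`, is inherited through the recursion
(`splitPack_spec`), and is what an oversized right child requires (`fits_of_swap_cornerChild`).

Decisions. `choose_ok` shows that every rule of Repack yields children whose excess is covered in
one of these two ways. If greedy filling leaves a deficit, any rejected circle is larger than the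
deficit, and below the threshold such a circle covers the enlarged right child. At or above the
threshold the two largest circles together exceed the ideal left capacity, yet each is large enough
to be in that left child. The relations between neighbouring levels (`LevelOK`) survive basic
insertions, and validity of the packing follows by going up the spine (`TreeOK.fits_and_clear`).

Cost. Either a level is exactly filled or its right child has the fraction `1 / (1 + s ^ 2)` of its
capacity. The potential charges the content of the right child, times `1 + s ^ 2`, at each level of
the second kind. An insertion passes at most logarithmically many such levels. It stops only if the
right child would become full, and then the potential there pays for the Repack up to a term
proportional to the new circle; a Repack itself creates no potential (`TreeOK.insert_cost`).

Deletions. Every circle in the tree, active or not, carries a credit of `3 / ε` times its area. A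
rebuild discards inactive circles of area at least `ε` times the capacity, so it releases three
times the capacity. This pays for moving the active circles and for the potential of the new tree,
which is at most twice the capacity (`potential_le`, `cost_bound`).

Capacity. Packings up to the critical total come from Split Packing, with one extra splitting step
for squares. Optimality is tested on one circle in a triangle and on two equal circles in a square.
-/

noncomputable section

namespace OnlineSplitPacking

open Real

/-! ### Acute angles and orthonormal coordinates. -/

/-- `C` and `S` are the cosine and the sine of an acute angle. -/
structure IsAngle (C S : ℝ) : Prop where
  C_pos : 0 < C
  S_pos : 0 < S
  sq : C ^ 2 + S ^ 2 = 1

namespace IsAngle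

variable {C S : ℝ}

theorem swap (hA : IsAngle C S) : IsAngle S C := ⟨hA.S_pos, hA.C_pos, by linarith [hA.sq]⟩

theorem C_lt_one (hA : IsAngle C S) : C < 1 := by nlinarith [hA.C_pos, hA.S_pos, hA.sq]

theorem S_lt_one (hA : IsAngle C S) : S < 1 := hA.swap.C_lt_one

theorem one_lt_add (hA : IsAngle C S) : 1 < C + S := by
  nlinarith [hA.C_pos, hA.S_pos, hA.sq, mul_pos hA.C_pos hA.S_pos]

theorem cauchy (hA : IsAngle C S) {x y : ℝ} (h : x ^ 2 + y ^ 2 ≤ 1) : x * C + y * S ≤ 1 := by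
  nlinarith [sq_nonneg (x - C), sq_nonneg (y - S), hA.sq]

end IsAngle

/-- The determinant of an orthonormal pair squares to one, so `u` is a quarter turn of `v` up to
sign. Hence the rows of the coordinate matrix are orthonormal as well (`f1`, `f2`, `f3`), which
gives the expansion. -/
theorem eq_add_of_orthonormal {u v : Plane} (uu : inner ℝ u u = (1 : ℝ))
    (vv : inner ℝ v v = (1 : ℝ)) (uv : inner ℝ u v = (0 : ℝ)) (w : Plane) :
    w = (inner ℝ w u : ℝ) • u + (inner ℝ w v : ℝ) • v := by
  simp only [PiLp.inner_apply, Fin.sum_univ_two, RCLike.inner_apply, conj_trivial] at *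
  have hd : (u 0 * v 1 - u 1 * v 0) ^ 2 = 1 := by
    linear_combination (v 0 * v 0 + v 1 * v 1) * uu + vv - (v 0 * u 0 + v 1 * u 1) * uv
  have e1 : u 1 = - (u 0 * v 1 - u 1 * v 0) * v 0 := by
    linear_combination (-u 1) * vv + v 1 * uv
  have e0 : u 0 = (u 0 * v 1 - u 1 * v 0) * v 1 := by
    linear_combination (-u 0) * vv + v 0 * uv
  have f1 : u 0 * u 0 + v 0 * v 0 = 1 := by
    linear_combination vv + (u 0 + (u 0 * v 1 - u 1 * v 0) * v 1) * e0 + v 1 * v 1 * hd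
  have f2 : u 1 * u 1 + v 1 * v 1 = 1 := by linear_combination uu + vv - f1
  have f3 : u 0 * u 1 + v 0 * v 1 = 0 := by
    linear_combination u 0 * e1 - (u 0 * v 1 - u 1 * v 0) * v 0 * e0 - v 0 * v 1 * hd
  ext i
  fin_cases i
  · simp
    linear_combination -(w 0) * f1 - w 1 * f3
  · simp
    linear_combination -(w 1) * f2 - w 0 * f3

/-! ### Triangles in coordinates, and when a disc fits into one. -/

namespace Triangle

/-- The full triangle as a subset of the plane. -/
def region (T : Triangle) : Set Plane := convexHull ℝ {T.L, T.Q, T.H}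

/-- The disc with centre `p` and radius `r` lies in the triangle. -/
def Fits (T : Triangle) (p : Plane) (r : ℝ) : Prop := Metric.closedBall p r ⊆ T.region

/-- The triangle with the roles of its two legs exchanged. -/
def swap (T : Triangle) : Triangle := ⟨T.H, T.Q, T.L⟩

/-- The child at the corner `L`, scaled by `lam`; `C` is the cosine of the angle at `L`. -/
def cornerChild (C lam : ℝ) (T : Triangle) : Triangle :=
  ⟨T.L, T.L + (lam * C) • (T.H - T.L), T.L + (lam / C) • (T.Q - T.L)⟩

theorem fits_swap {T : Triangle} {p : Plane} {r : ℝ} : T.swap.Fits p r ↔ T.Fits p r := by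
  have : ({T.H, T.Q, T.L} : Set Plane) = {T.L, T.Q, T.H} := by
    ext x; simp; tauto
  simp [Fits, region, swap, this]

/-- Orthonormal coordinates at the right angle of a triangle with hypotenuse `h` and legs
`C h` (along `u`) and `S h` (along `v`). -/
structure Frame (T : Triangle) (C S h : ℝ) (u v : Plane) : Prop where
  uu : inner ℝ u u = (1 : ℝ)
  vv : inner ℝ v v = (1 : ℝ)
  uv : inner ℝ u v = (0 : ℝ)
  hL : T.L = T.Q + (C * h) • u
  hH : T.H = T.Q + (S * h) • v

namespace Frame

variable {T : Triangle} {C S h lam t r : ℝ} {u v p q : Plane}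

theorem vu (F : T.Frame C S h u v) : inner ℝ v u = (0 : ℝ) := by rw [real_inner_comm, F.uv]

theorem swap (F : T.Frame C S h u v) : T.swap.Frame S C h v u :=
  ⟨F.vv, F.uu, F.vu, F.hH, F.hL⟩

/-- The child is a reflected, scaled copy of the parent: its legs run along the parent's hypotenuse
and along the inward normal of that hypotenuse. -/
theorem cornerChild (F : T.Frame C S h u v) (hA : IsAngle C S) (lam : ℝ) :
    (T.cornerChild C lam).Frame C S (lam * h) (C • u - S • v) (-(S • u + C • v)) := by
  have hC := hA.C_pos.ne'
  refine ⟨?_, ?_, ?_, ?_, ?_⟩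
  · simp only [inner_sub_left, inner_sub_right, real_inner_smul_left, real_inner_smul_right, F.uu,
      F.vv, F.uv, F.vu]
    linear_combination hA.sq
  · simp only [inner_neg_left, inner_neg_right, inner_add_left, inner_add_right,
      real_inner_smul_left, real_inner_smul_right, F.uu, F.vv, F.uv, F.vu]
    linear_combination hA.sq
  · simp only [inner_neg_right, inner_add_right, inner_sub_left,
      real_inner_smul_left, real_inner_smul_right, F.uu, F.vv, F.uv, F.vu]
    ring
  · simp only [Triangle.cornerChild, F.hL, F.hH]
    module
  · simp only [Triangle.cornerChild, F.hL, F.hH]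
    match_scalars
    · ring
    · field_simp
      linear_combination (lam * h) * hA.sq
    · ring

theorem x_cornerChild (F : T.Frame C S h u v) (lam : ℝ) (p : Plane) :
    inner ℝ (p - (T.cornerChild C lam).Q) (C • u - S • v) =
      C * inner ℝ (p - T.Q) u - S * inner ℝ (p - T.Q) v
        - C * h * (C - lam * (C ^ 2 + S ^ 2)) := by
  have : p - (T.cornerChild C lam).Q =
      (p - T.Q) - (C * h) • u + (lam * C * h) • (C • u - S • v) := by
    simp only [Triangle.cornerChild, F.hL, F.hH]; module
  rw [this]
  simp only [inner_sub_left (𝕜 := ℝ) _ ((C * h) • u), inner_add_left, inner_sub_right,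
    real_inner_smul_left, real_inner_smul_right, inner_sub_left (𝕜 := ℝ) (C • u),
    F.uu, F.vv, F.uv, F.vu]
  ring

theorem y_cornerChild (F : T.Frame C S h u v) (lam : ℝ) (p : Plane) :
    inner ℝ (p - (T.cornerChild C lam).Q) (-(S • u + C • v)) =
      S * C * h - S * inner ℝ (p - T.Q) u - C * inner ℝ (p - T.Q) v := by
  have : p - (T.cornerChild C lam).Q =
      (p - T.Q) - (C * h) • u + (lam * C * h) • (C • u - S • v) := by
    simp only [Triangle.cornerChild, F.hL, F.hH]; module
  rw [this]
  simp only [inner_sub_left (𝕜 := ℝ) _ ((C * h) • u), inner_add_left, inner_add_right,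
    inner_neg_right,
    real_inner_smul_left, real_inner_smul_right, inner_sub_left (𝕜 := ℝ) (C • u),
    F.uu, F.vv, F.uv, F.vu]
  ring

theorem norm_u (F : T.Frame C S h u v) : ‖u‖ = 1 := by
  have := F.uu
  rw [real_inner_self_eq_norm_sq] at this
  nlinarith [norm_nonneg u]

theorem norm_v (F : T.Frame C S h u v) : ‖v‖ = 1 := F.swap.norm_u

theorem dist_LQ (F : T.Frame C S h u v) (h0 : 0 ≤ C * h) : dist T.L T.Q = C * h := by
  rw [dist_eq_norm, F.hL, add_sub_cancel_left, norm_smul, F.norm_u, mul_one, Real.norm_of_nonneg h0]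

theorem dist_QH (F : T.Frame C S h u v) (h0 : 0 ≤ S * h) : dist T.Q T.H = S * h := by
  rw [dist_comm]; exact F.swap.dist_LQ h0

theorem dist_LH (F : T.Frame C S h u v) (hA : IsAngle C S) (h0 : 0 ≤ h) : dist T.L T.H = h := by
  have e : T.L - T.H = h • (C • u - S • v) := by rw [F.hL, F.hH]; module
  rw [dist_eq_norm, e, norm_smul, (F.cornerChild hA 1).norm_u, mul_one, Real.norm_of_nonneg h0]

theorem nonneg_of_mem_region (F : T.Frame C S h u v) (hA : IsAngle C S) (h0 : 0 ≤ h)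
    (hq : q ∈ T.region) :
    0 ≤ inner ℝ (q - T.Q) u ∧ 0 ≤ inner ℝ (q - T.Q) v ∧
      S * inner ℝ (q - T.Q) u + C * inner ℝ (q - T.Q) v ≤ S * C * h := by
  have hC := hA.C_pos
  have hS := hA.S_pos
  have hcv : Convex ℝ {q : Plane | 0 ≤ inner ℝ (q - T.Q) u ∧ 0 ≤ inner ℝ (q - T.Q) v ∧
      S * inner ℝ (q - T.Q) u + C * inner ℝ (q - T.Q) v ≤ S * C * h} := by
    intro x hx y hy a b ha hb hab
    obtain rfl : b = 1 - a := by linarith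
    have e : a • x + (1 - a) • y - T.Q = a • (x - T.Q) + (1 - a) • (y - T.Q) := by module
    obtain ⟨x1, x2, x3⟩ := hx
    obtain ⟨y1, y2, y3⟩ := hy
    simp only [Set.mem_ofPred_eq, e, inner_add_left, real_inner_smul_left]
    refine ⟨by positivity, by positivity, ?_⟩
    nlinarith [mul_le_mul_of_nonneg_left x3 ha, mul_le_mul_of_nonneg_left y3 hb]
  refine convexHull_min ?_ hcv hq
  rintro x (rfl | rfl | rfl)
  · simp only [F.hL, Set.mem_ofPred_eq, add_sub_cancel_left, real_inner_smul_left, F.uu, F.uv]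
    refine ⟨by positivity, by simp, by linarith⟩
  · simp only [Set.mem_ofPred_eq, sub_self, inner_zero_left]
    refine ⟨le_rfl, le_rfl, ?_⟩
    simp; positivity
  · simp only [F.hH, Set.mem_ofPred_eq, add_sub_cancel_left, real_inner_smul_left, F.vv, F.vu]
    refine ⟨by simp, by positivity, by linarith⟩

theorem mem_region (F : T.Frame C S h u v) (hA : IsAngle C S) (h0 : 0 < h)
    (h1 : 0 ≤ inner ℝ (q - T.Q) u) (h2 : 0 ≤ inner ℝ (q - T.Q) v)
    (h3 : S * inner ℝ (q - T.Q) u + C * inner ℝ (q - T.Q) v ≤ S * C * h) :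
    q ∈ T.region := by
  have hC := hA.C_pos
  have hS := hA.S_pos
  have e := eq_add_of_orthonormal F.uu F.vv F.uv (q - T.Q)
  set x : ℝ := inner ℝ (q - T.Q) u
  set y : ℝ := inner ℝ (q - T.Q) v
  have hw : x / (C * h) + y / (S * h) ≤ 1 := by
    rw [div_add_div _ _ (by positivity) (by positivity), div_le_one (by positivity)]
    nlinarith [mul_le_mul_of_nonneg_left h3 h0.le]
  -- Barycentric coordinates of `q`; the three inequalities say that they are nonnegative.
  have e' : q = (x / (C * h)) • T.L + (1 - x / (C * h) - y / (S * h)) • T.Q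
      + (y / (S * h)) • T.H := by
    rw [F.hL, F.hH, ← sub_add_cancel q T.Q, e]
    match_scalars
    · field_simp
    · field_simp
    · field_simp
      ring
  rw [e']
  have hcv := convex_convexHull ℝ ({T.L, T.Q, T.H} : Set Plane)
  have := hcv.sum_mem (t := Finset.univ)
    (w := ![x / (C * h), 1 - x / (C * h) - y / (S * h), y / (S * h)])
    (z := ![T.L, T.Q, T.H]) ?_ ?_ ?_
  · simpa [Fin.sum_univ_three, region] using this
  · intro i _
    fin_cases i
    · simp; positivity
    · simp; linarith
    · simp; positivity
  · simp [Fin.sum_univ_three]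
    ring
  · intro i _
    refine subset_convexHull ℝ _ ?_
    fin_cases i <;> simp

theorem abs_inner_le (F : T.Frame C S h u v) (hq : dist q p ≤ r) :
    |(inner ℝ (q - p) u : ℝ)| ≤ r := by
  refine (abs_real_inner_le_norm _ _).trans ?_
  rw [F.norm_u, mul_one, ← dist_eq_norm]
  exact hq

/-- Only the point of the disc nearest to each side matters, so containment becomes three linear
inequalities for the centre. All later containment arguments work with these inequalities. -/
theorem fits_iff (F : T.Frame C S h u v) (hA : IsAngle C S) (h0 : 0 < h) (hr : 0 ≤ r) :
    T.Fits p r ↔ r ≤ inner ℝ (p - T.Q) u ∧ r ≤ inner ℝ (p - T.Q) v ∧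
      S * inner ℝ (p - T.Q) u + C * inner ℝ (p - T.Q) v + r ≤ S * C * h := by
  have hC := hA.C_pos
  have hS := hA.S_pos
  -- The second axis of the corner child is the inward unit normal of the hypotenuse.
  have F' := F.cornerChild hA 1
  constructor
  · intro hf
    have key : ∀ w : Plane, ‖w‖ = 1 → p - r • w ∈ T.region := by
      intro w hw
      apply hf
      rw [Metric.mem_closedBall, dist_eq_norm, sub_sub_cancel_left, norm_neg, norm_smul, hw, mul_one,
        Real.norm_of_nonneg hr]
    refine ⟨?_, ?_, ?_⟩
    · have := (F.nonneg_of_mem_region hA h0.le (key u F.norm_u)).1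
      rw [sub_right_comm, inner_sub_left, real_inner_smul_left, F.uu] at this
      linarith
    · have := (F.nonneg_of_mem_region hA h0.le (key v F.norm_v)).2.1
      rw [sub_right_comm, inner_sub_left, real_inner_smul_left, F.vv] at this
      linarith
    · have := (F.nonneg_of_mem_region hA h0.le (key _ F'.norm_v)).2.2
      rw [sub_right_comm] at this
      simp only [inner_sub_left (𝕜 := ℝ) (p - T.Q), real_inner_smul_left, inner_neg_left,
        inner_add_left, F.uu, F.vv, F.uv, F.vu] at this
      linear_combination this - r * hA.sq
  · rintro ⟨h1, h2, h3⟩ q hq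
    rw [Metric.mem_closedBall] at hq
    have a1 := abs_le.1 (F.abs_inner_le hq)
    have a2 := abs_le.1 (F.swap.abs_inner_le hq)
    have a3 := abs_le.1 (F'.swap.abs_inner_le hq)
    have e : q - T.Q = (q - p) + (p - T.Q) := by abel
    rw [inner_neg_right, inner_add_right, real_inner_smul_right, real_inner_smul_right] at a3
    apply F.mem_region hA h0 <;> rw [e] <;> simp only [inner_add_left] <;> linarith

end Frame
end Triangle

/-! ### Areas and radii. -/

/-- The radius of a disc of area `a`. -/
def rad (a : ℝ) : ℝ := √(a / π)

theorem rad_nonneg (a : ℝ) : 0 ≤ rad a := Real.sqrt_nonneg _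

theorem rad_pos {a : ℝ} (ha : 0 < a) : 0 < rad a := Real.sqrt_pos.2 (by positivity)

theorem rad_mono {a b : ℝ} (h : a ≤ b) : rad a ≤ rad b :=
  Real.sqrt_le_sqrt (by gcongr)

theorem sqrt_eq_rad (a : ℝ) : √a = √π * rad a := by
  rw [rad, ← Real.sqrt_mul Real.pi_pos.le, mul_div_cancel₀ _ Real.pi_ne_zero]

theorem sqrt_pi_pos : 0 < √π := Real.sqrt_pos.2 Real.pi_pos

/-- Size conditions are linear in square roots of areas, so they pass to radii by the common factor
`√π`. -/
theorem sqrt_le_iff_rad_le {a b c k l : ℝ} :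
    √a ≤ k * √b + l * √c ↔ rad a ≤ k * rad b + l * rad c := by
  rw [sqrt_eq_rad a, sqrt_eq_rad b, sqrt_eq_rad c,
    show k * (√π * rad b) + l * (√π * rad c) = √π * (k * rad b + l * rad c) by ring]
  exact mul_le_mul_iff_right₀ sqrt_pi_pos

theorem sqrt_div_eq_rad {a b : ℝ} (ha : 0 ≤ a) : √(a / b) = rad a / rad b := by
  rw [Real.sqrt_div ha, sqrt_eq_rad a, sqrt_eq_rad b, mul_div_mul_left _ _ sqrt_pi_pos.ne']

theorem dist_le_of_inner {p q w : Plane} {d : ℝ} (hw : ‖w‖ = 1)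
    (h : d ≤ inner ℝ (p - q) w) : d ≤ dist p q := by
  have := real_inner_le_norm (p - q) w
  rw [hw, mul_one, ← dist_eq_norm] at this
  linarith

/-! ### Discs in the two corner children of a triangle. -/

namespace Triangle

/-- A right-angled triangle of capacity `a` with acute angle of cosine `C` and sine `S` at `L`. -/
def IsRight (C S a : ℝ) (T : Triangle) : Prop :=
  ∃ (h : ℝ) (u v : Plane), 0 < h ∧ T.Frame C S h u v ∧ a = π * (h * (C + S - 1) / 2) ^ 2

/-- The disc of centre `p` and radius `r` lies beyond the line that is orthogonal to the
hypotenuse and is tangent to the `t`-scaled incircle at the corner `L`. -/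
def ClearHyp (S t : ℝ) (T : Triangle) (p : Plane) (r : ℝ) : Prop :=
  r * dist T.L T.H + (1 - S) * t * dist T.L T.H ^ 2 ≤ inner ℝ (p - T.L) (T.H - T.L)

/-- The analogue of `ClearHyp` for the line that is orthogonal to the leg `L Q`. -/
def ClearLeg (S t : ℝ) (T : Triangle) (p : Plane) (r : ℝ) : Prop :=
  r * dist T.L T.Q + (1 - S) * t * dist T.L T.H * dist T.L T.Q ≤ inner ℝ (p - T.L) (T.Q - T.L)

theorem Frame.clearHyp_iff {T : Triangle} {C S h t r : ℝ} {u v p : Plane}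
    (F : T.Frame C S h u v) (hA : IsAngle C S) (h0 : 0 < h) :
    T.ClearHyp S t p r ↔ r + (1 - S) * t * h ≤
      S * inner ℝ (p - T.Q) v - C * inner ℝ (p - T.Q) u + C ^ 2 * h := by
  have e1 : p - T.L = (p - T.Q) - (C * h) • u := by rw [F.hL]; module
  have e2 : T.H - T.L = h • (S • v - C • u) := by rw [F.hL, F.hH]; module
  have key : (inner ℝ (p - T.L) (T.H - T.L) : ℝ) =
      h * (S * inner ℝ (p - T.Q) v - C * inner ℝ (p - T.Q) u + C ^ 2 * h) := by
    rw [e1, e2]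
    simp only [inner_sub_left (𝕜 := ℝ) (p - T.Q), inner_sub_right, real_inner_smul_left,
      real_inner_smul_right, F.uu, F.uv]
    ring
  rw [ClearHyp, F.dist_LH hA h0.le, key,
    show r * h + (1 - S) * t * h ^ 2 = h * (r + (1 - S) * t * h) by ring]
  exact mul_le_mul_iff_right₀ h0

theorem Frame.clearLeg_iff {T : Triangle} {C S h t r : ℝ} {u v p : Plane}
    (F : T.Frame C S h u v) (hA : IsAngle C S) (h0 : 0 < h) :
    T.ClearLeg S t p r ↔ r + (1 - S) * t * h ≤ C * h - inner ℝ (p - T.Q) u := by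
  have hC := hA.C_pos
  have e1 : p - T.L = (p - T.Q) - (C * h) • u := by rw [F.hL]; module
  have e2 : T.Q - T.L = (C * h) • (-u) := by rw [F.hL]; module
  have key : (inner ℝ (p - T.L) (T.Q - T.L) : ℝ) =
      C * h * (C * h - inner ℝ (p - T.Q) u) := by
    rw [e1, e2]
    simp only [inner_sub_left (𝕜 := ℝ) (p - T.Q), inner_neg_right, real_inner_smul_left,
      real_inner_smul_right, F.uu]
    ring
  rw [ClearLeg, F.dist_LH hA h0.le, F.dist_LQ (by positivity), key,
    show r * (C * h) + (1 - S) * t * h * (C * h) = C * h * (r + (1 - S) * t * h) by ring]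
  exact mul_le_mul_iff_right₀ (by positivity)

namespace IsRight

variable {C S a a₁ a₂ b b₀ r r' : ℝ} {T : Triangle} {p q : Plane}

theorem swap (hT : T.IsRight C S a) : T.swap.IsRight S C a := by
  obtain ⟨h, u, v, h0, F, rfl⟩ := hT
  exact ⟨h, v, u, h0, F.swap, by ring⟩

theorem rad_eq {C S h : ℝ} (hA : IsAngle C S) (h0 : 0 < h) :
    rad (π * (h * (C + S - 1) / 2) ^ 2) = h * (C + S - 1) / 2 := by
  have := hA.one_lt_add
  rw [rad, mul_div_cancel_left₀ _ Real.pi_ne_zero, Real.sqrt_sq]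
  have : 0 < C + S - 1 := by linarith
  positivity

theorem area_pos (hA : IsAngle C S) (hT : T.IsRight C S a) : 0 < a := by
  obtain ⟨h, u, v, h0, F, rfl⟩ := hT
  have : 0 < C + S - 1 := by linarith [hA.one_lt_add]
  positivity

theorem cornerChild (hA : IsAngle C S) (hT : T.IsRight C S a) (h1 : 0 < a₁) :
    (T.cornerChild C √(a₁ / a)).IsRight C S a₁ := by
  have ha := hT.area_pos hA
  obtain ⟨h, u, v, h0, F, ea⟩ := hT
  refine ⟨_, _, _, ?_, F.cornerChild hA _, ?_⟩
  · positivity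
  · have := Real.sq_sqrt (show 0 ≤ a₁ / a by positivity)
    calc a₁ = (a₁ / a) * a := by field_simp
      _ = (√(a₁ / a)) ^ 2 * (π * (h * (C + S - 1) / 2) ^ 2) := by rw [this, ← ea]
      _ = _ := by ring

/-- The only side of the parent that the child at `L` can cross is the leg `Q H`, beyond which its
acute corner protrudes. The size condition is the limiting case in which a disc touches both sides
of that corner and the leg. -/
theorem fits_of_cornerChild (hA : IsAngle C S) (hT : T.IsRight C S a) (h1 : 0 < a₁)
    (hf : (T.cornerChild C √(a₁ / a)).Fits p (rad b)) (hb : √a₁ ≤ C * √a + (1 - C) * √b) :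
    T.Fits p (rad b) := by
  have ha := hT.area_pos hA
  obtain ⟨h, u, v, h0, F, ea⟩ := hT
  have hC := hA.C_pos
  have hCS : 0 < C + S - 1 := by linarith [hA.one_lt_add]
  have h0' : 0 < √(a₁ / a) * h := by positivity
  rw [(F.cornerChild hA _).fits_iff hA h0' (rad_nonneg _), F.x_cornerChild, F.y_cornerChild] at hf
  rw [F.fits_iff hA h0 (rad_nonneg _)]
  rw [sqrt_le_iff_rad_le] at hb
  have hra := rad_eq hA h0
  rw [← ea] at hra
  have hlam : rad a₁ = √(a₁ / a) * rad a := by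
    rw [sqrt_div_eq_rad h1.le]; have := rad_pos ha; field_simp
  rw [hlam, hra] at hb
  set x : ℝ := inner ℝ (p - T.Q) u
  set y : ℝ := inner ℝ (p - T.Q) v
  set l := √(a₁ / a)
  set r := rad b
  obtain ⟨f1, f2, f3⟩ := hf
  have e := hA.sq
  rw [e] at f1
  have f4 : r ≤ y := by linear_combination f3 + (y - S * C * l * h) * e
  refine ⟨?_, f4, by linarith⟩
  -- The identity `(C + S - 1) * (1 + S - C) = 2 * C * (1 - C)` converts the condition on inradii
  -- into one on hypotenuses.
  have k1 : C * h * (l - C) * (C + S - 1) ≤ r * (1 + S - C) * (C + S - 1) := by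
    linear_combination (2 * C) * hb - r * e
  have k2 : C * h * (l - C) ≤ r * (1 + S - C) := le_of_mul_le_mul_right k1 hCS
  have k3 : r * C ≤ x * C := by linarith [mul_le_mul_of_nonneg_left f4 hA.S_pos.le]
  exact le_of_mul_le_mul_right k3 hC

/-- The children have legs of lengths `√(a₁ / a) * C * h` and `√(a₂ / a) * S * h` on the hypotenuse.
By Cauchy–Schwarz these add up to at most `h`, so a line orthogonal to the hypotenuse separates the
discs. -/
theorem add_le_dist (hA : IsAngle C S) (hT : T.IsRight C S a) (h1 : 0 < a₁) (h2 : 0 < a₂)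
    (h12 : a₁ + a₂ ≤ a) (hr : 0 ≤ r) (hr' : 0 ≤ r')
    (hp : (T.cornerChild C √(a₁ / a)).Fits p r)
    (hq : (T.swap.cornerChild S √(a₂ / a)).swap.Fits q r') : r + r' ≤ dist p q := by
  have ha := hT.area_pos hA
  obtain ⟨h, u, v, h0, F, ea⟩ := hT
  rw [fits_swap] at hq
  have G := F.cornerChild hA √(a₁ / a)
  have h0' : 0 < √(a₁ / a) * h := by positivity
  have h0'' : 0 < √(a₂ / a) * h := by positivity
  rw [G.fits_iff hA h0' hr, F.x_cornerChild, hA.sq] at hp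
  rw [(F.swap.cornerChild hA.swap _).fits_iff hA.swap h0'' hr', F.swap.x_cornerChild, hA.swap.sq]
    at hq
  have hc : √(a₁ / a) * C + √(a₂ / a) * S ≤ 1 := by
    apply hA.cauchy
    rw [Real.sq_sqrt (by positivity), Real.sq_sqrt (by positivity), ← add_div, div_le_one ha]
    exact h12
  refine dist_le_of_inner G.norm_u ?_
  have e : p - q = (p - T.Q) - (q - T.Q) := by abel
  rw [e]
  simp only [inner_sub_left (𝕜 := ℝ) (p - T.Q), inner_sub_right (𝕜 := ℝ) _ (C • u),
    real_inner_smul_right]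
  have e2 : T.swap.Q = T.Q := rfl
  rw [e2] at hq
  linarith [hp.1, hq.1, mul_le_mul_of_nonneg_left hc h0.le, hA.sq, mul_comm h (C ^ 2 + S ^ 2),
    congrArg (h * ·) hA.sq]

/-- A disc of area `b₀` comes closest to the corner `L` when it touches both sides there, and then
both lines are tangent to it. A larger disc can only be further away. -/
theorem clear_of_le (hA : IsAngle C S) (hT : T.IsRight C S a) (hb₀ : 0 ≤ b₀) (hb : b₀ ≤ b)
    (hf : T.Fits p (rad b)) :
    T.ClearHyp S √(b₀ / a) p (rad b) ∧ T.ClearLeg S √(b₀ / a) p (rad b) := by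
  have ha := hT.area_pos hA
  obtain ⟨h, u, v, h0, F, ea⟩ := hT
  have hS := hA.S_pos
  have hC := hA.C_pos
  have hCS : 0 < C + S - 1 := by linarith [hA.one_lt_add]
  rw [F.clearHyp_iff hA h0, F.clearLeg_iff hA h0]
  rw [F.fits_iff hA h0 (rad_nonneg _)] at hf
  have hra := rad_eq hA h0
  rw [← ea] at hra
  have ht : √(b₀ / a) * rad a = rad b₀ := by
    rw [sqrt_div_eq_rad hb₀]; have := rad_pos ha; field_simp
  have hrb := rad_mono hb
  rw [hra] at ht
  rw [← ht] at hrb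
  set x : ℝ := inner ℝ (p - T.Q) u
  set y : ℝ := inner ℝ (p - T.Q) v
  set t := √(b₀ / a)
  set r := rad b
  have e := hA.sq
  -- Here the identity is `(C + S - 1) * (1 + C - S) = 2 * S * (1 - S)`.
  have k : S * ((1 - S) * t * h) ≤ r * (1 + C - S) := by
    refine le_of_mul_le_mul_right ?_ hCS
    have h3 : 0 ≤ 2 * S * (1 - S) := by have := hA.S_lt_one; nlinarith
    linear_combination (mul_le_mul_of_nonneg_left hrb h3) - r * e
  obtain ⟨f1, f2, f3⟩ := hf
  constructor
  · refine le_of_mul_le_mul_left ?_ hS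
    linear_combination k + f2 + C * f3 - y * e
  · refine le_of_mul_le_mul_left ?_ hS
    nlinarith [mul_le_mul_of_nonneg_left f2 hC.le]

theorem clear_zero (hA : IsAngle C S) (hT : T.IsRight C S a) (hb : 0 ≤ b)
    (hf : T.Fits p (rad b)) : T.ClearHyp S √(0 / a) p (rad b) :=
  (hT.clear_of_le hA le_rfl hb hf).1

/-- The child has its hypotenuse on the parent's leg and its leg on the parent's hypotenuse, so the
two conditions trade places; this is why they are carried together. The distance of the lines from
`L` depends on `b` alone, not on which of the two triangles is used. -/
theorem clear_of_cornerChild (hA : IsAngle C S) (hT : T.IsRight C S a) (h1 : 0 < a₁)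
    (hb : 0 ≤ b)
    (hH : (T.cornerChild C √(a₁ / a)).ClearHyp S √(b / a₁) p r)
    (hL : (T.cornerChild C √(a₁ / a)).ClearLeg S √(b / a₁) p r) :
    T.ClearHyp S √(b / a) p r ∧ T.ClearLeg S √(b / a) p r := by
  have ha := hT.area_pos hA
  obtain ⟨h, u, v, h0, F, ea⟩ := hT
  have h0' : 0 < √(a₁ / a) * h := by positivity
  have G := F.cornerChild hA √(a₁ / a)
  rw [G.clearHyp_iff hA h0', F.x_cornerChild, F.y_cornerChild, hA.sq] at hH
  rw [G.clearLeg_iff hA h0', F.x_cornerChild, hA.sq] at hL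
  rw [F.clearHyp_iff hA h0, F.clearLeg_iff hA h0]
  have hs : √(b / a₁) * √(a₁ / a) = √(b / a) := by
    rw [← Real.sqrt_mul (by positivity), div_mul_div_cancel₀ h1.ne']
  have hs' : (1 - S) * √(b / a₁) * (√(a₁ / a) * h) = (1 - S) * √(b / a) * h := by
    rw [← hs]; ring
  rw [hs'] at hH hL
  set x : ℝ := inner ℝ (p - T.Q) u
  set y : ℝ := inner ℝ (p - T.Q) v
  constructor
  · linarith
  · have e := hA.sq
    linear_combination hH + (C * h - x) * e

/-- The scale factors `w` of the child at `H` and `t` of the reserved corner satisfy `w ^ 2 + t ^ 2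
≤ 1`, so even the part of the child nearest to `L` lies beyond the two lines. -/
theorem clear_of_swap_cornerChild (hA : IsAngle C S) (hT : T.IsRight C S a)
    (h2 : 0 < a₂) (h12 : a₁ + a₂ ≤ a) (hb : 0 ≤ b) (hb1 : b ≤ a₁) (hr : 0 ≤ r)
    (hq : (T.swap.cornerChild S √(a₂ / a)).swap.Fits p r) :
    T.ClearHyp S √(b / a) p r ∧ T.ClearLeg S √(b / a) p r := by
  have ha := hT.area_pos hA
  obtain ⟨h, u, v, h0, F, ea⟩ := hT
  rw [fits_swap] at hq
  have h0' : 0 < √(a₂ / a) * h := by positivity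
  rw [(F.swap.cornerChild hA.swap _).fits_iff hA.swap h0' hr, F.swap.x_cornerChild, hA.swap.sq,
    F.swap.y_cornerChild] at hq
  rw [F.clearHyp_iff hA h0, F.clearLeg_iff hA h0]
  have e2 : T.swap.Q = T.Q := rfl
  rw [e2] at hq
  have hw : √(a₂ / a) ^ 2 + √(b / a) ^ 2 ≤ 1 := by
    rw [Real.sq_sqrt (by positivity), Real.sq_sqrt (by positivity), ← add_div, div_le_one ha]
    linarith
  have hw0 := Real.sqrt_nonneg (a₂ / a)
  have ht0 := Real.sqrt_nonneg (b / a)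
  set x : ℝ := inner ℝ (p - T.Q) u
  set y : ℝ := inner ℝ (p - T.Q) v
  set w := √(a₂ / a)
  set t := √(b / a)
  have e := hA.sq
  have hS := hA.S_pos
  have hC := hA.C_pos
  have hS1 := hA.S_lt_one
  have hw1 : w ≤ 1 := by nlinarith
  have ht1 : t ≤ 1 := by nlinarith
  obtain ⟨f1, f2, f3⟩ := hq
  constructor
  · have k : (1 - S) * t ≤ 1 - w * S := by nlinarith
    linear_combination f1 + h * k - h * e
  · have k : w * (C * S) + t * (1 - S) ≤ C := by
      have k2 : (w * (C * S) + t * (1 - S)) ^ 2 ≤ C ^ 2 := by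
        have k3 : (w * (C * S) + t * (1 - S)) ^ 2 ≤ (w ^ 2 + t ^ 2) * ((C * S) ^ 2 + (1 - S) ^ 2) := by
          nlinarith [sq_nonneg (w * (1 - S) - t * (C * S))]
        have k4 : (C * S) ^ 2 + (1 - S) ^ 2 ≤ C ^ 2 := by
          have : C ^ 2 = (1 - S) * (1 + S) := by linarith
          rw [mul_pow, this]
          nlinarith [mul_nonneg (mul_nonneg (sub_nonneg.2 hS1.le) (sub_nonneg.2 hS1.le)) hS.le,
            mul_nonneg (mul_nonneg (mul_nonneg (sub_nonneg.2 hS1.le) (sub_nonneg.2 hS1.le)) hS.le) hS.le]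
        nlinarith [sq_nonneg (C * S), sq_nonneg (1 - S)]
      exact le_of_sq_le_sq k2 hC.le
    nlinarith [mul_le_mul_of_nonneg_left f1 hC.le, mul_le_mul_of_nonneg_left f2 hS.le,
      mul_le_mul_of_nonneg_left k h0.le, mul_nonneg hr (sub_nonneg.2 hA.one_lt_add.le)]

/-- The child at `H` has its hypotenuse on the ray `H Q`, and an oversized one crosses only the leg
`L Q`, with its own corner `L`. `ClearHyp` in the child measures the distance to that leg. One large
circle therefore permits an excess even for the small circles packed with it. -/
theorem fits_of_swap_cornerChild (hA : IsAngle C S) (hT : T.IsRight C S a) (h2 : 0 < a₂)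
    (hb : 0 ≤ b) (hr : 0 ≤ r)
    (hq : (T.swap.cornerChild S √(a₂ / a)).swap.Fits p r)
    (hc : (T.swap.cornerChild S √(a₂ / a)).swap.ClearHyp S √(b / a₂) p r)
    (hab : √a₂ ≤ S * √a + (1 - S) * √b) : T.Fits p r := by
  have ha := hT.area_pos hA
  obtain ⟨h, u, v, h0, F, ea⟩ := hT
  rw [fits_swap] at hq
  have h0' : 0 < √(a₂ / a) * h := by positivity
  have G := F.swap.cornerChild hA.swap √(a₂ / a)
  rw [G.swap.clearHyp_iff hA h0'] at hc
  rw [G.fits_iff hA.swap h0' hr] at hq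
  have e3 : ((T.swap.cornerChild S √(a₂ / a)).swap).Q = (T.swap.cornerChild S √(a₂ / a)).Q := rfl
  rw [e3] at hc
  rw [F.swap.x_cornerChild, hA.swap.sq, F.swap.y_cornerChild] at hc hq
  have e2 : T.swap.Q = T.Q := rfl
  rw [e2] at hq hc
  rw [F.fits_iff hA h0 hr]
  have hl : (1 - S) * √(b / a₂) * (√(a₂ / a) * h) = (1 - S) * √(b / a) * h := by
    rw [mul_assoc, ← mul_assoc (√(b / a₂)), ← Real.sqrt_mul (by positivity),
      div_mul_div_cancel₀ h2.ne', mul_assoc]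
  rw [hl] at hc
  have hk : √(a₂ / a) ≤ S + (1 - S) * √(b / a) := by
    have hsa := Real.sqrt_pos.2 ha
    rw [Real.sqrt_div h2.le, Real.sqrt_div hb, div_le_iff₀ hsa]
    have : (S + (1 - S) * (√b / √a)) * √a = S * √a + (1 - S) * √b := by field_simp
    rw [this]; exact hab
  set x : ℝ := inner ℝ (p - T.Q) u
  set y : ℝ := inner ℝ (p - T.Q) v
  have e := hA.sq
  obtain ⟨f1, f2, f3⟩ := hq
  refine ⟨?_, ?_, by linarith⟩
  · linear_combination f3 + x * e
  · linear_combination hc + h * hk + (y - S * h + h * √(a₂ / a)) * e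

end IsRight
end Triangle

/-! ### Lists of circles -/

/-- All circles of the list have positive area. -/
def AllPos (C : List Disc) : Prop := ∀ c ∈ C, 0 < c.area

theorem total_nil : total [] = 0 := rfl

theorem total_cons (c : Disc) (C : List Disc) : total (c :: C) = c.area + total C := by
  simp [total]

theorem total_append (C D : List Disc) : total (C ++ D) = total C + total D := by
  simp [total]

theorem total_perm {C D : List Disc} (h : C.Perm D) : total C = total D :=
  (h.map Disc.area).sum_eq

theorem AllPos.total_nonneg {C : List Disc} (h : AllPos C) : 0 ≤ total C :=
  List.sum_nonneg (by simpa using fun c hc => (h c hc).le)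

theorem AllPos.le_total {C : List Disc} (h : AllPos C) {c : Disc} (hc : c ∈ C) :
    c.area ≤ total C := by
  rw [total_perm (List.perm_cons_erase hc), total_cons]
  have : AllPos (C.erase c) := fun d hd => h d (List.mem_of_mem_erase hd)
  linarith [this.total_nonneg]

theorem AllPos.total_pos {C : List Disc} (h : AllPos C) (hC : C ≠ []) : 0 < total C := by
  obtain ⟨c, hc⟩ := List.exists_mem_of_ne_nil C hC
  exact (h c hc).trans_le (h.le_total hc)

theorem AllPos.subset {C D : List Disc} (h : AllPos C) (hD : D ⊆ C) : AllPos D :=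
  fun c hc => h c (hD hc)

theorem sortDesc_perm (C : List Disc) : (sortDesc C).Perm C := List.perm_insertionSort _ _

theorem mem_sortDesc {C : List Disc} {c : Disc} : c ∈ sortDesc C ↔ c ∈ C :=
  (sortDesc_perm C).mem_iff

theorem sortDesc_pairwise (C : List Disc) :
    (sortDesc C).Pairwise (fun c d => d.area ≤ c.area) := by
  have : Std.Total (fun c d : Disc => d.area ≤ c.area) := ⟨fun a b => le_total _ _⟩
  have : IsTrans Disc (fun c d : Disc => d.area ≤ c.area) := ⟨fun a b c h1 h2 => h2.trans h1⟩
  exact List.pairwise_insertionSort _ C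

/-! ### The greedy split -/

/-- A circle goes to the part that is behind, so without its last circle neither part exceeds its
proportional share. Since the order is decreasing, removing any other circle of the part removes at
least as much. -/
theorem splitLoop_spec {f₁ f₂ : ℝ} (h₁ : 0 < f₁) (h₂ : 0 < f₂) :
    ∀ (L C₁ C₂ : List Disc), AllPos L → L.Pairwise (fun c d => d.area ≤ c.area) →
      (∀ c ∈ L, ∀ d ∈ C₁ ++ C₂, c.area ≤ d.area) →
      (∀ d ∈ C₁, (total C₁ - d.area) / f₁ ≤ total C₂ / f₂) →
      (∀ d ∈ C₂, (total C₂ - d.area) / f₂ ≤ total C₁ / f₁) →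
      ((splitLoop f₁ f₂ L C₁ C₂).1 ++ (splitLoop f₁ f₂ L C₁ C₂).2).Perm (C₁ ++ C₂ ++ L) ∧
      C₂ ⊆ (splitLoop f₁ f₂ L C₁ C₂).2 ∧
      (∀ d ∈ (splitLoop f₁ f₂ L C₁ C₂).1,
        (total (splitLoop f₁ f₂ L C₁ C₂).1 - d.area) / f₁ ≤
          total (splitLoop f₁ f₂ L C₁ C₂).2 / f₂) ∧
      (∀ d ∈ (splitLoop f₁ f₂ L C₁ C₂).2,
        (total (splitLoop f₁ f₂ L C₁ C₂).2 - d.area) / f₂ ≤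
          total (splitLoop f₁ f₂ L C₁ C₂).1 / f₁) := by
  intro L
  induction L with
  | nil =>
    intro C₁ C₂ _ _ _ i1 i2
    simpa [splitLoop] using ⟨i1, i2⟩
  | cons c L ih =>
    intro C₁ C₂ hp hs hle i1 i2
    have hc : 0 < c.area := hp c (by simp)
    have hp' : AllPos L := fun d hd => hp d (by simp [hd])
    rw [List.pairwise_cons] at hs
    unfold splitLoop
    split_ifs with hlt
    · have hle' : ∀ x ∈ L, ∀ d ∈ (C₁ ++ [c]) ++ C₂, x.area ≤ d.area := by
        intro x hx d hd
        simp only [List.append_assoc, List.mem_append, List.mem_singleton] at hd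
        rcases hd with hd | rfl | hd
        · exact hle x (by simp [hx]) d (by simp [hd])
        · exact hs.1 x hx
        · exact hle x (by simp [hx]) d (by simp [hd])
      obtain ⟨k1, k2, k3, k4⟩ := ih (C₁ ++ [c]) C₂ hp' hs.2 hle' (by
          intro d hd
          have hcd : c.area ≤ d.area := by
            simp only [List.mem_append, List.mem_singleton] at hd
            rcases hd with hd | rfl
            · exact hle c (by simp) d (by simp [hd])
            · exact le_rfl
          refine le_trans ?_ hlt.le
          gcongr
          rw [total_append, total_cons, total_nil]; linarith) (by
          intro d hd
          refine (i2 d hd).trans ?_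
          gcongr
          rw [total_append, total_cons, total_nil]; linarith)
      refine ⟨k1.trans ?_, k2, k3, k4⟩
      rw [List.append_assoc, List.append_assoc, List.append_assoc]
      refine List.Perm.append_left _ ?_
      simpa using (List.perm_middle (a := c) (l₁ := C₂) (l₂ := L)).symm
    · have hle' : ∀ x ∈ L, ∀ d ∈ C₁ ++ (C₂ ++ [c]), x.area ≤ d.area := by
        intro x hx d hd
        simp only [List.mem_append, List.mem_singleton] at hd
        rcases hd with hd | hd | rfl
        · exact hle x (by simp [hx]) d (by simp [hd])
        · exact hle x (by simp [hx]) d (by simp [hd])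
        · exact hs.1 x hx
      obtain ⟨k1, k2, k3, k4⟩ := ih C₁ (C₂ ++ [c]) hp' hs.2 hle' (by
          intro d hd
          refine (i1 d hd).trans ?_
          gcongr
          rw [total_append, total_cons, total_nil]; linarith) (by
          intro d hd
          have hcd : c.area ≤ d.area := by
            simp only [List.mem_append, List.mem_singleton] at hd
            rcases hd with hd | rfl
            · exact hle c (by simp) d (by simp [hd])
            · exact le_rfl
          refine le_trans ?_ (not_lt.1 hlt)
          gcongr
          rw [total_append, total_cons, total_nil]; linarith)
      refine ⟨k1.trans (by simp), fun x hx => k2 (by simp [hx]), k3, k4⟩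

/-- The properties of a partition by the greedy split. -/
theorem split_spec {s : ℝ} (hs : 0 < s) {C : List Disc} (hC : AllPos C) :
    ((split s C).1 ++ (split s C).2).Perm C ∧
    (∀ d ∈ (split s C).1, s ^ 2 * (total (split s C).1 - d.area) ≤ total (split s C).2) ∧
    (∀ d ∈ (split s C).2, total (split s C).2 - d.area ≤ s ^ 2 * total (split s C).1) ∧
    (∀ d ∈ C, ∃ e ∈ (split s C).2, d.area ≤ e.area) := by
  have hs2 : 0 < s ^ 2 := by positivity
  obtain ⟨k1, -, k3, k4⟩ := splitLoop_spec one_pos hs2 (sortDesc C) [] []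
    (fun c hc => hC c (mem_sortDesc.1 hc)) (sortDesc_pairwise C) (by simp) (by simp) (by simp)
  have hperm : ((split s C).1 ++ (split s C).2).Perm C := by
    unfold split
    simpa only [List.append_nil, List.nil_append] using k1.trans (sortDesc_perm C)
  refine ⟨hperm, ?_, ?_, ?_⟩
  · intro d hd
    have := k3 d hd
    rw [div_one, le_div_iff₀ hs2] at this
    unfold split
    linarith
  · intro d hd
    have := k4 d hd
    rw [div_one, div_le_iff₀ hs2] at this
    unfold split
    linarith
  · intro d hd
    have hd' : d ∈ sortDesc C := mem_sortDesc.2 hd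
    have hsort := sortDesc_pairwise C
    have hpos : AllPos (sortDesc C) := fun c hc => hC c (mem_sortDesc.1 hc)
    unfold split
    cases hL : sortDesc C with
    | nil => simp [hL] at hd'
    | cons c L =>
      rw [hL] at hd' hsort hpos
      rw [List.pairwise_cons] at hsort
      -- At the start both sums vanish, so the strict comparison fails and the largest circle goes
      -- to the long part.
      have e : splitLoop 1 (s ^ 2) (c :: L) [] [] = splitLoop 1 (s ^ 2) L [] [c] := by
        simp [splitLoop, total_nil]
      rw [e]
      obtain ⟨-, m2, -, -⟩ := splitLoop_spec one_pos hs2 L [] [c]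
        (fun x hx => hpos x (by simp [hx])) hsort.2 (by simpa using hsort.1) (by simp)
        (by simp [total])
      refine ⟨c, m2 (by simp), ?_⟩
      rcases List.mem_cons.1 hd' with rfl | h
      · exact le_rfl
      · exact hsort.1 d h

/-! ### Offline Split Packing -/

/-- Cosine of the angle at the corner `L`. -/
def cosL (s : ℝ) : ℝ := s / √(1 + s ^ 2)

/-- Sine of the angle at the corner `L`. -/
def sinL (s : ℝ) : ℝ := 1 / √(1 + s ^ 2)

theorem cosL_sq (s : ℝ) : cosL s ^ 2 = s ^ 2 / (1 + s ^ 2) := by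
  rw [cosL, div_pow, Real.sq_sqrt (by positivity)]

theorem sinL_sq (s : ℝ) : sinL s ^ 2 = 1 / (1 + s ^ 2) := by
  rw [sinL, div_pow, Real.sq_sqrt (by positivity), one_pow]

theorem isAngle {s : ℝ} (hs : 0 < s) : IsAngle (cosL s) (sinL s) where
  C_pos := by unfold cosL; positivity
  S_pos := by unfold sinL; positivity
  sq := by rw [cosL_sq, sinL_sq]; field_simp; ring

/-- The square of the right-hand side exceeds `k ^ 2 * a + (1 - k ^ 2) * b` by `2 * k * (1 - k) * √b
* (√a - √b)`. -/
theorem sqrt_le_mix {k a a₁ b : ℝ} (hk : 0 ≤ k) (hk1 : k ≤ 1) (hb : 0 ≤ b) (hba : b ≤ a)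
    (h : a₁ ≤ k ^ 2 * a + (1 - k ^ 2) * b) : √a₁ ≤ k * √a + (1 - k) * √b := by
  have h1 := Real.sqrt_nonneg a
  have h2 := Real.sqrt_nonneg b
  have h3 := Real.sqrt_le_sqrt hba
  have h4 := Real.sq_sqrt (hb.trans hba)
  have h5 := Real.sq_sqrt hb
  refine Real.sqrt_le_iff.2 ⟨by nlinarith, h.trans ?_⟩
  set x := √a
  set y := √b
  rw [← h4, ← h5]
  nlinarith [mul_nonneg (mul_nonneg (mul_nonneg hk (sub_nonneg.2 hk1)) h2) (sub_nonneg.2 h3)]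

theorem sqrt_le_mix_of_le {k a a₁ b : ℝ} (hk : 0 ≤ k) (hk1 : k ≤ 1)
    (h : a₁ ≤ k ^ 2 * a) : √a₁ ≤ k * √a + (1 - k) * √b := by
  have h2 := Real.sqrt_nonneg b
  have h3 := Real.sqrt_le_sqrt h
  rw [Real.sqrt_mul (by positivity), Real.sqrt_sq hk] at h3
  nlinarith

theorem fits_incenter {C S a b : ℝ} {T : Triangle} (hA : IsAngle C S) (hT : T.IsRight C S a)
    (hb : b ≤ a) : T.Fits T.incenter (rad b) := by
  obtain ⟨h, u, v, h0, F, rfl⟩ := hT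
  have hS := hA.S_pos
  have hC := hA.C_pos
  have hR := rad_mono hb
  rw [Triangle.IsRight.rad_eq hA h0] at hR
  rw [F.fits_iff hA h0 (rad_nonneg _)]
  have e : T.incenter - T.Q = (h * (C + S - 1) / 2) • (u + v) := by
    rw [Triangle.incenter, F.dist_LH hA h0.le, F.dist_LQ (by positivity),
      F.dist_QH (by positivity), F.hL, F.hH]
    -- The inradius in two forms: half of legs minus hypotenuse, and twice the area over the
    -- perimeter.
    have e1 : h * (C + S - 1) / 2 = S * C * h / (1 + S + C) := by
      rw [div_eq_div_iff (by positivity) (by positivity)]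
      linear_combination h * hA.sq
    rw [e1]
    have : h * (1 + S + C) ≠ 0 := by positivity
    match_scalars
    · field_simp
      ring
    · field_simp
      ring
    · field_simp
      ring
  rw [e]
  simp only [real_inner_smul_left, inner_add_left, F.uu, F.vv, F.uv, F.vu]
  refine ⟨by linarith, by linarith, ?_⟩
  have e2 : S * C * h = h * (C + S - 1) / 2 * (1 + S + C) := by linear_combination -(h / 2) * hA.sq
  rw [e2]
  linarith

theorem shortChild_eq (s a a₂ : ℝ) (T : Triangle) :
    T.shortChild s a a₂ = (T.swap.cornerChild (sinL s) √(a₂ / a)).swap := rfl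

theorem Triangle.IsRight.longChild {s a a₁ : ℝ} {T : Triangle} (hs : 0 < s)
    (hT : T.IsRight (cosL s) (sinL s) a) (h1 : 0 < a₁) :
    (T.longChild s a a₁).IsRight (cosL s) (sinL s) a₁ := hT.cornerChild (isAngle hs) h1

theorem Triangle.IsRight.shortChild {s a a₂ : ℝ} {T : Triangle} (hs : 0 < s)
    (hT : T.IsRight (cosL s) (sinL s) a) (h2 : 0 < a₂) :
    (T.shortChild s a a₂).IsRight (cosL s) (sinL s) a₂ :=
  (hT.swap.cornerChild (isAngle hs).swap h2).swap

/-- Split Packing packs circles of total area at most the capacity, and keeps all of them off the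
part of the corner `L` that the largest circle would leave free. -/
theorem splitPack_spec {s : ℝ} (hs : 0 < s) :
    ∀ (n : ℕ) (T : Triangle) (a : ℝ) (C : List Disc), T.IsRight (cosL s) (sinL s) a →
      C.Nodup → AllPos C → total C ≤ a → C.length ≤ n →
      (∀ c ∈ C, T.Fits (splitPack s n T a C c) (rad c.area)) ∧
      (∀ c ∈ C, ∀ d ∈ C, c ≠ d →
        rad c.area + rad d.area ≤ dist (splitPack s n T a C c) (splitPack s n T a C d)) ∧
      (∀ b, 0 ≤ b → (∃ e ∈ C, b ≤ e.area) → ∀ c ∈ C,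
        T.ClearHyp (sinL s) √(b / a) (splitPack s n T a C c) (rad c.area) ∧
        T.ClearLeg (sinL s) √(b / a) (splitPack s n T a C c) (rad c.area)) := by
  have hA := isAngle hs
  intro n
  induction n with
  | zero =>
    intro T a C _ _ _ _ hl
    obtain rfl : C = [] := List.length_eq_zero_iff.1 (by omega)
    simp
  | succ n ih =>
    intro T a C hT hnd hpos htot hl
    by_cases h1 : C.length ≤ 1
    · have hfit : ∀ c ∈ C, T.Fits (splitPack s (n + 1) T a C c) (rad c.area) := by
        intro c hc
        simp only [splitPack, h1, if_true]
        exact fits_incenter hA hT ((hpos.le_total hc).trans htot)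
      have heq : ∀ c ∈ C, ∀ d ∈ C, c = d := by
        intro c hc d hd
        obtain ⟨i, hi, rfl⟩ := List.getElem_of_mem hc
        obtain ⟨j, hj, rfl⟩ := List.getElem_of_mem hd
        congr 1; omega
      refine ⟨hfit, fun c hc d hd hcd => absurd (heq c hc d hd) hcd, ?_⟩
      rintro b hb ⟨e, he, hbe⟩ c hc
      rw [heq e he c hc] at hbe
      exact hT.clear_of_le hA hb hbe (hfit c hc)
    · obtain ⟨kp, k1, k2, k3⟩ := split_spec hs hpos
      set sh := (split s C).1
      set lg := (split s C).2
      have hmem : ∀ c ∈ C, c ∈ lg ∨ c ∉ lg ∧ c ∈ sh := by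
        intro c hc
        have := kp.mem_iff.2 hc
        rw [List.mem_append] at this
        tauto
      have hpack : ∀ c, splitPack s (n + 1) T a C c =
          if c ∈ lg then splitPack s n (T.longChild s a (total lg)) (total lg) lg c
          else splitPack s n (T.shortChild s a (total sh)) (total sh) sh c := by
        intro c
        simp only [splitPack, h1, if_false]
        rfl
      have hlgC : lg ⊆ C := fun c hc => kp.mem_iff.1 (by simp [hc])
      have hshC : sh ⊆ C := fun c hc => kp.mem_iff.1 (by simp [hc])
      have hlgp := hpos.subset hlgC
      have hshp := hpos.subset hshC
      have hnd' := kp.nodup_iff.2 hnd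
      rw [List.nodup_append] at hnd'
      have hlen := kp.length_eq
      rw [List.length_append] at hlen
      have htt : total sh + total lg = total C := by rw [← total_append]; exact total_perm kp
      have hlg0 : lg ≠ [] := by
        intro h
        have hC0 : C ≠ [] := by rintro rfl; simp at h1
        obtain ⟨c, hc⟩ := List.exists_mem_of_ne_nil C hC0
        obtain ⟨e, he, -⟩ := k3 c hc
        simp [h] at he
      have hsh0 : sh ≠ [] := by
        intro h
        rw [h, List.length_nil, zero_add] at hlen
        obtain ⟨d, hd⟩ := List.exists_mem_of_ne_nil lg hlg0
        have h2 := k2 d hd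
        rw [h, total_nil, total_perm (List.perm_cons_erase hd), total_cons] at h2
        have hne : lg.erase d ≠ [] := by
          intro h3
          have := List.length_erase_of_mem hd
          rw [h3, List.length_nil] at this
          omega
        have := (hlgp.subset (List.erase_subset (a := d))).total_pos hne
        linarith
      have hlgt := hlgp.total_pos hlg0
      have hsht := hshp.total_pos hsh0
      have hlg_len : 0 < lg.length := List.length_pos_iff.2 hlg0
      have hsh_len : 0 < sh.length := List.length_pos_iff.2 hsh0
      obtain ⟨L1, L2, L3⟩ := ih (T.longChild s a (total lg)) (total lg) lg (hT.longChild hs hlgt)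
        hnd'.2.1 hlgp le_rfl (by omega)
      obtain ⟨S1, S2, -⟩ := ih (T.shortChild s a (total sh)) (total sh) sh (hT.shortChild hs hsht)
        hnd'.1 hshp le_rfl (by omega)
      have hC2 := cosL_sq s
      have hS2 := sinL_sq s
      have hd : 0 < 1 + s ^ 2 := by positivity
      rw [eq_div_iff hd.ne'] at hC2 hS2
      refine ⟨?_, ?_, ?_⟩
      · intro c hc
        rw [hpack]
        rcases hmem c hc with h | ⟨h, h'⟩
        · rw [if_pos h]
          -- The balance of the split gives a long part of at most `C ^ 2 * a + (1 - C ^ 2) *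
          -- c.area`, with `C` the cosine at `L`, for each circle `c` in it.
          refine hT.fits_of_cornerChild hA hlgt (L1 c h) (sqrt_le_mix hA.C_pos.le hA.C_lt_one.le
            (hpos c hc).le ((hpos.le_total hc).trans htot) ?_)
          refine le_of_mul_le_mul_right ?_ hd
          have h3 := mul_le_mul_of_nonneg_left htot (sq_nonneg s)
          rw [← htt] at h3
          linear_combination k2 c h + h3 + (c.area - a) * hC2
        · rw [if_neg h]
          have hf := S1 c h'
          rw [shortChild_eq, Triangle.fits_swap] at hf
          refine Triangle.fits_swap.1 (hT.swap.fits_of_cornerChild hA.swap hsht hf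
            (sqrt_le_mix hA.S_pos.le hA.S_lt_one.le
            (hpos c hc).le ((hpos.le_total hc).trans htot) ?_))
          refine le_of_mul_le_mul_right ?_ hd
          linear_combination k1 c h' + htot + htt + (c.area - a) * hS2
      · intro c hc d hd' hcd
        have hbetw : ∀ x ∈ lg, ∀ y ∈ sh, rad x.area + rad y.area ≤
            dist (splitPack s n (T.longChild s a (total lg)) (total lg) lg x)
              (splitPack s n (T.shortChild s a (total sh)) (total sh) sh y) :=
          fun x hx y hy => hT.add_le_dist hA hlgt hsht (by linarith) (rad_nonneg _) (rad_nonneg _)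
            (L1 x hx) (S1 y hy)
        rw [hpack, hpack]
        rcases hmem c hc with h | ⟨h, h'⟩ <;> rcases hmem d hd' with g | ⟨g, g'⟩
        · rw [if_pos h, if_pos g]; exact L2 c h d g hcd
        · rw [if_pos h, if_neg g]; exact hbetw c h d g'
        · rw [if_neg h, if_pos g, add_comm, dist_comm]; exact hbetw d g c h'
        · rw [if_neg h, if_neg g]; exact S2 c h' d g' hcd
      · rintro b hb ⟨e, he, hbe⟩ c hc
        -- The largest circle is in the long part, the one at the corner `L`, so the induction
        -- hypothesis there applies with the same `b`.
        obtain ⟨e', he', hee⟩ := k3 e he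
        rw [hpack]
        rcases hmem c hc with h | ⟨h, h'⟩
        · rw [if_pos h]
          obtain ⟨q1, q2⟩ := L3 b hb ⟨e', he', hbe.trans hee⟩ c h
          exact hT.clear_of_cornerChild hA hlgt hb q1 q2
        · rw [if_neg h]
          exact hT.clear_of_swap_cornerChild hA hsht (a₁ := total lg) (by linarith) hb
            (hbe.trans (hee.trans (hlgp.le_total he'))) (rad_nonneg _) (S1 c h')

/-! ### Geometry of one level of the spine -/

theorem cosL_one : cosL 1 = sinL 1 := rfl

theorem sqrt_two_mul_sinL : √2 * sinL 1 = 1 := by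
  rw [sinL]; norm_num

namespace Shape

/-- `S` is an `s`-shape of capacity `a`. -/
def HasCap (s a : ℝ) : Shape → Prop
  | square O X Y => s = 1 ∧ Triangle.IsRight (cosL s) (sinL s) (a / 2) ⟨X, O, Y⟩
  | triangle T => T.IsRight (cosL s) (sinL s) a

/-- The disc with centre `p` and radius `r` lies in the shape. -/
def Fits (S : Shape) (p : Plane) (r : ℝ) : Prop := Metric.closedBall p r ⊆ S.region

/-- `Triangle.ClearHyp` for triangles; no condition for squares. -/
def ClearHyp (s t : ℝ) : Shape → Plane → ℝ → Prop
  | square _ _ _, _, _ => True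
  | triangle T, p, r => T.ClearHyp (sinL s) t p r

/-- A disc of area `b` in the left child of capacity `aL` does not leave the shape. -/
def LeftOK (s a aL b : ℝ) : Shape → Prop
  | square _ _ _ => √aL ≤ √(a / 2) + (√2 - 1) * √b
  | triangle _ => √aL ≤ cosL s * √a + (1 - cosL s) * √b

/-- A disc in the right child of capacity `aR`, clear of the corner that a disc of area `b` leaves
free, does not leave the shape. -/
def RightOK (s a aR b : ℝ) : Shape → Prop
  | square _ _ _ => aR ≤ a / 2
  | triangle _ => √aR ≤ sinL s * √a + (1 - sinL s) * √b

end Shape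

namespace Triangle

variable {C S a a₁ a₂ b r r' : ℝ} {O X Y p q : Plane}

theorem Frame.square_fits_iff {C h : ℝ} {u v : Plane} (F : Frame ⟨X, O, Y⟩ C C h u v)
    (hC : 0 < C) (h0 : 0 < h) (hr : 0 ≤ r) :
    (Shape.square O X Y).Fits p r ↔
      (r ≤ inner ℝ (p - O) u ∧ inner ℝ (p - O) u + r ≤ C * h) ∧
      (r ≤ inner ℝ (p - O) v ∧ inner ℝ (p - O) v + r ≤ C * h) := by
  have hX : X = O + (C * h) • u := F.hL
  have hY : Y = O + (C * h) • v := F.hH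
  have hl : 0 < C * h := by positivity
  constructor
  · intro hf
    have hcv : Convex ℝ {q : Plane | (0 ≤ inner ℝ (q - O) u ∧ inner ℝ (q - O) u ≤ C * h) ∧
        (0 ≤ inner ℝ (q - O) v ∧ inner ℝ (q - O) v ≤ C * h)} := by
      intro x hx y hy a b ha hb hab
      obtain rfl : b = 1 - a := by linarith
      have e : a • x + (1 - a) • y - O = a • (x - O) + (1 - a) • (y - O) := by module
      obtain ⟨⟨x1, x2⟩, x3, x4⟩ := hx
      obtain ⟨⟨y1, y2⟩, y3, y4⟩ := hy
      simp only [Set.mem_ofPred_eq, e, inner_add_left, real_inner_smul_left]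
      refine ⟨⟨by positivity, ?_⟩, by positivity, ?_⟩
      · nlinarith [mul_le_mul_of_nonneg_left x2 ha, mul_le_mul_of_nonneg_left y2 hb]
      · nlinarith [mul_le_mul_of_nonneg_left x4 ha, mul_le_mul_of_nonneg_left y4 hb]
    have key : ∀ q ∈ (Shape.square O X Y).region,
        (0 ≤ inner ℝ (q - O) u ∧ inner ℝ (q - O) u ≤ C * h) ∧
        (0 ≤ inner ℝ (q - O) v ∧ inner ℝ (q - O) v ≤ C * h) := by
      intro q hq
      refine convexHull_min ?_ hcv hq
      have e : X + Y - O - O = (C * h) • u + (C * h) • v := by rw [hX, hY]; module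
      rintro x (rfl | rfl | rfl | rfl)
      · simp [hl.le]
      · simp [hX, real_inner_smul_left, F.norm_u, F.uv, hl.le]
      · simp [e, inner_add_left, real_inner_smul_left, F.norm_u, F.uv, F.norm_v, F.vu, hl.le]
      · simp [hY, real_inner_smul_left, F.norm_v, F.vu, hl.le]
    have key2 : ∀ (w : Plane) (e : ℝ), |e| ≤ r → ‖w‖ = 1 →
        p - e • w ∈ (Shape.square O X Y).region := by
      intro w e he hw
      apply hf
      rw [Metric.mem_closedBall, dist_eq_norm, sub_sub_cancel_left, norm_neg, norm_smul, hw, mul_one]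
      exact he
    have ar := (abs_of_nonneg hr).le
    have ar' : |-r| ≤ r := by rw [abs_neg]; exact ar
    have k1 := (key _ (key2 u r ar F.norm_u)).1.1
    have k2 := (key _ (key2 u (-r) ar' F.norm_u)).1.2
    have k3 := (key _ (key2 v r ar F.norm_v)).2.1
    have k4 := (key _ (key2 v (-r) ar' F.norm_v)).2.2
    rw [sub_right_comm, inner_sub_left (𝕜 := ℝ) (p - O), real_inner_smul_left] at k1 k2 k3 k4
    rw [F.uu] at k1 k2
    rw [F.vv] at k3 k4
    exact ⟨⟨by linarith, by linarith⟩, by linarith, by linarith⟩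
  · rintro ⟨⟨x1, x2⟩, y1, y2⟩ q hq
    rw [Metric.mem_closedBall] at hq
    have a1 := abs_le.1 (F.abs_inner_le hq)
    have a2 := abs_le.1 (F.swap.abs_inner_le hq)
    have e := eq_add_of_orthonormal F.uu F.vv F.uv (q - O)
    have e0 : q - O = (q - p) + (p - O) := by abel
    have bx : 0 ≤ (inner ℝ (q - O) u : ℝ) ∧ (inner ℝ (q - O) u : ℝ) ≤ C * h := by
      rw [e0, inner_add_left]; constructor <;> linarith
    have bY : 0 ≤ (inner ℝ (q - O) v : ℝ) ∧ (inner ℝ (q - O) v : ℝ) ≤ C * h := by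
      rw [e0, inner_add_left]; constructor <;> linarith
    set x : ℝ := inner ℝ (q - O) u
    set y : ℝ := inner ℝ (q - O) v
    obtain ⟨x', hx'⟩ : ∃ x', x = x' * (C * h) := ⟨x / (C * h), by field_simp⟩
    obtain ⟨y', hy'⟩ : ∃ y', y = y' * (C * h) := ⟨y / (C * h), by field_simp⟩
    rw [hx'] at bx e
    rw [hy'] at bY e
    have bx0 : 0 ≤ x' := nonneg_of_mul_nonneg_left bx.1 hl
    have bx1 : x' ≤ 1 := le_of_mul_le_mul_right (by linarith) hl
    have by0 : 0 ≤ y' := nonneg_of_mul_nonneg_left bY.1 hl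
    have by1 : y' ≤ 1 := le_of_mul_le_mul_right (by linarith) hl
    -- Bilinear weights write a point of the square as a convex combination of its four corners.
    have e' : q = ((1 - x') * (1 - y')) • O + (x' * (1 - y')) • X + (x' * y') • (X + Y - O)
        + ((1 - x') * y') • Y := by
      rw [hX, hY, ← sub_add_cancel q O, e]
      module
    rw [e']
    have hcv := convex_convexHull ℝ ({O, X, X + Y - O, Y} : Set Plane)
    have := hcv.sum_mem (t := Finset.univ)
      (w := ![(1 - x') * (1 - y'), x' * (1 - y'), x' * y', (1 - x') * y'])
      (z := ![O, X, X + Y - O, Y]) ?_ ?_ ?_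
    · simpa [Fin.sum_univ_four, Shape.region] using this
    · have := sub_nonneg.2 bx1
      have := sub_nonneg.2 by1
      intro i _
      fin_cases i <;> simp <;> positivity
    · simp [Fin.sum_univ_four]; ring
    · intro i _
      refine subset_convexHull ℝ _ ?_
      fin_cases i <;> simp

theorem Frame.square_left {C S h lam : ℝ} {u v : Plane} (F : Frame ⟨X, O, Y⟩ C S h u v) :
    Frame ⟨O + lam • (X - O), O, O + lam • (Y - O)⟩ C S (lam * h) u v := by
  have hX : X = O + (C * h) • u := F.hL
  have hY : Y = O + (S * h) • v := F.hH
  refine ⟨F.uu, F.vv, F.uv, ?_, ?_⟩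
  · simp only [hX]; module
  · simp only [hY]; module

theorem Frame.square_right {C h lam : ℝ} {u v : Plane} (F : Frame ⟨X, O, Y⟩ C C h u v) :
    Frame ⟨(X + Y - O) + lam • (O - Y), X + Y - O, (X + Y - O) + lam • (O - X)⟩ C C (lam * h)
      (-v) (-u) := by
  have hX : X = O + (C * h) • u := F.hL
  have hY : Y = O + (C * h) • v := F.hH
  refine ⟨by simpa using F.vv, by simpa using F.uu, by simpa using F.vu, ?_, ?_⟩
  · simp only [hX, hY]; module
  · simp only [hX, hY]; module

end Triangle

namespace Shape

variable {s a aL aR b r r' : ℝ} {S : Shape} {p q : Plane}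

theorem HasCap.pos (hs : 0 < s) (h : S.HasCap s a) : 0 < a := by
  cases S with
  | square O X Y =>
    obtain ⟨rfl, h⟩ := h
    have := h.area_pos (isAngle one_pos)
    linarith
  | triangle T => exact Triangle.IsRight.area_pos (isAngle hs) h

theorem _root_.OnlineSplitPacking.scaled_area {C S h a A : ℝ} (ha : 0 ≤ a) (hA : 0 < A)
    (e : A = π * (h * (C + S - 1) / 2) ^ 2) :
    a = π * (√(a / A) * h * (C + S - 1) / 2) ^ 2 := by
  have h2 := Real.sq_sqrt (show 0 ≤ a / A by positivity)
  calc a = (a / A) * A := by field_simp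
    _ = (√(a / A)) ^ 2 * (π * (h * (C + S - 1) / 2) ^ 2) := by rw [h2, ← e]
    _ = _ := by ring

theorem HasCap.left (hs : 0 < s) (h : S.HasCap s a) (hL : 0 < aL) :
    (S.leftChild s a aL).IsRight (cosL s) (sinL s) aL := by
  have ha := h.pos hs
  cases S with
  | square O X Y =>
    obtain ⟨rfl, h, u, v, h0, F, e⟩ := h
    exact ⟨_, u, v, by positivity, F.square_left, scaled_area hL.le (by positivity) e⟩
  | triangle T => exact Triangle.IsRight.longChild hs h hL

theorem HasCap.right (hs : 0 < s) (h : S.HasCap s a) (hR : 0 < aR) :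
    (S.rightChild s a aR).IsRight (cosL s) (sinL s) aR := by
  have ha := h.pos hs
  cases S with
  | square O X Y =>
    obtain ⟨rfl, h, u, v, h0, F, e⟩ := h
    exact ⟨_, -v, -u, by positivity, F.square_right, scaled_area hR.le (by positivity) e⟩
  | triangle T => exact Triangle.IsRight.shortChild hs h hR

theorem HasCap.fits_of_left (hs : 0 < s) (h : S.HasCap s a) (hL : 0 < aL)
    (hf : (S.leftChild s a aL).Fits p (rad b)) (hb : S.LeftOK s a aL b) : S.Fits p (rad b) := by
  have ha := h.pos hs
  cases S with
  | square O X Y =>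
    obtain ⟨rfl, h, u, v, h0, F, e⟩ := h
    have hA := isAngle one_pos
    have hc := sqrt_two_mul_sinL
    rw [cosL_one] at F e hA
    have G := F.square_left (lam := √(aL / (a / 2)))
    have hS := hA.S_pos
    have hl : 0 < √(aL / (a / 2)) := by positivity
    have hf' := (G.fits_iff hA (by positivity) (rad_nonneg _)).1 hf
    rw [F.square_fits_iff hS h0 (rad_nonneg _)]
    have hb' : √aL ≤ 1 * √(a / 2) + (√2 - 1) * √b := by simpa [LeftOK] using hb
    rw [sqrt_le_iff_rad_le] at hb'
    have hra := Triangle.IsRight.rad_eq hA h0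
    rw [← e] at hra
    have hlam : rad aL = √(aL / (a / 2)) * rad (a / 2) := by
      rw [sqrt_div_eq_rad hL.le]; have := rad_pos (half_pos ha); field_simp
    rw [hlam, hra] at hb'
    simp only at hf'
    set x : ℝ := inner ℝ (p - O) u
    set y : ℝ := inner ℝ (p - O) v
    set l := √(aL / (a / 2))
    set r := rad b
    obtain ⟨f1, f2, f3⟩ := hf'
    have h2 : √2 * √2 = 2 := Real.mul_self_sqrt (by norm_num)
    have h3 : 1 < √2 := by nlinarith [Real.sqrt_nonneg 2]
    have f3' : x + y + √2 * r ≤ l * (sinL 1 * h) := by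
      linear_combination √2 * f3 - (x + y - l * (sinL 1 * h)) * hc
    -- The left side is the overhang of the left child beyond the square. A disc kept in by the
    -- child's leg and hypotenuse recovers `√2 * r` of it.
    have k : (l - 1) * (sinL 1 * h) ≤ √2 * r := by
      refine le_of_mul_le_mul_left ?_ (sub_pos.2 h3)
      linear_combination √2 * hb' + (l - 1) * h / 2 * (sinL 1 * h2 - √2 * hc)
    have r0 : 0 ≤ r := rad_nonneg _
    refine ⟨⟨f1, by linarith⟩, f2, by linarith⟩
  | triangle T => exact Triangle.IsRight.fits_of_cornerChild (isAngle hs) h hL hf hb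

theorem HasCap.fits_of_right (hs : 0 < s) (h : S.HasCap s a) (hR : 0 < aR) (hr : 0 ≤ r)
    (hb0 : 0 ≤ b) (hf : (S.rightChild s a aR).Fits p r)
    (hc : (S.rightChild s a aR).ClearHyp (sinL s) √(b / aR) p r)
    (hb : S.RightOK s a aR b) : S.Fits p r := by
  have ha := h.pos hs
  cases S with
  | square O X Y =>
    obtain ⟨rfl, h, u, v, h0, F, e⟩ := h
    have hA := isAngle one_pos
    have hc := sqrt_two_mul_sinL
    rw [cosL_one] at F e hA
    have G := F.square_right (lam := √(aR / (a / 2)))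
    have hS := hA.S_pos
    have hl : 0 < √(aR / (a / 2)) := by positivity
    have hf' := (G.fits_iff hA (by positivity) hr).1 hf
    rw [F.square_fits_iff hS h0 hr]
    have hX : X = O + (sinL 1 * h) • u := F.hL
    have hY : Y = O + (sinL 1 * h) • v := F.hH
    have eW : p - (X + Y - O) = (p - O) - (sinL 1 * h) • u - (sinL 1 * h) • v := by
      rw [hX, hY]; module
    simp only [eW, inner_neg_right, inner_sub_left (𝕜 := ℝ) (p - O),
      inner_sub_left (𝕜 := ℝ) (p - O - _), real_inner_smul_left, F.uu, F.uv, F.vv, F.vu] at hf'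
    have hl1 : √(aR / (a / 2)) ≤ 1 := by
      refine Real.sqrt_le_iff.2 ⟨zero_le_one, ?_⟩
      rw [one_pow, div_le_one (by positivity)]; exact hb
    have hl2 := mul_le_mul_of_nonneg_right hl1 (show 0 ≤ sinL 1 * h by positivity)
    set x : ℝ := inner ℝ (p - O) u
    set y : ℝ := inner ℝ (p - O) v
    set l := √(aR / (a / 2))
    obtain ⟨f1, f2, f3⟩ := hf'
    have h2 := Real.sqrt_nonneg 2
    have f3' : 2 * (sinL 1 * h) - x - y + √2 * r ≤ l * (sinL 1 * h) := by
      linear_combination √2 * f3 - (2 * (sinL 1 * h) - x - y - l * (sinL 1 * h)) * hc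
    have h4 : r ≤ √2 * r := by
      have : 1 ≤ √2 := Real.one_le_sqrt.2 (by norm_num)
      nlinarith
    refine ⟨⟨by linarith, by linarith⟩, by linarith, by linarith⟩
  | triangle T => exact Triangle.IsRight.fits_of_swap_cornerChild (isAngle hs) h hR hb0 hr hf hc hb

/-- In a square both children have hypotenuses orthogonal to the diagonal through `O`. They do not
cross because scale factors with squares summing to at most 2 sum to at most 2. -/
theorem HasCap.add_le_dist (hs : 0 < s) (h : S.HasCap s a) (hL : 0 < aL) (hR : 0 < aR)
    (hLR : aL + aR ≤ a) (hr : 0 ≤ r) (hr' : 0 ≤ r') (hp : (S.leftChild s a aL).Fits p r)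
    (hq : (S.rightChild s a aR).Fits q r') : r + r' ≤ dist p q := by
  have ha := h.pos hs
  cases S with
  | square O X Y =>
    obtain ⟨rfl, h, u, v, h0, F, e⟩ := h
    have hA := isAngle one_pos
    have hc := sqrt_two_mul_sinL
    rw [cosL_one] at F e hA
    have hS := hA.S_pos
    have G := F.square_left (lam := √(aL / (a / 2)))
    have G' := F.square_right (lam := √(aR / (a / 2)))
    have f := ((G.fits_iff hA (by positivity) hr).1 hp).2.2
    have g := ((G'.fits_iff hA (by positivity) hr').1 hq).2.2
    have hX : X = O + (sinL 1 * h) • u := F.hL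
    have hY : Y = O + (sinL 1 * h) • v := F.hH
    have eW : q - (X + Y - O) = (q - O) - (sinL 1 * h) • u - (sinL 1 * h) • v := by
      rw [hX, hY]; module
    simp only [eW, inner_neg_right, inner_sub_left (𝕜 := ℝ) (q - O),
      inner_sub_left (𝕜 := ℝ) (q - O - _), real_inner_smul_left, F.uu, F.uv, F.vv, F.vu] at g
    have hl : √(aL / (a / 2)) + √(aR / (a / 2)) ≤ 2 := by
      have h1 := Real.sq_sqrt (show 0 ≤ aL / (a / 2) by positivity)
      have h2 := Real.sq_sqrt (show 0 ≤ aR / (a / 2) by positivity)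
      have h3 : aL / (a / 2) + aR / (a / 2) ≤ 2 := by
        rw [← add_div, div_le_iff₀ (by positivity)]; linarith
      nlinarith [sq_nonneg (√(aL / (a / 2)) - 1), sq_nonneg (√(aR / (a / 2)) - 1)]
    have hl' := mul_le_mul_of_nonneg_left hl (show 0 ≤ sinL 1 * (sinL 1 * h) by positivity)
    refine dist_le_of_inner (F.cornerChild hA 1).norm_v ?_
    have e : p - q = (p - O) - (q - O) := by abel
    rw [e]
    simp only [inner_sub_left (𝕜 := ℝ) (p - O), inner_neg_right, inner_add_right,
      real_inner_smul_right]
    simp only at f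
    linarith
  | triangle T => exact Triangle.IsRight.add_le_dist (isAngle hs) h hL hR hLR hr hr' hp hq

theorem HasCap.clear_of_left (hs : 0 < s) (h : S.HasCap s a) (hL : 0 < aL) (hb : 0 ≤ b)
    (hH : (S.leftChild s a aL).ClearHyp (sinL s) √(b / aL) p r)
    (hf : (S.leftChild s a aL).ClearLeg (sinL s) √(b / aL) p r) :
    S.ClearHyp s √(b / a) p r := by
  cases S with
  | square O X Y => trivial
  | triangle T => exact (Triangle.IsRight.clear_of_cornerChild (isAngle hs) h hL hb hH hf).1

theorem HasCap.clear_of_right (hs : 0 < s) (h : S.HasCap s a) (hR : 0 < aR)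
    (hLR : aL + aR ≤ a) (hr : 0 ≤ r) (hb : 0 ≤ b) (hbL : b ≤ aL)
    (hf : (S.rightChild s a aR).Fits p r) : S.ClearHyp s √(b / a) p r := by
  cases S with
  | square O X Y => trivial
  | triangle T =>
    exact (Triangle.IsRight.clear_of_swap_cornerChild (isAngle hs) h hR hLR hb hbL hr hf).1

end Shape

/-! ### The decision step of Repack -/

theorem greedyFill_perm (m : ℝ) : ∀ (L : List Disc) (t : ℝ),
    ((greedyFill m t L).1 ++ (greedyFill m t L).2).Perm L
  | [], t => by simp [greedyFill]
  | c :: L, t => by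
    unfold greedyFill
    split_ifs
    · exact (greedyFill_perm m L _).cons c
    · exact List.perm_middle.trans ((greedyFill_perm m L _).cons c)

theorem greedyFill_le (m : ℝ) : ∀ (L : List Disc) (t : ℝ), t ≤ m →
    t + total (greedyFill m t L).1 ≤ m
  | [], t, h => by simpa [greedyFill, total_nil] using h
  | c :: L, t, h => by
    unfold greedyFill
    split_ifs with h1
    · have := greedyFill_le m L (t + c.area) h1
      simp only [total_cons]
      linarith
    · exact greedyFill_le m L t h

/-- A rejected circle overflowed when its turn came, and the kept total only grows afterwards. -/
theorem greedyFill_lt (m : ℝ) : ∀ (L : List Disc) (t : ℝ), AllPos L →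
    ∀ d ∈ (greedyFill m t L).2, m < t + total (greedyFill m t L).1 + d.area
  | [], t, _ => by simp [greedyFill]
  | c :: L, t, hp => by
    have hp' : AllPos L := hp.subset (by simp)
    unfold greedyFill
    split_ifs with h1
    · intro d hd
      have := greedyFill_lt m L (t + c.area) hp' d hd
      simp only [total_cons]
      linarith
    · intro d hd
      rcases List.mem_cons.1 hd with rfl | hd
      · have : AllPos (greedyFill m t L).1 :=
          hp'.subset fun x hx => (greedyFill_perm m L t).mem_iff.1 (by simp [hx])
        have := this.total_nonneg
        simp only
        linarith [not_le.1 h1]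
      · exact greedyFill_lt m L t hp' d hd

theorem greedyTrim_perm (m : ℝ) : ∀ (L : List Disc) (t : ℝ),
    ((greedyTrim m t L).1 ++ (greedyTrim m t L).2).Perm L
  | [], t => by simp [greedyTrim]
  | c :: L, t => by
    unfold greedyTrim
    split_ifs
    · exact List.perm_middle.trans ((greedyTrim_perm m L _).cons c)
    · exact (greedyTrim_perm m L _).cons c

theorem greedyTrim_le (m : ℝ) : ∀ (L : List Disc) (t : ℝ), m ≤ t →
    m ≤ t - total (greedyTrim m t L).2
  | [], t, h => by simpa [greedyTrim, total_nil] using h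
  | c :: L, t, h => by
    unfold greedyTrim
    split_ifs with h1
    · have := greedyTrim_le m L (t - c.area) h1
      simp only [total_cons]
      linarith
    · exact greedyTrim_le m L t h

theorem greedyTrim_lt (m : ℝ) : ∀ (L : List Disc) (t : ℝ), AllPos L →
    ∀ d ∈ (greedyTrim m t L).1, t - total (greedyTrim m t L).2 - d.area < m
  | [], t, _ => by simp [greedyTrim]
  | c :: L, t, hp => by
    have hp' : AllPos L := hp.subset (by simp)
    unfold greedyTrim
    split_ifs with h1
    · intro d hd
      have := greedyTrim_lt m L (t - c.area) hp' d hd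
      simp only [total_cons]
      linarith
    · intro d hd
      rcases List.mem_cons.1 hd with rfl | hd
      · have : AllPos (greedyTrim m t L).2 :=
          hp'.subset fun x hx => (greedyTrim_perm m L t).mem_iff.1 (by simp [hx])
        have := this.total_nonneg
        simp only
        linarith [not_le.1 h1]
      · exact greedyTrim_lt m L t hp' d hd

/-- What the analysis needs to know about a decision for circles `C` in a shape `S` of capacity
`a`. -/
structure ChoiceOK (s a : ℝ) (S : Shape) (C : List Disc) (ch : Choice) : Prop where
  perm : (ch.left ++ ch.right).Perm C
  left_le : total ch.left ≤ ch.capL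
  capL_pos : 0 < ch.capL
  right_le : ch.right = [] ∨ total ch.left = ch.capL
  ratio : total ch.left = ch.capL ∨ ch.right = [] ∧ (a - ch.capL) * (1 + s ^ 2) = a
  leftOK : ∀ d ∈ ch.left, S.LeftOK s a ch.capL d.area
  rightOK : ∃ b, 0 ≤ b ∧ S.RightOK s a (a - ch.capL) b ∧ (b = 0 ∨ ∃ d ∈ ch.right, b ≤ d.area)
  max_left : ∀ T, S = .triangle T → ∀ d ∈ C, ∃ e ∈ ch.left, d.area ≤ e.area
  left_ne : C ≠ [] → ch.left ≠ []

/-- If `b` is at least `A`, the bound `2 * A` suffices; otherwise `A + b` does, since `(√2 - 1) ^ 2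
+ 2 * (√2 - 1) = 1`. -/
theorem square_overflow {A aL b : ℝ} (hA : 0 ≤ A) (hb : 0 ≤ b) (h1 : aL ≤ 2 * A)
    (h2 : aL ≤ A + b) : √aL ≤ √A + (√2 - 1) * √b := by
  have hx := Real.sqrt_nonneg A
  have hy := Real.sqrt_nonneg b
  have ex := Real.sq_sqrt hA
  have ey := Real.sq_sqrt hb
  have q2 : √2 * √2 = 2 := Real.mul_self_sqrt (by norm_num)
  have q1 : 1 < √2 := by nlinarith [Real.sqrt_nonneg 2]
  set x := √A
  set y := √b
  set q := √2
  refine Real.sqrt_le_iff.2 ⟨by nlinarith, ?_⟩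
  rcases le_total x y with h | h
  · refine h1.trans ?_
    rw [← ex, show 2 * x ^ 2 = (q * x) ^ 2 by rw [mul_pow, sq q, q2]]
    have : q * x ≤ x + (q - 1) * y := by nlinarith
    gcongr
  · refine h2.trans ?_
    rw [← ex, ← ey]
    nlinarith [mul_nonneg hy (sub_nonneg.2 h)]

theorem chooseSquare_ok {s a : ℝ} {O X Y : Plane} {C : List Disc}
    (hS : (Shape.square O X Y).HasCap s a) (hC : AllPos C) (htot : total C ≤ a) :
    ChoiceOK s a (.square O X Y) C (chooseSquare a C) := by
  have hs := hS.1
  have ha : 0 < a := hS.pos (by rw [hs]; exact one_pos)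
  unfold chooseSquare
  have hps : AllPos (sortDesc C) := fun c hc => hC c (mem_sortDesc.1 hc)
  have hperm := greedyTrim_perm (a / 2) (sortDesc C) (total C)
  have hle := greedyTrim_le (a / 2) (sortDesc C) (total C)
  have hlt := greedyTrim_lt (a / 2) (sortDesc C) (total C) hps
  set G := greedyTrim (a / 2) (total C) (sortDesc C)
  have hperm' := hperm.trans (sortDesc_perm C)
  have ht : total G.1 + total G.2 = total C := by
    rw [← total_append]; exact total_perm hperm'
  have hG2 : AllPos G.2 := hC.subset fun x hx => hperm'.mem_iff.1 (by simp [hx])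
  have hG2' := hG2.total_nonneg
  by_cases h : a / 2 < total C
  · simp only [h, if_true]
    have h1 := hle h.le
    have h2 : a / 2 ≤ total G.1 := by linarith
    refine ⟨hperm', le_rfl, by simp only; linarith, Or.inr rfl, Or.inl rfl, ?_, ?_, ?_, ?_⟩
    · intro d hd
      have := hlt d hd
      have hdp : 0 < d.area := hC d (hperm'.mem_iff.1 (by simp [hd]))
      exact square_overflow (by linarith) hdp.le (by simp only; linarith) (by simp only; linarith)
    · exact ⟨0, le_rfl, by simp only [Shape.RightOK]; linarith, Or.inl rfl⟩
    · intro T hT; simp at hT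
    · rintro - (h0 : G.1 = [])
      rw [h0, total_nil] at h2
      linarith
  · simp only [h, if_false]
    refine ⟨by simp, by simp only; linarith, by simp only; linarith, Or.inl rfl, Or.inr ⟨rfl, ?_⟩, ?_,
      ?_, ?_, by simp⟩
    · simp only [hs]; ring
    · intro d hd
      have hdp := hC d hd
      exact square_overflow (by linarith) hdp.le (by simp only; linarith) (by simp only; linarith)
    · exact ⟨0, le_rfl, by simp only [Shape.RightOK]; linarith, Or.inl rfl⟩
    · intro T hT; simp at hT

/-- In terms of the sine, the threshold is the ratio of deficit to capacity at which the estimate in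
`short_overflow` (with `d = e`) becomes an equality. -/
theorem deltaShort_eq {s : ℝ} (hs : 0 < s) :
    deltaShort s = (2 * (1 - sinL s) / (2 - sinL s)) ^ 2 := by
  have hA := isAngle hs
  have h1 : (1 : ℝ) < √(1 + s ^ 2) := by
    rw [Real.lt_sqrt (by norm_num)]; nlinarith
  unfold deltaShort sinL
  set w := √(1 + s ^ 2)
  have : 2 * w - 1 ≠ 0 := by linarith
  have : 2 - 1 / w ≠ 0 := by
    have : 1 / w < 1 := by rw [div_lt_one (by linarith)]; exact h1
    linarith
  congr 1
  field_simp
  ring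

theorem sinL_sq_le {s : ℝ} (hs : 1 ≤ s) : 2 * sinL s ^ 2 ≤ 1 := by
  rw [sinL_sq, mul_one_div, div_le_one (by positivity)]
  nlinarith

/-- The threshold for the greedy filling is exactly what makes the right child acceptable. -/
theorem short_overflow {S a e d : ℝ} (hS : 0 < S) (hS1 : S < 1) (ha : 0 < a) (he : 0 ≤ e)
    (hed : e ≤ d) (h : e / a < (2 * (1 - S) / (2 - S)) ^ 2) :
    √(S ^ 2 * a + e) ≤ S * √a + (1 - S) * √d := by
  rw [div_lt_iff₀ ha] at h
  have hx := Real.sqrt_nonneg a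
  have hz := Real.sqrt_nonneg e
  have ex := Real.sq_sqrt ha.le
  have ez := Real.sq_sqrt he
  have hzy := Real.sqrt_le_sqrt hed
  have h2S : 0 < 2 - S := by linarith
  have k : √e * (2 - S) ≤ 2 * (1 - S) * √a := by
    have h0 : √e ≤ 2 * (1 - S) / (2 - S) * √a := by
      have h3 : 0 ≤ 2 * (1 - S) / (2 - S) := div_nonneg (by linarith) h2S.le
      rw [← Real.sqrt_sq h3, ← Real.sqrt_mul (by positivity)]
      exact Real.sqrt_le_sqrt h.le
    rw [div_mul_eq_mul_div, le_div_iff₀ h2S] at h0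
    exact h0
  set x := √a
  set z := √e
  have k2 : √(S ^ 2 * a + e) ≤ S * x + (1 - S) * z := by
    refine Real.sqrt_le_iff.2 ⟨by nlinarith, ?_⟩
    rw [← ex, ← ez]
    nlinarith [mul_le_mul_of_nonneg_left k (mul_nonneg hS.le hz)]
  nlinarith

/-- This excludes that the two largest circles fit together when the greedy filling is refused: a
rejected circle would be at most half of the kept total, and the deficit less than a third of the
ideal capacity. -/
theorem third_le_delta {C S : ℝ} (hA : IsAngle C S) (hS : 2 * S ^ 2 ≤ 1) :
    C ^ 2 / 3 ≤ (2 * (1 - S) / (2 - S)) ^ 2 := by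
  have h1 := hA.S_lt_one
  have h0 := hA.S_pos
  have h2 : 0 < 2 - S := by linarith
  rw [div_pow, div_le_div_iff₀ (by norm_num) (by positivity)]
  have e : C ^ 2 = (1 - S) * (1 + S) := by linarith [hA.sq]
  have hS' : S ≤ 0.7072 := by nlinarith
  have k : (1 + S) * (2 - S) ^ 2 ≤ 12 * (1 - S) := by
    nlinarith [mul_nonneg h0.le (sub_nonneg.2 hS'), mul_nonneg (mul_nonneg h0.le h0.le) (sub_nonneg.2 hS')]
  rw [e]
  nlinarith [mul_le_mul_of_nonneg_left k (sub_nonneg.2 h1.le)]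

/-- Let `D ^ 2` be the threshold. Two circles of area at most `(C ^ 2 - D ^ 2) * a` exceed `C ^ 2 *
a` by at most the left side times `a`; the right side times `a` is the cross term when the smaller
circle has area `D ^ 2 * a`. After clearing denominators the left side is negative for `S ≤ 0.6`,
and crude numerical bounds settle the rest. -/
theorem two_largest_bound {C S : ℝ} (hA : IsAngle C S) (hS : 2 * S ^ 2 ≤ 1) :
    C ^ 2 - 2 * (2 * (1 - S) / (2 - S)) ^ 2 ≤ 2 * C * (1 - C) * (2 * (1 - S) / (2 - S)) := by
  have h1 := hA.S_lt_one
  have h0 := hA.S_pos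
  have c1 := hA.C_lt_one
  have c0 := hA.C_pos
  have h2 : 0 < 2 - S := by linarith
  have e : C ^ 2 = (1 - S) * (1 + S) := by linarith [hA.sq]
  have hS' : S ≤ 0.7072 := by nlinarith
  have k : (1 + S) * (2 - S) ^ 2 - 8 * (1 - S) ≤ 4 * C * (1 - C) * (2 - S) := by
    have e2 : (1 + S) * (2 - S) ^ 2 - 8 * (1 - S) = S * (8 - 3 * S + S ^ 2) - 4 := by ring
    rw [e2]
    rcases le_total S 0.6 with h | h
    · have r0 : 0 ≤ 4 * C * (1 - C) * (2 - S) := by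
        have := sub_nonneg.2 c1.le
        positivity
      refine le_trans ?_ r0
      have : S * (8 - 3 * S + S ^ 2) ≤ 0.6 * (8 - 3 * 0.6 + 0.6 ^ 2) := by
        nlinarith [mul_nonneg h0.le (sub_nonneg.2 h), mul_nonneg (mul_nonneg h0.le h0.le) (sub_nonneg.2 h)]
      norm_num at this ⊢
      linarith
    · have hC8 : C ≤ 0.8 := by nlinarith
      have hC2 : 0.2 ≤ C := by nlinarith
      have hcc : 0.16 ≤ C * (1 - C) := by nlinarith
      have hr : 0.8 ≤ 4 * C * (1 - C) * (2 - S) := by nlinarith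
      refine le_trans ?_ hr
      have h6 : 8 - 3 * S + S ^ 2 ≤ 6.56 := by nlinarith
      nlinarith
  have e3 : 2 * C * (1 - C) * (2 * (1 - S) / (2 - S)) - (C ^ 2 - 2 * (2 * (1 - S) / (2 - S)) ^ 2) =
      (1 - S) / (2 - S) ^ 2 *
        (4 * C * (1 - C) * (2 - S) - ((1 + S) * (2 - S) ^ 2 - 8 * (1 - S))) := by
    rw [e]
    field_simp
    ring
  rw [← sub_nonneg, e3]
  exact mul_nonneg (div_nonneg (by linarith) (by positivity)) (by linarith)

/-- The two largest circles fit into the left child in the last case. -/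
theorem two_largest_overflow {C S a c₁ c₂ : ℝ} (hA : IsAngle C S) (hS : 2 * S ^ 2 ≤ 1)
    (ha : 0 < a) (h12 : c₂ ≤ c₁) (h1 : (2 * (1 - S) / (2 - S)) ^ 2 ≤ (C ^ 2 * a - c₁) / a)
    (h3 : C ^ 2 * a < c₁ + c₂) : √(c₁ + c₂) ≤ C * √a + (1 - C) * √c₂ := by
  rw [le_div_iff₀ ha] at h1
  have hb := two_largest_bound hA hS
  have hD : 0 ≤ 2 * (1 - S) / (2 - S) :=
    div_nonneg (by linarith [hA.S_lt_one]) (by linarith [hA.S_lt_one])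
  set D := 2 * (1 - S) / (2 - S)
  have hC := hA.C_pos
  have hC1 := sub_pos.2 hA.C_lt_one
  have hx := Real.sqrt_nonneg a
  have ex := Real.sq_sqrt ha.le
  have hc2 : D ^ 2 * a ≤ c₂ := by linarith
  have hy : D * √a ≤ √c₂ := by
    rw [← Real.sqrt_sq hD, ← Real.sqrt_mul (by positivity)]
    exact Real.sqrt_le_sqrt hc2
  have hy0 := Real.sqrt_nonneg c₂
  refine Real.sqrt_le_iff.2 ⟨by positivity, ?_⟩
  set x := √a
  set y := √c₂
  have k1 : c₁ + c₂ ≤ 2 * (C ^ 2 * a - D ^ 2 * a) := by linarith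
  have k2 := mul_le_mul_of_nonneg_right hb ha.le
  have k3 : C * (1 - C) * x * (D * x) ≤ C * (1 - C) * x * y :=
    mul_le_mul_of_nonneg_left hy (by positivity)
  have k4 : 0 ≤ (1 - C) ^ 2 * y ^ 2 := by positivity
  rw [← ex] at k1 k2
  nlinarith

theorem chooseTriangle_ok {s a : ℝ} (hs : 1 ≤ s) {T : Triangle} {C : List Disc}
    (hT : (Shape.triangle T).HasCap s a) (hC : AllPos C) (htot : total C ≤ a) :
    ChoiceOK s a (.triangle T) C (chooseTriangle s a C) := by
  have hs0 : 0 < s := by linarith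
  have ha : 0 < a := hT.pos hs0
  have hA := isAngle hs0
  have hm : idealLong s a = cosL s ^ 2 * a := by rw [idealLong, cosL_sq]; ring
  have hm0 : 0 < idealLong s a := by have := hA.C_pos; rw [hm]; positivity
  have hC2 : cosL s ^ 2 * a + sinL s ^ 2 * a = a := by rw [← add_mul, hA.sq, one_mul]
  have hps : AllPos (sortDesc C) := fun c hc => hC c (mem_sortDesc.1 hc)
  have hsort := sortDesc_pairwise C
  have hsp := sortDesc_perm C
  -- A right child of at most ideal capacity needs no large circle, so `b = 0` will do. Only the
  -- greedy case requires more.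
  have mix0 : ∀ aR, aR ≤ sinL s ^ 2 * a →
      ∃ b, 0 ≤ b ∧ (Shape.triangle T).RightOK s a aR b ∧ b = 0 := fun aR h =>
    ⟨0, le_rfl, sqrt_le_mix_of_le hA.S_pos.le hA.S_lt_one.le h, rfl⟩
  unfold chooseTriangle
  dsimp only
  by_cases c1 : ∃ c ∈ C, idealLong s a < c.area
  · rw [if_pos c1]
    cases hD : sortDesc C with
    | nil =>
      obtain ⟨c, hc, -⟩ := c1
      rw [← mem_sortDesc, hD] at hc
      simp at hc
    | cons c L =>
      rw [hD] at hsort hsp hps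
      rw [List.pairwise_cons] at hsort
      have hmax : ∀ d ∈ C, d.area ≤ c.area := by
        intro d hd
        rcases List.mem_cons.1 (hsp.mem_iff.2 hd) with rfl | h
        · exact le_rfl
        · exact hsort.1 d h
      have hcm : idealLong s a < c.area := by
        obtain ⟨d, hd, h⟩ := c1
        exact h.trans_le (hmax d hd)
      have hca : c.area ≤ a := (hC.le_total (hsp.mem_iff.1 (by simp))).trans htot
      have hc0 : 0 < c.area := hps c (by simp)
      have e1 : total [c] = c.area := by simp [total]
      simp only [List.take_succ_cons, List.take_zero, List.drop_succ_cons, List.drop_zero, e1]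
      refine ⟨hsp, e1.le, hc0, Or.inr e1, Or.inl e1, ?_, ?_, ?_, by simp⟩
      · intro d hd
        rw [List.mem_singleton.1 hd]
        refine sqrt_le_mix hA.C_pos.le hA.C_lt_one.le hc0.le hca ?_
        nlinarith [sq_nonneg (cosL s), mul_le_mul_of_nonneg_left hca (sq_nonneg (cosL s))]
      · obtain ⟨b, b0, b1, b2⟩ := mix0 (a - c.area) (by linarith)
        exact ⟨b, b0, b1, Or.inl b2⟩
      · intro _ _ d hd
        exact ⟨c, by simp, hmax d hd⟩
  · rw [if_neg c1]
    push Not at c1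
    by_cases c2 : total C ≤ idealLong s a
    · rw [if_pos c2]
      refine ⟨by simp, c2, hm0, Or.inl rfl, Or.inr ⟨rfl, ?_⟩, ?_, ?_, ?_, fun h => h⟩
      · simp only [idealLong]; field_simp; ring
      · intro d _
        exact sqrt_le_mix_of_le hA.C_pos.le hA.C_lt_one.le hm.le
      · obtain ⟨b, b0, b1, b2⟩ := mix0 (a - idealLong s a) (by linarith)
        exact ⟨b, b0, b1, Or.inl b2⟩
      · intro _ _ d hd
        exact ⟨d, hd, le_rfl⟩
    · rw [if_neg c2]
      have hperm := greedyFill_perm (idealLong s a) (sortDesc C) 0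
      have hle := greedyFill_le (idealLong s a) (sortDesc C) 0 hm0.le
      have hlt := greedyFill_lt (idealLong s a) (sortDesc C) 0 hps
      have hpC := hperm.trans hsp
      cases hD : sortDesc C with
      | nil =>
        rw [hD] at hsp
        rw [← total_perm hsp, total_nil] at c2
        exact absurd hm0.le c2
      | cons c L =>
        have hcm : c.area ≤ idealLong s a := c1 c (mem_sortDesc.1 (by rw [hD]; simp))
        rw [hD] at hsort hsp hps hperm hle hlt hpC
        rw [List.pairwise_cons] at hsort
        have hc0 : 0 < c.area := hps c (by simp)
        have hmax : ∀ d ∈ C, d.area ≤ c.area := by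
          intro d hd
          rcases List.mem_cons.1 (hsp.mem_iff.2 hd) with rfl | h
          · exact le_rfl
          · exact hsort.1 d h
        have hG1 : (greedyFill (idealLong s a) 0 (c :: L)).1 =
            c :: (greedyFill (idealLong s a) (0 + c.area) L).1 := by
          simp [greedyFill, hcm]
        have hG2 : (greedyFill (idealLong s a) 0 (c :: L)).2 =
            (greedyFill (idealLong s a) (0 + c.area) L).2 := by
          simp [greedyFill, hcm]
        have hcG : c ∈ (greedyFill (idealLong s a) 0 (c :: L)).1 := by simp [hG1]
        have hGne : (greedyFill (idealLong s a) 0 (c :: L)).2 ≠ [] := by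
          intro h
          rw [h, List.append_nil] at hpC
          rw [total_perm hpC] at hle
          linarith
        -- A circle rejected by the greedy filling; its area exceeds the deficit, so it can cover an
        -- enlarged right child.
        obtain ⟨d, hd⟩ := List.exists_mem_of_ne_nil _ hGne
        have hGp : AllPos (greedyFill (idealLong s a) 0 (c :: L)).1 :=
          hC.subset fun x hx => hpC.mem_iff.1 (by simp [hx])
        have hGt := hGp.le_total hcG
        have hdG := hlt d hd
        rw [zero_add] at hle hdG
        by_cases c3 : (idealLong s a - total (greedyFill (idealLong s a) 0 (c :: L)).1) / a
            < deltaShort s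
        · rw [if_pos c3]
          refine ⟨hpC, le_rfl, by simp only; linarith, Or.inr rfl, Or.inl rfl, ?_, ?_, ?_, ?_⟩
          · intro x _
            refine sqrt_le_mix_of_le hA.C_pos.le hA.C_lt_one.le ?_
            simp only
            linarith
          · refine ⟨d.area, (hps d (hperm.mem_iff.1 (by simp [hd]))).le, ?_, Or.inr ⟨d, hd, le_rfl⟩⟩
            rw [deltaShort_eq hs0] at c3
            have := short_overflow hA.S_pos hA.S_lt_one ha (sub_nonneg.2 hle)
              (by linarith : _ ≤ d.area) c3
            have e : sinL s ^ 2 * a + (idealLong s a -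
                total (greedyFill (idealLong s a) 0 (c :: L)).1) =
                a - total (greedyFill (idealLong s a) 0 (c :: L)).1 := by linarith
            rw [e] at this
            exact this
          · intro _ _ x hx
            exact ⟨c, hcG, hmax x hx⟩
          · intro _ h
            simp only at h
            rw [h] at hcG
            simp at hcG
        · rw [if_neg c3]
          push Not at c3
          rw [deltaShort_eq hs0] at c3
          have hS2 := sinL_sq_le hs
          cases L with
          | nil =>
            simp [greedyFill, hcm] at hGne
          | cons c' L =>
            have hcc' : c'.area ≤ c.area := hsort.1 c' (by simp)
            have hc'0 : 0 < c'.area := hps c' (by simp)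
            have hsort' := (List.pairwise_cons.1 hsort.2).1
            -- Otherwise both largest circles are kept, the rejected `d` is no larger than either,
            -- and the deficit falls below the threshold by `third_le_delta`.
            have h12 : idealLong s a < c.area + c'.area := by
              by_contra! hcon
              have e1 : total (greedyFill (idealLong s a) 0 (c :: c' :: L)).1 =
                  c.area + (c'.area + total (greedyFill (idealLong s a) (0 + c.area + c'.area) L).1) := by
                simp [greedyFill, hcm, hcon, total_cons]
              have e2 : (greedyFill (idealLong s a) 0 (c :: c' :: L)).2 =
                  (greedyFill (idealLong s a) (0 + c.area + c'.area) L).2 := by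
                simp [greedyFill, hcm, hcon]
              have hGp' : AllPos (greedyFill (idealLong s a) (0 + c.area + c'.area) L).1 :=
                hps.subset fun x hx => by
                  have := (greedyFill_perm (idealLong s a) L _).mem_iff.1 (List.mem_append_left _ hx)
                  simp [this]
              have hdL : d ∈ L := by
                rw [e2] at hd
                exact (greedyFill_perm (idealLong s a) L _).mem_iff.1 (List.mem_append_right _ hd)
              have hdc := hsort' d hdL
              have := hGp'.total_nonneg
              have k := third_le_delta hA hS2
              have k2 := k.trans c3
              rw [le_div_iff₀ ha] at k2
              linarith
            have e12 : total [c, c'] = c.area + c'.area := by simp [total]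
            have hLp : AllPos L := hps.subset fun x hx => by simp [hx]
            have hcct : c.area + c'.area ≤ a := by
              have := total_perm hsp
              rw [total_cons, total_cons] at this
              have := hLp.total_nonneg
              linarith
            simp only [List.take_succ_cons, List.take_zero, List.drop_succ_cons, List.drop_zero, e12]
            have hmain : √(c.area + c'.area) ≤ cosL s * √a + (1 - cosL s) * √c'.area := by
              refine two_largest_overflow hA hS2 ha hcc' (c3.trans ?_) (by linarith)
              gcongr
              linarith
            refine ⟨hsp, e12.le, by simp only; linarith, Or.inr e12, Or.inl e12, ?_, ?_, ?_, by simp⟩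
            · intro x hx
              simp only [List.mem_cons, List.not_mem_nil, or_false] at hx
              rcases hx with rfl | rfl
              · refine hmain.trans ?_
                have := Real.sqrt_le_sqrt hcc'
                have := mul_le_mul_of_nonneg_left this (sub_nonneg.2 hA.C_lt_one.le)
                linarith
              · exact hmain
            · obtain ⟨b, b0, b1, b2⟩ := mix0 (a - (c.area + c'.area)) (by linarith)
              exact ⟨b, b0, b1, Or.inl b2⟩
            · intro _ _ x hx
              exact ⟨c, by simp, hmax x hx⟩

theorem choose_ok {s a : ℝ} (hs : 1 ≤ s) {S : Shape} {C : List Disc}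
    (hS : S.HasCap s a) (hC : AllPos C) (htot : total C ≤ a) :
    ChoiceOK s a S C (choose s S a C) := by
  cases S with
  | square O X Y => exact chooseSquare_ok hS hC htot
  | triangle T => exact chooseTriangle_ok hs hS hC htot

/-! ### The packing tree -/

/-- The relations between two consecutive levels of a packing tree. -/
structure LevelOK (s : ℝ) (l l' : Level) : Prop where
  perm : (l.left ++ l'.contents).Perm l.contents
  cap : l'.cap = l.cap - l.capL
  shape : l'.shape = .triangle (l.shape.rightChild s l.cap l'.cap)
  lt : total l.contents < l.cap
  left_le : total l.left ≤ l.capL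
  capL_pos : 0 < l.capL
  ratio : l.Tight ∨ l'.cap * (1 + s ^ 2) = l.cap
  leftOK : ∀ d ∈ l.left, l.shape.LeftOK s l.cap l.capL d.area
  rightOK : ∃ b, 0 ≤ b ∧ l.shape.RightOK s l.cap l'.cap b ∧ (b = 0 ∨ ∃ d ∈ l'.left, b ≤ d.area)

/-- The invariant of the packing tree for the shape `S` of capacity `a`. -/
structure TreeOK (s a : ℝ) (S : Shape) (t : Tree) : Prop where
  shape : (t 0).shape = S
  cap : (t 0).cap = a
  level : ∀ k, LevelOK s (t k) (t (k + 1))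
  pos : AllPos (t 0).contents
  nodup : (t 0).contents.Nodup
  finite : ∃ N, ∀ k, N ≤ k → (t k).contents = []

namespace TreeOK

variable {s a : ℝ} {S : Shape} {t : Tree}

theorem pos_level (ht : TreeOK s a S t) : ∀ k, AllPos (t k).contents
  | 0 => ht.pos
  | k + 1 => (ht.pos_level k).subset fun x hx => (ht.level k).perm.mem_iff.1 (by simp [hx])

theorem nodup_level (ht : TreeOK s a S t) : ∀ k, (t k).contents.Nodup
  | 0 => ht.nodup
  | k + 1 => by
    have := (ht.level k).perm.nodup_iff.2 (ht.nodup_level k)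
    exact (List.nodup_append.1 this).2.1

theorem left_subset (ht : TreeOK s a S t) (k : ℕ) : (t k).left ⊆ (t k).contents :=
  fun x hx => (ht.level k).perm.mem_iff.1 (by simp [hx])

theorem subset_succ (ht : TreeOK s a S t) (k : ℕ) : (t (k + 1)).contents ⊆ (t k).contents :=
  fun x hx => (ht.level k).perm.mem_iff.1 (by simp [hx])

theorem subset_of_le (ht : TreeOK s a S t) {j k : ℕ} (h : j ≤ k) :
    (t k).contents ⊆ (t j).contents := by
  induction k, h using Nat.le_induction with
  | base => exact fun _ h => h
  | succ k _ ih => exact fun x hx => ih (ht.subset_succ k hx)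

theorem cap_pos (ht : TreeOK s a S t) (k : ℕ) : 0 < (t k).cap :=
  (ht.pos_level k).total_nonneg.trans_lt (ht.level k).lt

theorem hasCap (ht : TreeOK s a S t) (hs : 0 < s) (hS : S.HasCap s a) :
    ∀ k, (t k).shape.HasCap s (t k).cap
  | 0 => by rw [ht.shape, ht.cap]; exact hS
  | k + 1 => by
    rw [(ht.level k).shape]
    exact (ht.hasCap hs hS k).right hs (ht.cap_pos (k + 1))

theorem total_eq (ht : TreeOK s a S t) (k : ℕ) :
    total (t k).left + total (t (k + 1)).contents = total (t k).contents := by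
  rw [← total_append]; exact total_perm (ht.level k).perm

/-- A circle is not in the left child of a level and also further down. -/
theorem not_mem_left (ht : TreeOK s a S t) {c : Disc} {j k : ℕ} (h : j < k)
    (hk : c ∈ (t k).contents) : c ∉ (t j).left := by
  intro hj
  have := (List.nodup_append.1 ((ht.level j).perm.nodup_iff.2 (ht.nodup_level j))).2.2
  exact this c hj c (ht.subset_of_le h hk) rfl

theorem exists_left (ht : TreeOK s a S t) {c : Disc} (hc : c ∈ (t 0).contents) :
    ∃ k, c ∈ (t k).left := by
  by_contra! h
  have key : ∀ k, c ∈ (t k).contents := by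
    intro k
    induction k with
    | zero => exact hc
    | succ k ih =>
      have := (ht.level k).perm.mem_iff.2 ih
      rw [List.mem_append] at this
      exact this.resolve_left (h k)
  obtain ⟨N, hN⟩ := ht.finite
  have := key N
  rw [hN N le_rfl] at this
  simp at this

theorem pos_eq (ht : TreeOK s a S t) {c : Disc} {k : ℕ} (hk : c ∈ (t k).left) :
    t.pos s c = splitPack s (t k).left.length ((t k).shape.leftChild s (t k).cap (t k).capL)
      (t k).capL (t k).left c := by
  have h : ∃ k, c ∈ (t k).left := ⟨k, hk⟩
  have e : Nat.find h = k := by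
    rcases lt_trichotomy (Nat.find h) k with h1 | h1 | h1
    · exact absurd (Nat.find_spec h) (ht.not_mem_left h1 (ht.left_subset k hk))
    · exact h1
    · exact absurd hk (Nat.find_min h h1)
  rw [Tree.pos, dif_pos h, e]

theorem splitPack_left (ht : TreeOK s a S t) (hs : 0 < s) (hS : S.HasCap s a) (k : ℕ) :
    (∀ c ∈ (t k).left,
      ((t k).shape.leftChild s (t k).cap (t k).capL).Fits (t.pos s c) (rad c.area)) ∧
    (∀ c ∈ (t k).left, ∀ d ∈ (t k).left, c ≠ d →
      rad c.area + rad d.area ≤ dist (t.pos s c) (t.pos s d)) ∧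
    (∀ b, 0 ≤ b → (∃ e ∈ (t k).left, b ≤ e.area) → ∀ c ∈ (t k).left,
      ((t k).shape.leftChild s (t k).cap (t k).capL).ClearHyp (sinL s) √(b / (t k).capL)
        (t.pos s c) (rad c.area) ∧
      ((t k).shape.leftChild s (t k).cap (t k).capL).ClearLeg (sinL s) √(b / (t k).capL)
        (t.pos s c) (rad c.area)) := by
  have l := ht.level k
  have hnd := (List.nodup_append.1 (l.perm.nodup_iff.2 (ht.nodup_level k))).1
  obtain ⟨h1, h2, h3⟩ := splitPack_spec hs (t k).left.length _ _ _
    ((ht.hasCap hs hS k).left hs l.capL_pos) hnd ((ht.pos_level k).subset (ht.left_subset k))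
    l.left_le le_rfl
  refine ⟨?_, ?_, ?_⟩
  · intro c hc
    rw [ht.pos_eq hc]; exact h1 c hc
  · intro c hc d hd hcd
    rw [ht.pos_eq hc, ht.pos_eq hd]; exact h2 c hc d hd hcd
  · intro b hb he c hc
    rw [ht.pos_eq hc]; exact h3 b hb he c hc

theorem _root_.OnlineSplitPacking.Shape.HasCap.clear_zero {s a b : ℝ} {S : Shape} {p : Plane}
    (hs : 0 < s) (h : S.HasCap s a) (hb : 0 ≤ b) (hf : S.Fits p (rad b)) :
    S.ClearHyp s √(0 / a) p (rad b) := by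
  cases S with
  | square O X Y => trivial
  | triangle T => exact Triangle.IsRight.clear_zero (isAngle hs) h hb hf

/-- The position of a circle lies in all nodes of the spine that contain the circle, and stays
clear of the corners that other circles occupy. -/
theorem fits_and_clear (ht : TreeOK s a S t) (hs : 0 < s) (hS : S.HasCap s a) {c : Disc} {k : ℕ}
    (hk : c ∈ (t k).left) {j : ℕ} (hj : j ≤ k) :
    (t j).shape.Fits (t.pos s c) (rad c.area) ∧
    ∀ b, 0 ≤ b → (b = 0 ∨ ∃ e ∈ (t j).left, b ≤ e.area) →
      (t j).shape.ClearHyp s √(b / (t j).cap) (t.pos s c) (rad c.area) := by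
  have hcpos : 0 < c.area := ht.pos_level k c (ht.left_subset k hk)
  -- Going up the spine: lying in a node requires clearance inside its right child, so containment
  -- and clearance are proved together.
  induction hj using Nat.decreasingInduction with
  | self =>
    obtain ⟨h1, -, h3⟩ := ht.splitPack_left hs hS k
    have l := ht.level k
    have hcap := ht.hasCap hs hS k
    have hfit := hcap.fits_of_left hs l.capL_pos (h1 c hk) (l.leftOK c hk)
    refine ⟨hfit, ?_⟩
    rintro b hb (rfl | he)
    · exact hcap.clear_zero hs hcpos.le hfit
    · obtain ⟨q1, q2⟩ := h3 b hb he c hk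
      exact hcap.clear_of_left hs l.capL_pos hb q1 q2
  | of_succ j hj ih =>
    have l := ht.level j
    have hcap := ht.hasCap hs hS j
    have hR := ht.cap_pos (j + 1)
    obtain ⟨f, cl⟩ := ih
    -- The circle behind `b` is in the left child of the next level, exactly where the induction
    -- hypothesis provides clearance.
    obtain ⟨b, hb, hbR, hb'⟩ := l.rightOK
    have cl' := cl b hb hb'
    rw [l.shape] at f cl'
    have hfit := hcap.fits_of_right hs hR (rad_nonneg _) hb f cl' hbR
    refine ⟨hfit, ?_⟩
    rintro b' hb0 (rfl | ⟨e, he, hbe⟩)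
    · exact hcap.clear_zero hs hcpos.le hfit
    · refine hcap.clear_of_right hs hR (aL := (t j).capL) (by rw [l.cap]; linarith) (rad_nonneg _)
        hb0 ?_ f
      have hp := (ht.pos_level j).subset (ht.left_subset j)
      exact hbe.trans ((hp.le_total he).trans l.left_le)

theorem add_le_dist_of_lt (ht : TreeOK s a S t) (hs : 0 < s) (hS : S.HasCap s a) {c d : Disc}
    {j k : ℕ} (hj : c ∈ (t j).left) (hk : d ∈ (t k).left) (h : j < k) :
    rad c.area + rad d.area ≤ dist (t.pos s c) (t.pos s d) := by
  have l := ht.level j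
  have f := (ht.fits_and_clear hs hS hk (j := j + 1) h).1
  rw [l.shape] at f
  exact (ht.hasCap hs hS j).add_le_dist hs l.capL_pos (ht.cap_pos (j + 1))
    (by rw [l.cap]; linarith) (rad_nonneg _) (rad_nonneg _) ((ht.splitPack_left hs hS j).1 c hj) f

theorem isPacking (ht : TreeOK s a S t) (hs : 0 < s) (hS : S.HasCap s a) :
    IsPacking S.region {c | c ∈ (t 0).contents} (t.pos s) := by
  constructor
  · intro c hc
    obtain ⟨k, hk⟩ := ht.exists_left hc
    have := (ht.fits_and_clear hs hS hk (Nat.zero_le k)).1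
    rw [ht.shape] at this
    exact this
  · intro c hc d hd hcd
    have hc0 : 0 < c.radius := rad_pos (ht.pos c hc)
    have hd0 : 0 < d.radius := rad_pos (ht.pos d hd)
    rw [disjoint_ball_ball_iff hc0 hd0]
    obtain ⟨j, hj⟩ := ht.exists_left hc
    obtain ⟨k, hk⟩ := ht.exists_left hd
    rcases lt_trichotomy j k with h | rfl | h
    · exact ht.add_le_dist_of_lt hs hS hj hk h
    · exact (ht.splitPack_left hs hS j).2.1 c hj d hk hcd
    · rw [add_comm, dist_comm]
      exact ht.add_le_dist_of_lt hs hS hk hj h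

end TreeOK

/-! ### Repack -/

theorem ChoiceOK.right_pos {s a : ℝ} {S : Shape} {C : List Disc} {ch : Choice}
    (h : ChoiceOK s a S C ch) (hC : AllPos C) : AllPos ch.right :=
  hC.subset fun x hx => h.perm.mem_iff.1 (by simp [hx])

theorem ChoiceOK.right_lt {s a : ℝ} {S : Shape} {C : List Disc} {ch : Choice}
    (h : ChoiceOK s a S C ch) (ha : 0 < a) (htot : total C < a) :
    total ch.right < a - ch.capL := by
  have htt : total ch.left + total ch.right = total C := by
    rw [← total_append]; exact total_perm h.perm
  rcases h.ratio with h' | ⟨h', h2⟩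
  · linarith
  · rw [h', total_nil]
    refine pos_of_mul_pos_left ?_ (show 0 ≤ 1 + s ^ 2 by positivity)
    rw [h2]; exact ha

/-- The recursion enters the right child, so shape, capacity and circles vary in the induction. The
clause on levels that are not tight means that Repack creates no potential; the decreasing length
makes the tree finite. -/
theorem repack_level {s : ℝ} (hs : 1 ≤ s) : ∀ (k : ℕ) (S : Shape) (a : ℝ) (C : List Disc),
    S.HasCap s a → AllPos C → total C < a →
    LevelOK s (repack s S a C k) (repack s S a C (k + 1)) ∧
    (¬ (repack s S a C k).Tight → (repack s S a C (k + 1)).contents = []) ∧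
    (repack s S a C k).contents.length ≤ C.length - k := by
  have hs0 : 0 < s := by linarith
  intro k
  induction k with
  | zero =>
    intro S a C hS hC htot
    have h := choose_ok hs hS hC htot.le
    have hrp := h.right_pos hC
    have hright := h.right_lt (hS.pos hs0) htot
    have hcap : 0 < a - (choose s S a C).capL := hrp.total_nonneg.trans_lt hright
    refine ⟨⟨h.perm, rfl, rfl, htot, h.left_le, h.capL_pos, ?_, h.leftOK, ?_⟩, ?_, by simp [repack]⟩
    · rcases h.ratio with h' | ⟨-, h'⟩
      · exact Or.inl h'
      · exact Or.inr h'
    · obtain ⟨b, b0, bR, hb⟩ := h.rightOK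
      refine ⟨b, b0, bR, ?_⟩
      rcases hb with hb | ⟨d, hd, hbd⟩
      · exact Or.inl hb
      · have h2 := choose_ok hs (S := .triangle (S.rightChild s a (a - (choose s S a C).capL)))
          (hS.right hs0 hcap) hrp hright.le
        obtain ⟨e, he, hde⟩ := h2.max_left _ rfl d hd
        exact Or.inr ⟨e, he, hbd.trans hde⟩
    · intro hn
      exact h.right_le.resolve_right hn
  | succ k ih =>
    intro S a C hS hC htot
    have h := choose_ok hs hS hC htot.le
    have hrp := h.right_pos hC
    have hright := h.right_lt (hS.pos hs0) htot
    have hcap : 0 < a - (choose s S a C).capL := hrp.total_nonneg.trans_lt hright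
    obtain ⟨i1, i2, i3⟩ := ih (.triangle (S.rightChild s a (a - (choose s S a C).capL)))
      (a - (choose s S a C).capL) (choose s S a C).right (hS.right hs0 hcap) hrp hright
    refine ⟨i1, i2, ?_⟩
    refine le_trans (show _ ≤ _ from i3) ?_
    have hlen := h.perm.length_eq
    rw [List.length_append] at hlen
    by_cases hne : C = []
    · subst hne
      simp at hlen
      simp [hlen.2]
    · have := List.length_pos_iff.2 (h.left_ne hne)
      omega

theorem repack_ok {s a : ℝ} (hs : 1 ≤ s) {S : Shape} {C : List Disc} (hS : S.HasCap s a)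
    (hC : AllPos C) (hnd : C.Nodup) (htot : total C < a) : TreeOK s a S (repack s S a C) where
  shape := rfl
  cap := rfl
  level k := (repack_level hs k S a C hS hC htot).1
  pos := hC
  nodup := hnd
  finite := ⟨C.length, fun k hk => List.length_eq_zero_iff.1 (by
    have := (repack_level hs k S a C hS hC htot).2.2
    omega)⟩

/-! ### Insertion -/

/-- Beyond some level there are no circles, so no level is tight and capacities at least halve each
time; eventually the new circle is too large for the right child. -/
theorem TreeOK.exists_not_descends {s a : ℝ} {S : Shape} {t : Tree} (ht : TreeOK s a S t)
    (hs : 1 ≤ s) {c : Disc} (hc : 0 < c.area) : ∃ k, ¬ Descends t c k := by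
  by_contra! h
  obtain ⟨N, hN⟩ := ht.finite
  have key : ∀ i, c.area * 2 ^ i < (t N).cap ∧ (t (N + i)).cap * 2 ^ i ≤ (t N).cap := by
    intro i
    have hleft : ∀ i, ¬ (t (N + i)).Tight := by
      intro i hT
      have h1 : (t (N + i)).left = [] := by
        rw [List.eq_nil_iff_forall_not_mem]
        intro x hx
        have := ht.left_subset _ hx
        rw [hN _ (by omega)] at this
        simp at this
      rw [Level.Tight, h1, total_nil] at hT
      linarith [(ht.level (N + i)).capL_pos]
    have hstep : ∀ i, (t (N + i + 1)).cap * 2 ≤ (t (N + i)).cap := by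
      intro i
      have := (ht.level (N + i)).ratio.resolve_left (hleft i)
      have hp := ht.cap_pos (N + i + 1)
      have : 1 ≤ s ^ 2 := one_le_pow₀ hs
      nlinarith
    have hcap : (t (N + i)).cap * 2 ^ i ≤ (t N).cap := by
      induction i with
      | zero => simp
      | succ i ih =>
        have h1 := hstep i
        have h2 : (t (N + i + 1)).cap * 2 * 2 ^ i ≤ (t (N + i)).cap * 2 ^ i := by gcongr
        calc (t (N + (i + 1))).cap * 2 ^ (i + 1) = (t (N + i + 1)).cap * 2 * 2 ^ i := by
              rw [pow_succ, ← add_assoc]; ring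
          _ ≤ _ := h2.trans ih
    refine ⟨lt_of_lt_of_le ?_ hcap, hcap⟩
    have h1 := (h (N + i)).resolve_left (hleft i)
    rw [hN _ (by omega), total_nil, zero_add] at h1
    have h2 := hstep i
    have h3 := ht.cap_pos (N + i + 1)
    have : c.area < (t (N + i)).cap := by linarith
    gcongr
  obtain ⟨n, hn⟩ := pow_unbounded_of_one_lt ((t N).cap / c.area) (one_lt_two (α := ℝ))
  rw [div_lt_iff₀ hc] at hn
  linarith [(key n).1]

/-- The level at which an insertion stops and repacks, and the resulting tree. -/
theorem insertCircle_eq {s : ℝ} {t : Tree} {c : Disc} (h : ∃ k, ¬ Descends t c k) :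
    ∃ k, ¬ Descends t c k ∧ (∀ j < k, Descends t c j) ∧
      (∀ j < k, insertCircle s t c j = { t j with contents := c :: (t j).contents }) ∧
      (∀ i, insertCircle s t c (k + i) =
        repack s (t k).shape (t k).cap (c :: (t k).contents) i) ∧
      insertMoved t c = c :: (t k).contents := by
  refine ⟨Nat.find h, Nat.find_spec h, fun j hj => not_not.1 (Nat.find_min h hj), ?_, ?_, ?_⟩
  · intro j hj
    simp [insertCircle, h, hj]
  · intro i
    simp [insertCircle, h]
  · simp only [insertMoved, dif_pos h]

/-- An exactly filled left child leaves all free space to the right child; otherwise the rule for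
descending has checked the room. -/
theorem TreeOK.total_add_lt {s a : ℝ} {S : Shape} {t : Tree} (ht : TreeOK s a S t) {c : Disc}
    (htot : total (t 0).contents + c.area < a) {k : ℕ} (hk : ∀ j < k, Descends t c j) :
    total (t k).contents + c.area < (t k).cap := by
  induction k with
  | zero => rw [ht.cap]; exact htot
  | succ k ih =>
    have ih := ih fun j hj => hk j (by omega)
    rcases hk k (by omega) with h | h
    · have h1 := ht.total_eq k
      rw [Level.Tight] at h
      rw [(ht.level k).cap]
      linarith
    · exact h

theorem TreeOK.insertCircle {s a : ℝ} {S : Shape} {t : Tree} (ht : TreeOK s a S t)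
    (hs : 1 ≤ s) (hS : S.HasCap s a) {c : Disc} (hc : 0 < c.area) (hnew : c ∉ (t 0).contents)
    (htot : total (t 0).contents + c.area < a) :
    TreeOK s a S (insertCircle s t c) ∧
      (OnlineSplitPacking.insertCircle s t c 0).contents = c :: (t 0).contents := by
  have hs0 : 0 < s := by linarith
  obtain ⟨k, -, hdesc, hlt, hge, -⟩ := insertCircle_eq (s := s) (ht.exists_not_descends hs hc)
  set t' := OnlineSplitPacking.insertCircle s t c
  have hkc := ht.hasCap hs0 hS k
  have hpos : AllPos (c :: (t k).contents) := by
    intro d hd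
    rcases List.mem_cons.1 hd with rfl | h
    · exact hc
    · exact ht.pos_level k d h
  have htot' : total (c :: (t k).contents) < (t k).cap := by
    rw [total_cons, add_comm]; exact ht.total_add_lt htot hdesc
  have hnd : (c :: (t k).contents).Nodup :=
    List.nodup_cons.2 ⟨fun h => hnew (ht.subset_of_le (Nat.zero_le k) h), ht.nodup_level k⟩
  have hrep := repack_ok hs hkc hpos hnd htot'
  have hk0 : t' k = repack s (t k).shape (t k).cap (c :: (t k).contents) 0 := hge 0
  have hcont : ∀ j ≤ k, (t' j).contents = c :: (t j).contents := by
    intro j hj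
    rcases hj.lt_or_eq with h | rfl
    · rw [hlt j h]
    · rw [hk0]; rfl
  have hshape : ∀ j ≤ k, (t' j).shape = (t j).shape := by
    intro j hj
    rcases hj.lt_or_eq with h | rfl
    · rw [hlt j h]
    · rw [hk0]; rfl
  have hcap : ∀ j ≤ k, (t' j).cap = (t j).cap := by
    intro j hj
    rcases hj.lt_or_eq with h | rfl
    · rw [hlt j h]
    · rw [hk0]; rfl
  refine ⟨⟨?_, ?_, ?_, ?_, ?_, ?_⟩, hcont 0 (Nat.zero_le _)⟩
  · rw [hshape 0 (Nat.zero_le _), ht.shape]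
  · rw [hcap 0 (Nat.zero_le _), ht.cap]
  · intro j
    rcases lt_or_ge j k with h | h
    · have l := ht.level j
      have c1 := hcont (j + 1) h
      have p1 := hcap (j + 1) h
      have s1 := hshape (j + 1) h
      have e := hlt j h
      refine ⟨?_, ?_, ?_, ?_, ?_, ?_, ?_, ?_, ?_⟩
      · rw [c1, e]
        exact List.perm_middle.trans (l.perm.cons c)
      · rw [p1, e]; exact l.cap
      · rw [s1, p1, e]; exact l.shape
      · rw [e]
        simp only [total_cons]
        rw [add_comm]
        exact ht.total_add_lt htot fun i hi => hdesc i (by omega)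
      · rw [e]; exact l.left_le
      · rw [e]; exact l.capL_pos
      · rw [p1, e]; exact l.ratio
      · rw [e]; exact l.leftOK
      · obtain ⟨b, b0, bR, hb⟩ := l.rightOK
        rw [p1, e]
        refine ⟨b, b0, bR, ?_⟩
        rcases hb with hb | ⟨d, hd, hbd⟩
        · exact Or.inl hb
        · right
          rcases (show j + 1 ≤ k from h).lt_or_eq with h' | rfl
          · rw [hlt (j + 1) h']; exact ⟨d, hd, hbd⟩
          · rw [hk0]
            -- Just above the repacked node the old witness may have moved, but the new left child
            -- contains a circle at least as large.
            obtain ⟨x, hx, hdx⟩ := (choose_ok hs hkc hpos htot'.le).max_left _ l.shape d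
              (List.mem_cons_of_mem _ (ht.left_subset _ hd))
            exact ⟨x, hx, hbd.trans hdx⟩
    · obtain ⟨i, rfl⟩ := Nat.exists_eq_add_of_le h
      rw [add_assoc, hge i, hge (i + 1)]
      exact hrep.level i
  · rw [hcont 0 (Nat.zero_le _)]
    intro d hd
    rcases List.mem_cons.1 hd with rfl | h
    · exact hc
    · exact ht.pos d h
  · rw [hcont 0 (Nat.zero_le _)]
    exact List.nodup_cons.2 ⟨hnew, ht.nodup⟩
  · obtain ⟨N, hN⟩ := hrep.finite
    refine ⟨k + N, fun j hj => ?_⟩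
    obtain ⟨i, rfl⟩ := Nat.exists_eq_add_of_le (show k ≤ j by omega)
    rw [hge i]
    exact hN i (by omega)

/-- Circles that are not declared as reallocated keep their places. -/
theorem TreeOK.pos_insertCircle {s a : ℝ} {S : Shape} {t : Tree} (ht : TreeOK s a S t)
    (hs : 1 ≤ s) (hS : S.HasCap s a) {c d : Disc} (hc : 0 < c.area) (hnew : c ∉ (t 0).contents)
    (htot : total (t 0).contents + c.area < a) (hd : d ∈ (t 0).contents)
    (hmoved : d ∉ insertMoved t c) :
    Tree.pos s (OnlineSplitPacking.insertCircle s t c) d = Tree.pos s t d := by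
  have ht' := (ht.insertCircle hs hS hc hnew htot).1
  obtain ⟨k, -, hdesc, hlt, hge, hm⟩ := insertCircle_eq (s := s) (ht.exists_not_descends hs hc)
  rw [hm, List.mem_cons, not_or] at hmoved
  obtain ⟨j, hj⟩ := ht.exists_left hd
  have hjk : j < k := by
    by_contra! h
    exact hmoved.2 (ht.subset_of_le h (ht.left_subset j hj))
  have hj' : d ∈ (OnlineSplitPacking.insertCircle s t c j).left := by rw [hlt j hjk]; exact hj
  rw [ht'.pos_eq hj', ht.pos_eq hj, hlt j hjk]

/-! ### The potential of a tree -/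

/-- The potential of the first `N` levels: each level whose left child is not exactly filled
collects `1 + s²` times the area that its right child contains. -/
def potential (s : ℝ) (N : ℕ) (t : Tree) : ℝ :=
  ∑ k ∈ Finset.range N,
    if (t k).Tight then 0 else (1 + s ^ 2) * total (t (k + 1)).contents

namespace TreeOK

variable {s a : ℝ} {S : Shape} {t : Tree}

theorem potential_term_nonneg (ht : TreeOK s a S t) (k : ℕ) :
    0 ≤ if (t k).Tight then 0 else (1 + s ^ 2) * total (t (k + 1)).contents := by
  have := (ht.pos_level (k + 1)).total_nonneg
  split_ifs <;> positivity

theorem potential_nonneg (ht : TreeOK s a S t) (N : ℕ) : 0 ≤ potential s N t :=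
  Finset.sum_nonneg fun k _ => ht.potential_term_nonneg k

theorem potential_mono (ht : TreeOK s a S t) {M N : ℕ} (h : M ≤ N) :
    potential s M t ≤ potential s N t :=
  Finset.sum_le_sum_of_subset_of_nonneg (by simpa using h) fun k _ _ => ht.potential_term_nonneg k

/-- A level that is not tight contributes at most its capacity, while the right child has at most
half of it. Hence the contribution is at most twice the drop in capacity, and the drops telescope.
-/
theorem potential_le (ht : TreeOK s a S t) (hs : 1 ≤ s) (N : ℕ) : potential s N t ≤ 2 * a := by
  have key : potential s N t ≤ 2 * (a - (t N).cap) := by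
    induction N with
    | zero => simp [potential, ht.cap]
    | succ N ih =>
      have l := ht.level N
      have h1 := (ht.level (N + 1)).lt
      have h2 := ht.cap_pos (N + 1)
      have h3 := l.cap
      have h4 := l.capL_pos
      have h5 : 1 ≤ s ^ 2 := one_le_pow₀ hs
      have e : potential s (N + 1) t = potential s N t +
          if (t N).Tight then 0 else (1 + s ^ 2) * total (t (N + 1)).contents :=
        Finset.sum_range_succ _ _
      rw [e]
      split_ifs with hT
      · linarith
      · have h6 := l.ratio.resolve_left hT
        have h7 := mul_le_mul_of_nonneg_left h1.le (show 0 ≤ 1 + s ^ 2 by positivity)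
        nlinarith
  linarith [ht.cap_pos N]

end TreeOK

/-- Up to `w`, concavity puts the logarithm above its chord from 1 to `w`; beyond `w` it is at least
1. -/
theorem min_le_one_add_logb {w y : ℝ} (hw : 1 < w) (hy : 1 ≤ y) :
    min y w ≤ 1 + w * Real.logb w y := by
  have hlw : 0 < Real.log w := Real.log_pos hw
  rcases le_total w y with h | h
  · have : 1 ≤ Real.logb w y := by
      rw [Real.le_logb_iff_rpow_le hw (by linarith), Real.rpow_one]; exact h
    rw [min_eq_right h]
    nlinarith
  · rw [min_eq_left h]
    have hw1 : 0 < w - 1 := by linarith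
    have hc := strictConcaveOn_log_Ioi.concaveOn.2 (show (1 : ℝ) ∈ Set.Ioi 0 by simp)
      (show w ∈ Set.Ioi 0 from lt_trans one_pos hw)
      (show 0 ≤ 1 - (y - 1) / (w - 1) by rw [sub_nonneg, div_le_one hw1]; linarith)
      (show 0 ≤ (y - 1) / (w - 1) from div_nonneg (by linarith) hw1.le) (by ring)
    have e : (1 - (y - 1) / (w - 1)) • (1 : ℝ) + ((y - 1) / (w - 1)) • w = y := by
      simp only [smul_eq_mul]; field_simp; ring
    rw [e, Real.log_one, smul_zero, zero_add, smul_eq_mul] at hc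
    have h2 : (y - 1) / (w - 1) ≤ Real.logb w y := by
      rw [Real.logb, le_div_iff₀ hlw]; exact hc
    have h3 : y - 1 ≤ w * ((y - 1) / (w - 1)) := by
      rw [← mul_div_assoc, le_div_iff₀ hw1]; nlinarith
    nlinarith

/-- The levels that an insertion descends through and that are not exactly filled. -/
theorem TreeOK.descend_le {s a : ℝ} {S : Shape} {t : Tree} (ht : TreeOK s a S t) (hs : 1 ≤ s)
    {x : ℝ} (hx : 0 ≤ x) (k : ℕ) :
    (∑ j ∈ Finset.range k, if (t j).Tight then 0 else (1 + s ^ 2) * x) ≤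
      (1 + s ^ 2) * x * Real.logb (1 + s ^ 2) (a / (t k).cap) := by
  have hw : 1 < 1 + s ^ 2 := by have : 1 ≤ s ^ 2 := one_le_pow₀ hs; linarith
  have ha : 0 < a := by rw [← ht.cap]; exact ht.cap_pos 0
  induction k with
  | zero => simp [ht.cap, div_self ha.ne']
  | succ k ih =>
    have l := ht.level k
    have h1 := ht.cap_pos k
    have h2 := ht.cap_pos (k + 1)
    rw [Finset.sum_range_succ]
    split_ifs with hT
    · rw [add_zero]
      refine ih.trans ?_
      have : Real.logb (1 + s ^ 2) (a / (t k).cap) ≤ Real.logb (1 + s ^ 2) (a / (t (k + 1)).cap) := by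
        refine Real.logb_le_logb_of_le hw (by positivity) ?_
        gcongr
        linarith [l.cap, l.capL_pos]
      gcongr
    · have h3 := l.ratio.resolve_left hT
      have e : Real.logb (1 + s ^ 2) (a / (t (k + 1)).cap) =
          Real.logb (1 + s ^ 2) (a / (t k).cap) + 1 := by
        have : a / (t (k + 1)).cap = a / (t k).cap * (1 + s ^ 2) := by
          rw [← h3]; field_simp
        rw [this, Real.logb_mul (by positivity) (by positivity), Real.logb_self_eq_one hw]
      rw [e]
      linarith

/-- The amortised cost of a basic insertion. -/
theorem TreeOK.insert_cost {s a : ℝ} {S : Shape} {t : Tree} (ht : TreeOK s a S t)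
    (hs : 1 ≤ s) (hS : S.HasCap s a) {c : Disc} (hc : 0 < c.area)
    (htot : total (t 0).contents + c.area < a) :
    ∃ N₀, ∀ N, N₀ ≤ N →
      total (insertMoved t c) + potential s N (OnlineSplitPacking.insertCircle s t c) ≤
        potential s N t +
          c.area * (1 + (1 + s ^ 2) * Real.logb (1 + s ^ 2) (a / c.area)) := by
  have hs0 : 0 < s := by linarith
  have hw : 1 < 1 + s ^ 2 := by have : 1 ≤ s ^ 2 := one_le_pow₀ hs; linarith
  have ha : 0 < a := hS.pos hs0
  obtain ⟨k, hn, hdesc, hlt, hge, hm⟩ := insertCircle_eq (s := s) (ht.exists_not_descends hs hc)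
  -- The truncated potential has to include the level `k` whose potential pays for the Repack.
  refine ⟨k + 1, fun N hN => ?_⟩
  set t' := OnlineSplitPacking.insertCircle s t c
  have hkc := ht.hasCap hs0 hS k
  have hpos : AllPos (c :: (t k).contents) := by
    intro d hd
    rcases List.mem_cons.1 hd with rfl | h
    · exact hc
    · exact ht.pos_level k d h
  have hk := ht.total_add_lt htot hdesc
  have htot' : total (c :: (t k).contents) < (t k).cap := by
    rw [total_cons, add_comm]; exact hk
  -- Freshly repacked levels are tight or have an empty right child, so they carry no potential.
  have e1 : potential s N t' = potential s k t' := by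
    refine (Finset.sum_subset (by simpa using (by omega : k ≤ N)) ?_).symm
    intro j _ hj
    obtain ⟨i, rfl⟩ := Nat.exists_eq_add_of_le (show k ≤ j by simpa using hj)
    have hg2 := hge (i + 1)
    rw [← add_assoc] at hg2
    rw [hge i, hg2]
    have := (repack_level hs i _ _ _ hkc hpos htot').2.1
    split_ifs with hT
    · rfl
    · rw [this hT, total_nil, mul_zero]
  have e2 : potential s k t' = potential s k t +
      ∑ j ∈ Finset.range k, if (t j).Tight then 0 else (1 + s ^ 2) * c.area := by
    rw [potential, potential, ← Finset.sum_add_distrib]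
    refine Finset.sum_congr rfl fun j hj => ?_
    have hj : j < k := by simpa using hj
    have hc1 : (t' (j + 1)).contents = c :: (t (j + 1)).contents := by
      rcases (show j + 1 ≤ k from hj).lt_or_eq with h | h
      · rw [hlt _ h]
      · rw [h, ← add_zero k, hge 0]; rfl
    have hT : (t' j).Tight ↔ (t j).Tight := by rw [hlt j hj]; rfl
    rw [hc1, total_cons]
    by_cases h : (t j).Tight
    · simp [h, hT]
    · simp only [h, hT, if_false]; ring
  rw [Descends, not_or, not_lt] at hn
  -- The old potential of level `k`, which the Repack consumes.
  have e3 : potential s k t + (1 + s ^ 2) * total (t (k + 1)).contents ≤ potential s N t := by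
    refine le_trans (le_of_eq ?_) (ht.potential_mono hN)
    rw [potential, potential, Finset.sum_range_succ, if_neg hn.1]
  have hr := (ht.level k).ratio.resolve_left hn.1
  have h1 := mul_le_mul_of_nonneg_left hn.2 (show 0 ≤ 1 + s ^ 2 by positivity)
  have h2 := (ht.pos_level (k + 1)).total_nonneg
  have h2' : 0 ≤ (1 + s ^ 2) * total (t (k + 1)).contents := by positivity
  have h3 := ht.descend_le hs hc.le k
  have hck : c.area ≤ (t k).cap := by
    have := (ht.pos_level k).total_nonneg
    linarith
  have hcap := ht.cap_pos k
  have h4 := mul_le_mul_of_nonneg_left (min_le_one_add_logb hw ((one_le_div hc).2 hck)) hc.le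
  rw [mul_min_of_nonneg _ _ hc.le, mul_div_cancel₀ _ hc.ne'] at h4
  -- The unpaid cost is below the capacity of the node. It is also below `1 + s ^ 2` times `c.area`,
  -- because with `c` the right child would be full. The minimum of both is needed for the
  -- logarithms to telescope.
  have h5 : total (c :: (t k).contents) - (1 + s ^ 2) * total (t (k + 1)).contents ≤
      min (t k).cap (c.area * (1 + s ^ 2)) := by
    refine le_min (by linarith) ?_
    linarith
  have h6 : Real.logb (1 + s ^ 2) (a / c.area) = Real.logb (1 + s ^ 2) (a / (t k).cap) +
      Real.logb (1 + s ^ 2) ((t k).cap / c.area) := by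
    rw [← Real.logb_mul (by positivity) (by positivity), div_mul_div_cancel₀ hcap.ne']
  rw [hm, e1, e2, h6]
  linarith

/-! ### Capacity -/

theorem Triangle.hasCap {s : ℝ} {T : Triangle} (h : (Shape.triangle T).IsSShape s) :
    T.IsRight (cosL s) (sinL s) T.capacity := by
  obtain ⟨hs, hl, hL, hin⟩ := h
  have hs0 : 0 < s := by linarith
  have hA := isAngle hs0
  have hw : 0 < √(1 + s ^ 2) := by positivity
  set l := dist T.Q T.H with hldef
  have eC : cosL s * (l * √(1 + s ^ 2)) = s * l := by rw [cosL]; field_simp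
  have eS : sinL s * (l * √(1 + s ^ 2)) = l := by rw [sinL]; field_simp
  have nL : ‖T.L - T.Q‖ = s * l := by rw [← hL, dist_eq_norm]
  have nH : ‖T.H - T.Q‖ = l := by rw [hldef, dist_comm, dist_eq_norm]
  have hsl : 0 < s * l := by positivity
  have F : T.Frame (cosL s) (sinL s) (l * √(1 + s ^ 2)) ((s * l)⁻¹ • (T.L - T.Q))
      (l⁻¹ • (T.H - T.Q)) := by
    refine ⟨?_, ?_, ?_, ?_, ?_⟩
    · rw [real_inner_smul_left, real_inner_smul_right, real_inner_self_eq_norm_sq, nL]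
      field_simp
    · rw [real_inner_smul_left, real_inner_smul_right, real_inner_self_eq_norm_sq, nH]
      field_simp
    · rw [real_inner_smul_left, real_inner_smul_right, hin, mul_zero, mul_zero]
    · rw [eC, smul_smul, mul_inv_cancel₀ hsl.ne', one_smul, add_sub_cancel]
    · rw [eS, smul_smul, mul_inv_cancel₀ hl.ne', one_smul, add_sub_cancel]
  refine ⟨_, _, _, by positivity, F, ?_⟩
  rw [Triangle.capacity, F.dist_LQ (by rw [eC]; exact hsl.le), F.dist_QH (by rw [eS]; exact hl.le),
    F.dist_LH hA (by positivity)]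
  ring

theorem Shape.IsSShape.hasCap {s : ℝ} {S : Shape} (h : S.IsSShape s) :
    S.HasCap s S.capacity := by
  cases S with
  | square O X Y =>
    obtain ⟨rfl, h1, h2, h3⟩ := h
    refine ⟨rfl, ?_⟩
    have e : Shape.capacity (.square O X Y) / 2 = Triangle.capacity ⟨X, O, Y⟩ := by
      simp [Shape.capacity]
    rw [e]
    refine Triangle.hasCap ⟨le_rfl, ?_, ?_, h3⟩
    · simp only [h2]; exact h1
    · simp only [one_mul, h2]; exact dist_comm _ _
  | triangle T => exact Triangle.hasCap h

theorem Shape.IsSShape.one_le {s : ℝ} {S : Shape} (h : S.IsSShape s) : 1 ≤ s := by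
  cases S with
  | square O X Y => exact h.1.ge
  | triangle T => exact h.1

theorem isPacking_of_add_le_dist {R : Set Plane} {C : List Disc} {pos : Disc → Plane}
    (hC : AllPos C) (h1 : ∀ c ∈ C, Metric.closedBall (pos c) (rad c.area) ⊆ R)
    (h2 : ∀ c ∈ C, ∀ d ∈ C, c ≠ d → rad c.area + rad d.area ≤ dist (pos c) (pos d)) :
    IsPacking R {c | c ∈ C} pos := by
  refine ⟨h1, fun c hc d hd hcd => ?_⟩
  have hc0 : 0 < c.radius := rad_pos (hC c hc)
  have hd0 : 0 < d.radius := rad_pos (hC d hd)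
  rw [disjoint_ball_ball_iff hc0 hd0]
  exact h2 c hc d hd hcd

/-- Circles of total area at most the capacity can be packed offline. -/
theorem exists_isPacking {s a : ℝ} (hs : 1 ≤ s) {S : Shape} (hS : S.HasCap s a)
    {C : List Disc} (hC : AllPos C) (hnd : C.Nodup) (htot : total C ≤ a) :
    ∃ pos, IsPacking S.region {c | c ∈ C} pos := by
  have hs0 : 0 < s := by linarith
  cases S with
  | triangle T =>
    obtain ⟨h1, h2, -⟩ := splitPack_spec hs0 C.length T a C hS hnd hC htot le_rfl
    exact ⟨_, isPacking_of_add_le_dist hC h1 h2⟩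
  | square O X Y =>
    -- Trees require a total strictly below the capacity. Here equality is allowed, so the square is
    -- divided once and both halves are filled by Split Packing.
    have h := choose_ok hs hS hC htot
    set ch := choose s (.square O X Y) a C
    have htt : total ch.left + total ch.right = total C := by
      rw [← total_append]; exact total_perm h.perm
    have hnd' := List.nodup_append.1 (h.perm.nodup_iff.2 hnd)
    have hlp : AllPos ch.left := hC.subset fun x hx => h.perm.mem_iff.1 (by simp [hx])
    have hrp := h.right_pos hC
    have hcap : ch.right ≠ [] → 0 < a - ch.capL ∧ total ch.right ≤ a - ch.capL := by
      intro hne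
      have h1 := hrp.total_pos hne
      have h2 := h.right_le.resolve_left hne
      constructor <;> linarith
    obtain ⟨l1, l2, -⟩ := splitPack_spec hs0 ch.left.length _ _ ch.left
      (hS.left hs0 h.capL_pos) hnd'.1 hlp h.left_le le_rfl
    have hr : ∀ c ∈ ch.right, 0 < a - ch.capL ∧ total ch.right ≤ a - ch.capL :=
      fun c hc => hcap (List.ne_nil_of_mem hc)
    have rspec : ∀ c₀ ∈ ch.right, _ := fun c₀ hc₀ =>
      splitPack_spec hs0 ch.right.length _ _ ch.right
        (hS.right hs0 (hr c₀ hc₀).1) hnd'.2.1 hrp (hr c₀ hc₀).2 le_rfl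
    set pl := splitPack s ch.left.length (Shape.leftChild s a ch.capL (.square O X Y)) ch.capL ch.left
    set pr := splitPack s ch.right.length (Shape.rightChild s a (a - ch.capL) (.square O X Y))
      (a - ch.capL) ch.right
    have hmem : ∀ c ∈ C, c ∈ ch.left ∨ c ∉ ch.left ∧ c ∈ ch.right := by
      intro c hc
      have := h.perm.mem_iff.2 hc
      rw [List.mem_append] at this
      tauto
    have hbetw : ∀ c ∈ ch.left, ∀ d ∈ ch.right, rad c.area + rad d.area ≤ dist (pl c) (pr d) :=
      fun c hc d hd => hS.add_le_dist hs0 h.capL_pos (hr d hd).1 (by linarith) (rad_nonneg _)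
        (rad_nonneg _) (l1 c hc) ((rspec d hd).1 d hd)
    refine ⟨fun c => if c ∈ ch.left then pl c else pr c, isPacking_of_add_le_dist hC ?_ ?_⟩
    · intro c hc
      rcases hmem c hc with hl | ⟨hl, hl'⟩
      · simp only [hl, if_true]
        exact hS.fits_of_left hs0 h.capL_pos (l1 c hl) (h.leftOK c hl)
      · simp only [hl, if_false]
        obtain ⟨b, -, bR, -⟩ := h.rightOK
        have hf := (rspec c hl').1 c hl'
        exact hS.fits_of_right hs0 (hr c hl').1 (rad_nonneg _) le_rfl hf
          (((hS.right hs0 (hr c hl').1)).clear_zero (isAngle hs0) (hC c hc).le hf) (b := 0) bR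
    · intro c hc d hd hcd
      rcases hmem c hc with hl | ⟨hl, hl'⟩ <;> rcases hmem d hd with hg | ⟨hg, hg'⟩
      · simp only [hl, hg, if_true]; exact l2 c hl d hg hcd
      · simp only [hl, hg, if_true, if_false]; exact hbetw c hl d hg'
      · simp only [hl, hg, if_true, if_false]
        rw [add_comm, dist_comm]; exact hbetw d hg c hl'
      · simp only [hl, hg, if_false]; exact (rspec c hl').2.1 c hl' d hg' hcd

/-- Adding the three distance conditions with weights sine, cosine and 1 eliminates the centre and
leaves the inradius. -/
theorem Triangle.IsRight.rad_le {C S a b : ℝ} {T : Triangle} {p : Plane} (hA : IsAngle C S)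
    (hT : T.IsRight C S a) (hf : T.Fits p (rad b)) : rad b ≤ rad a := by
  obtain ⟨h, u, v, h0, F, rfl⟩ := hT
  rw [F.fits_iff hA h0 (rad_nonneg _)] at hf
  rw [Triangle.IsRight.rad_eq hA h0]
  have hS := hA.S_pos
  have hC := hA.C_pos
  obtain ⟨f1, f2, f3⟩ := hf
  have e2 : S * C * h = h * (C + S - 1) / 2 * (1 + S + C) := by linear_combination -(h / 2) * hA.sq
  rw [e2] at f3
  refine le_of_mul_le_mul_right (a := 1 + S + C) ?_ (by positivity)
  linarith [mul_le_mul_of_nonneg_left f1 hS.le, mul_le_mul_of_nonneg_left f2 hC.le]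

/-- Two equal circles in a square are not larger than the incircles of its halves. -/
theorem Shape.HasCap.rad_le_of_two {s a b : ℝ} {O X Y p q : Plane}
    (hS : (Shape.square O X Y).HasCap s a) (hp : (Shape.square O X Y).Fits p (rad b))
    (hq : (Shape.square O X Y).Fits q (rad b)) (hd : rad b + rad b ≤ dist p q) :
    rad b ≤ rad (a / 2) := by
  obtain ⟨rfl, h, u, v, h0, F, e⟩ := hS
  have hA := isAngle one_pos
  rw [cosL_one] at F e hA
  have hc := hA.S_pos
  rw [F.square_fits_iff hc h0 (rad_nonneg _)] at hp hq
  rw [e, Triangle.IsRight.rad_eq hA h0]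
  have hr := rad_nonneg b
  set r := rad b
  have e1 := eq_add_of_orthonormal F.uu F.vv F.uv (p - q)
  have e0 : p - q = (p - O) - (q - O) := by abel
  have en : dist p q ^ 2 = (inner ℝ (p - q) u : ℝ) ^ 2 + (inner ℝ (p - q) v : ℝ) ^ 2 := by
    rw [dist_eq_norm, ← real_inner_self_eq_norm_sq]
    nth_rw 2 [e1]
    rw [inner_add_right, real_inner_smul_right, real_inner_smul_right]
    ring
  rw [e0, inner_sub_left (p - O), inner_sub_left (p - O)] at en
  set x : ℝ := inner ℝ (p - O) u
  set y : ℝ := inner ℝ (p - O) v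
  set x' : ℝ := inner ℝ (q - O) u
  set y' : ℝ := inner ℝ (q - O) v
  set c := sinL 1
  obtain ⟨⟨p1, p2⟩, p3, p4⟩ := hp
  obtain ⟨⟨q1, q2⟩, q3, q4⟩ := hq
  -- Both centres lie in a square of side `c * h - 2 * r`, so their distance is at most its
  -- diagonal.
  have hx : (x - x') ^ 2 ≤ (c * h - 2 * r) ^ 2 := sq_le_sq' (by linarith) (by linarith)
  have hy : (y - y') ^ 2 ≤ (c * h - 2 * r) ^ 2 := sq_le_sq' (by linarith) (by linarith)
  have hd2 : (r + r) ^ 2 ≤ dist p q ^ 2 := pow_le_pow_left₀ (by linarith) hd 2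
  have hsq := hA.sq
  have k : (2 * r * c) ^ 2 ≤ (c * h - 2 * r) ^ 2 := by
    have : (r + r) ^ 2 ≤ 2 * (c * h - 2 * r) ^ 2 := by linarith
    have h3 := mul_le_mul_of_nonneg_left this (sq_nonneg c)
    have h4 : c ^ 2 * (2 * (c * h - 2 * r) ^ 2) = (c * h - 2 * r) ^ 2 := by
      linear_combination (c * h - 2 * r) ^ 2 * hsq
    rw [h4] at h3
    linarith [show (2 * r * c) ^ 2 = c ^ 2 * (r + r) ^ 2 by ring]
  have k2 : 2 * r * c ≤ c * h - 2 * r := le_of_sq_le_sq k (by linarith)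
  refine le_of_mul_le_mul_right (a := 2 * (1 + c)) ?_ (by positivity)
  linear_combination k2 - h * hsq

theorem isCapacity {s : ℝ} {S : Shape} (h : S.IsSShape s) : IsCapacity S.region S.capacity := by
  have hS := h.hasCap
  have hs := h.one_le
  have hs0 : 0 < s := by linarith
  constructor
  · intro C hC htot
    have e : total C.toList = ∑ c ∈ C, c.area := by simp [total]
    obtain ⟨pos, hpos⟩ := exists_isPacking hs hS (C := C.toList)
      (fun c hc => hC c (by simpa using hc)) C.nodup_toList (by rw [e]; exact htot)
    refine ⟨pos, ?_⟩
    have e2 : {c | c ∈ C.toList} = (C : Set Disc) := by ext c; simp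
    rwa [e2] at hpos
  · intro A hA
    by_contra! hlt
    have ha := hS.pos hs0
    have hA0 : 0 < A := ha.trans hlt
    cases S with
    | triangle T =>
      -- A single circle larger than the incircle refutes a greater capacity.
      obtain ⟨pos, hp, -⟩ := hA {⟨0, A⟩} (by simpa using hA0) (by simp)
      have h1 : T.Fits (pos ⟨0, A⟩) (rad A) := hp ⟨0, A⟩ (by simp)
      have h2 := Triangle.IsRight.rad_le (isAngle hs0) hS h1
      have h3 : rad (Shape.capacity (.triangle T)) < rad A :=
        Real.sqrt_lt_sqrt (by positivity) (by gcongr)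
      linarith
    | square O X Y =>
      have hne : (⟨0, A / 2⟩ : Disc) ≠ ⟨1, A / 2⟩ := by simp
      -- For squares the extremal instance consists of two equal circles.
      obtain ⟨pos, hp, hd⟩ := hA {⟨0, A / 2⟩, ⟨1, A / 2⟩} (by simp [hA0])
        (by rw [Finset.sum_pair hne]; simp)
      have hr : 0 < rad (A / 2) := rad_pos (by positivity)
      have h1 : (Shape.square O X Y).Fits (pos ⟨0, A / 2⟩) (rad (A / 2)) := hp ⟨0, A / 2⟩ (by simp)
      have h2 : (Shape.square O X Y).Fits (pos ⟨1, A / 2⟩) (rad (A / 2)) := hp ⟨1, A / 2⟩ (by simp)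
      have h3 := (disjoint_ball_ball_iff hr hr).1 (hd ⟨0, A / 2⟩ (by simp) ⟨1, A / 2⟩ (by simp) hne)
      have h4 := hS.rad_le_of_two h1 h2 h3
      have h5 : rad (Shape.capacity (.square O X Y) / 2) < rad (A / 2) :=
        Real.sqrt_lt_sqrt (by positivity) (by gcongr)
      linarith

/-! ### Request sequences -/

theorem Admissible.facts {A : ℝ} {ω : List Request} {act : List Disc} (h : Admissible A ω act) :
    AllPos act ∧ act.Nodup ∧ ∀ d ∈ act, Request.insert d ∈ ω := by
  induction h with
  | nil => simp [AllPos]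
  | @insert ω act c _ hpos hnew _ ih =>
    obtain ⟨h1, h2, h3⟩ := ih
    refine ⟨?_, ?_, ?_⟩
    · intro d hd
      rcases List.mem_append.1 hd with h | h
      · exact h1 d h
      · rw [List.mem_singleton.1 h]; exact hpos
    · refine List.nodup_append.2 ⟨h2, by simp, ?_⟩
      rintro x hx y hy rfl
      rw [List.mem_singleton.1 hy] at hx
      exact hnew c (h3 c hx) rfl
    · intro d hd
      rcases List.mem_append.1 hd with h | h
      · exact List.mem_append_left _ (h3 d h)
      · rw [List.mem_singleton.1 h]; simp
  | @delete ω act c _ _ ih =>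
    obtain ⟨h1, h2, h3⟩ := ih
    have hsub : act.filter (fun d => d.id ≠ c.id) ⊆ act := fun x hx => (List.mem_filter.1 hx).1
    exact ⟨h1.subset hsub, h2.filter _, fun d hd => List.mem_append_left _ (h3 d (hsub hd))⟩

theorem OnlineAlgorithm.run_append (alg : OnlineAlgorithm) (ω : List Request) (r : Request) :
    alg.run (ω ++ [r]) = alg.step (alg.run ω) r := by
  simp [OnlineAlgorithm.run]

theorem OnlineAlgorithm.costFrom_append (alg : OnlineAlgorithm) (ω : List Request) (r : Request) :
    ∀ σ, alg.costFrom σ (ω ++ [r]) =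
      alg.costFrom σ ω + total (alg.moved (ω.foldl alg.step σ) r) := by
  induction ω with
  | nil => intro σ; simp [OnlineAlgorithm.costFrom]
  | cons r' ω ih =>
    intro σ
    simp only [List.cons_append, OnlineAlgorithm.costFrom, ih, List.foldl_cons]
    ring

/-- Inserting circles one by one. -/
theorem TreeOK.foldl {s a : ℝ} {S : Shape} (hs : 1 ≤ s) (hS : S.HasCap s a) :
    ∀ (L : List Disc) (t : Tree), TreeOK s a S t → AllPos L → ((t 0).contents ++ L).Nodup →
      total (t 0).contents + total L < a →
      TreeOK s a S (L.foldl (OnlineSplitPacking.insertCircle s) t) ∧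
      (L.foldl (OnlineSplitPacking.insertCircle s) t 0).contents.Perm ((t 0).contents ++ L)
  | [], t, ht, _, _, _ => by simpa using ht
  | c :: L, t, ht, hp, hnd, htot => by
    have hp' : AllPos L := hp.subset (by simp)
    have hc := hp c (by simp)
    rw [total_cons] at htot
    have hnew : c ∉ (t 0).contents := fun h => (List.nodup_append.1 hnd).2.2 c h c (by simp) rfl
    obtain ⟨h1, h2⟩ := ht.insertCircle hs hS hc hnew (by linarith [hp'.total_nonneg])
    have hperm : (c :: (t 0).contents ++ L).Perm ((t 0).contents ++ c :: L) :=
      List.perm_middle.symm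
    obtain ⟨k1, k2⟩ := TreeOK.foldl hs hS L _ h1 hp'
      (by rw [h2]; exact hperm.nodup_iff.2 hnd) (by rw [h2, total_cons]; linarith)
    rw [h2] at k2
    exact ⟨k1, k2.trans hperm⟩

/-- The tree that is built from the empty tree by inserting circles one by one. -/
theorem build_ok {s a : ℝ} {S : Shape} (hs : 1 ≤ s) (hS : S.HasCap s a) (ha : S.capacity = a)
    {L : List Disc} (hp : AllPos L) (hnd : L.Nodup) (htot : total L < a) :
    TreeOK s a S (L.foldl (insertCircle s) (emptyTree s S)) ∧
    (L.foldl (insertCircle s) (emptyTree s S) 0).contents.Perm L := by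
  have h0 : TreeOK s a S (emptyTree s S) := by
    rw [emptyTree, ha]
    exact repack_ok hs hS (by simp [AllPos]) (by simp)
      (by rw [total_nil]; exact hS.pos (by linarith))
  exact TreeOK.foldl hs hS L _ h0 hp hnd (by
    show total [] + total L < a
    rw [total_nil, zero_add]; exact htot)

/-- The invariant of the algorithm: `ω` has been served and the circles `act` are present. -/
structure StateOK (s : ℝ) (S : Shape) (ω : List Request) (act : List Disc) (σ : PackState) :
    Prop where
  tree : TreeOK s S.capacity S σ.tree
  active : σ.active = act
  subset : act ⊆ (σ.tree 0).contents
  inserted : ∀ d ∈ (σ.tree 0).contents, Request.insert d ∈ ω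

theorem StateOK.insert {s A : ℝ} {S : Shape} (hSS : S.IsSShape s) (hA : A < S.capacity)
    {ω : List Request} {act : List Disc} {σ : PackState} (hσ : StateOK s S ω act σ) {c : Disc}
    (hadm : Admissible A (ω ++ [Request.insert c]) (act ++ [c])) (hc : 0 < c.area)
    (hnew : ∀ d : Disc, Request.insert d ∈ ω → d.id ≠ c.id) (htot : total (act ++ [c]) ≤ A) :
    StateOK s S (ω ++ [Request.insert c]) (act ++ [c]) (serve s S σ (.insert c)) := by
  have hs := hSS.one_le
  have hS := hSS.hasCap
  obtain ⟨f1, f2, f3⟩ := hadm.facts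
  simp only [serve, hσ.active]
  split_ifs with hR
  · obtain ⟨h1, h2⟩ := build_ok hs hS rfl f1 f2 (htot.trans_lt hA)
    exact ⟨h1, rfl, fun d hd => h2.mem_iff.2 hd, fun d hd => f3 d (h2.mem_iff.1 hd)⟩
  · rw [NeedsRebuild, not_le] at hR
    -- Identifiers are not reused after deletions, so `c` also differs from the inactive circles
    -- still in the tree.
    have hnew' : c ∉ (σ.tree 0).contents := fun h => hnew c (hσ.inserted c h) rfl
    obtain ⟨h1, h2⟩ := hσ.tree.insertCircle hs hS hc hnew' (by linarith)
    refine ⟨h1, rfl, ?_, ?_⟩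
    · intro d hd
      simp only [h2]
      rcases List.mem_append.1 hd with h | h
      · exact List.mem_cons_of_mem _ (hσ.subset h)
      · rw [List.mem_singleton.1 h]; simp
    · intro d hd
      simp only [h2] at hd
      rcases List.mem_cons.1 hd with rfl | h
      · simp
      · exact List.mem_append_left _ (hσ.inserted d h)

theorem stateOK_run {s A : ℝ} {S : Shape} (hSS : S.IsSShape s) (hA : A < S.capacity)
    {ω : List Request} {act : List Disc} (h : Admissible A ω act) :
    StateOK s S ω act ((onlineSplitPacking s S).run ω) := by
  have hs := hSS.one_le
  have hS := hSS.hasCap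
  induction h with
  | nil =>
    obtain ⟨h1, h2⟩ := build_ok hs hS rfl (L := []) (by simp [AllPos]) (by simp)
      (by rw [total_nil]; exact hS.pos (by linarith))
    exact ⟨h1, rfl, by simp, fun d hd => by simpa using h2.mem_iff.1 hd⟩
  | @insert ω act c h hpos hnew htot ih =>
    rw [OnlineAlgorithm.run_append]
    exact ih.insert hSS hA (Admissible.insert c h hpos hnew htot) hpos hnew htot
  | @delete ω act c h hmem ih =>
    rw [OnlineAlgorithm.run_append]
    refine ⟨ih.tree, ?_, ?_, ?_⟩
    · show List.filter _ _ = _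
      rw [ih.active]
    · exact fun x hx => ih.subset (List.mem_filter.1 hx).1
    · exact fun d hd => List.mem_append_left _ (ih.inserted d hd)

theorem hasPackingDensity {s A : ℝ} {S : Shape} (hSS : S.IsSShape s) (hA : A < S.capacity) :
    HasPackingDensity (onlineSplitPacking s S) S.region A := by
  have hs := hSS.one_le
  have hs0 : 0 < s := by linarith
  have hS := hSS.hasCap
  constructor
  · intro ω act h
    have hσ := stateOK_run hSS hA h
    obtain ⟨p1, p2⟩ := hσ.tree.isPacking hs0 hS
    exact ⟨fun c hc => p1 c (hσ.subset hc),
      fun c hc d hd => p2 c (hσ.subset hc) d (hσ.subset hd)⟩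
  · intro ω r act act' h h' c hc hmoved
    have hσ := stateOK_run hSS hA h
    rw [OnlineAlgorithm.run_append]
    set σ := (onlineSplitPacking s S).run ω with hσdef
    generalize hω : ω ++ [r] = ω' at h'
    cases h' with
    | nil => simp at hω
    | @insert ω₁ act₁ x h₁ hpos hnew htot =>
      obtain ⟨rfl, hr⟩ := List.append_inj' hω rfl
      obtain rfl : r = Request.insert x := by simpa using hr
      -- The state records the active circles, so two derivations for the same requests agree on
      -- them.
      have e : act₁ = act := (stateOK_run hSS hA h₁).active.symm.trans hσ.active
      subst e
      have hm : (onlineSplitPacking s S).moved σ (.insert x) =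
          if NeedsRebuild S σ x then σ.active ++ [x] else insertMoved σ.tree x := rfl
      rw [hm] at hmoved
      split_ifs at hmoved with hR
      · rw [hσ.active] at hmoved
        exact absurd hc hmoved
      · have hR' := hR
        replace hR : x.area + total (σ.tree 0).contents < S.capacity := not_le.1 hR
        have hnew' : x ∉ (σ.tree 0).contents := fun h => hnew x (hσ.inserted x h) rfl
        have hcx : c ≠ x := by
          rintro rfl
          obtain ⟨k, -, -, -, -, hk⟩ :=
            insertCircle_eq (s := s) (hσ.tree.exists_not_descends hs hpos)
          rw [hk] at hmoved
          simp at hmoved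
        have hc' : c ∈ act₁ := by simpa [hcx] using hc
        refine ⟨hc', ?_⟩
        have e2 : ((onlineSplitPacking s S).step σ (.insert x)).tree = insertCircle s σ.tree x := by
          show (serve s S σ (.insert x)).tree = _
          simp [serve, hR']
        show Tree.pos s ((onlineSplitPacking s S).step σ (.insert x)).tree c = Tree.pos s σ.tree c
        rw [e2]
        exact hσ.tree.pos_insertCircle hs hS hpos hnew' (by linarith) (hσ.subset hc') hmoved
    | @delete ω₁ act₁ x h₁ hmem =>
      obtain ⟨rfl, hr⟩ := List.append_inj' hω rfl
      obtain rfl : r = Request.delete x := by simpa using hr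
      have e : act₁ = act := (stateOK_run hSS hA h₁).active.symm.trans hσ.active
      subst e
      exact ⟨(List.mem_filter.1 hc).1, rfl⟩

/-! ### Amortised cost with deletions. -/

/-- The amortised cost of the algorithm, together with the potential of the tree and a credit for
every circle that is still in the tree. -/
theorem cost_bound {s ε : ℝ} {S : Shape} (hSS : S.IsSShape s) (hε : 0 < ε)
    {ω : List Request} {act : List Disc} (h : Admissible ((1 - ε) * S.capacity) ω act) :
    ∃ N₀, ∀ N, N₀ ≤ N →
      (onlineSplitPacking s S).costFrom (onlineSplitPacking s S).init ω +
        potential s N ((onlineSplitPacking s S).run ω).tree +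
        3 / ε * total (((onlineSplitPacking s S).run ω).tree 0).contents ≤
      (ω.map (Request.charge fun c => 4 * (c * ((1 + s ^ 2) *
        Real.logb (1 + s ^ 2) (S.capacity / c) + 1 / ε)))).sum := by
  have hs := hSS.one_le
  have hS := hSS.hasCap
  have ha : 0 < S.capacity := hS.pos (by linarith)
  have hA : (1 - ε) * S.capacity < S.capacity := by nlinarith
  induction h with
  | nil =>
    refine ⟨0, fun N _ => ?_⟩
    have e : potential s N (emptyTree s S) = 0 := by
      refine Finset.sum_eq_zero fun k _ => ?_
      have := (repack_level hs k S S.capacity [] hS (by simp [AllPos])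
        (by rw [total_nil]; exact ha)).2.1
      rw [emptyTree]
      split_ifs with hT
      · rfl
      · rw [this hT, total_nil, mul_zero]
    show 0 + potential s N (emptyTree s S) + 3 / ε * total [] ≤ 0
    rw [e, total_nil]
    simp
  | @insert ω act c h hpos hnew htot ih =>
    obtain ⟨N₀, hN₀⟩ := ih
    have hadm := Admissible.insert c h hpos hnew htot
    have hσ := stateOK_run hSS hA h
    have hσ' := stateOK_run hSS hA hadm
    obtain ⟨f1, f2, -⟩ := hadm.facts
    have hcA : c.area ≤ (1 - ε) * S.capacity := (f1.le_total (by simp)).trans htot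
    -- For `ε ≥ 1` no circle of positive area could be inserted.
    have hε1 : ε < 1 := by
      by_contra! hge
      nlinarith
    have hca : c.area ≤ S.capacity := by linarith
    have hw : 1 < 1 + s ^ 2 := by have : 1 ≤ s ^ 2 := one_le_pow₀ hs; linarith
    have hlog : 0 ≤ Real.logb (1 + s ^ 2) (S.capacity / c.area) :=
      Real.logb_nonneg hw ((one_le_div hpos).2 hca)
    have hinv : 1 ≤ 1 / ε := (one_le_div hε).2 hε1.le
    have hlog' : 0 ≤ c.area * ((1 + s ^ 2) * Real.logb (1 + s ^ 2) (S.capacity / c.area)) := by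
      positivity
    have hinv' : c.area ≤ c.area * (1 / ε) := le_mul_of_one_le_right hpos.le hinv
    rw [OnlineAlgorithm.run_append, OnlineAlgorithm.costFrom_append, List.map_append,
      List.sum_append]
    simp only [List.map_cons, List.map_nil, List.sum_cons, List.sum_nil, add_zero, Request.charge]
    rw [OnlineAlgorithm.run_append] at hσ'
    change ∃ N₀, ∀ N, N₀ ≤ N → (onlineSplitPacking s S).costFrom (onlineSplitPacking s S).init ω +
      total (serveMoved S ((onlineSplitPacking s S).run ω) (.insert c)) +
      potential s N (serve s S ((onlineSplitPacking s S).run ω) (.insert c)).tree +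
      3 / ε * total ((serve s S ((onlineSplitPacking s S).run ω) (.insert c)).tree 0).contents ≤ _
    change StateOK s S _ _ (serve s S ((onlineSplitPacking s S).run ω) (.insert c)) at hσ'
    set σ := (onlineSplitPacking s S).run ω
    have e3 : 3 / ε = 3 * (1 / ε) := by ring
    by_cases hR : NeedsRebuild S σ c
    · obtain ⟨h1, h2⟩ := build_ok hs hS rfl f1 f2 (htot.trans_lt hA)
      refine ⟨N₀, fun N hN => ?_⟩
      -- Rebuild: counting `c` as present before, the discarded area is at least `ε` times the
      -- capacity. Its credit of three capacities covers the moved circles and twice the capacity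
      -- for the new potential; the charge for `c` provides its own credit.
      have h3 := hN₀ N hN
      have h4 := hσ'.tree.potential_le hs N
      have h5 := hσ.tree.potential_nonneg N
      simp only [serve, serveMoved, hR, if_true, hσ.active] at h4 ⊢
      rw [total_perm h2]
      replace hR : S.capacity ≤ c.area + total (σ.tree 0).contents := hR
      have hb : 0 < 1 / ε := by positivity
      have h6 := mul_le_mul_of_nonneg_left hR hb.le
      have h7 := mul_le_mul_of_nonneg_left htot hb.le
      have h8 : 1 / ε * ((1 - ε) * S.capacity) = 1 / ε * S.capacity - S.capacity := by
        field_simp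
      rw [h8] at h7
      have h9 : 0 < ε * S.capacity := by positivity
      rw [e3] at h3 ⊢
      linarith
    · have hR' : c.area + total (σ.tree 0).contents < S.capacity := not_le.1 hR
      have hnew' : c ∉ (σ.tree 0).contents := fun h => hnew c (hσ.inserted c h) rfl
      have h1 := (hσ.tree.insertCircle hs hS hpos hnew' (by linarith)).2
      -- Basic insertion: the extra `c.area` and the credit `3 / ε * c.area` together are at most `4
      -- / ε * c.area`.
      obtain ⟨N₁, hN₁⟩ := hσ.tree.insert_cost hs hS hpos (by linarith)
      refine ⟨max N₀ N₁, fun N hN => ?_⟩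
      have h3 := hN₀ N (le_trans (le_max_left _ _) hN)
      have h4 := hN₁ N (le_trans (le_max_right _ _) hN)
      simp only [serve, serveMoved, hR, if_false, h1, total_cons]
      rw [e3] at h3 ⊢
      linarith
  | @delete ω act c h hmem ih =>
    obtain ⟨N₀, hN₀⟩ := ih
    refine ⟨N₀, fun N hN => ?_⟩
    have h3 := hN₀ N hN
    rw [OnlineAlgorithm.run_append, OnlineAlgorithm.costFrom_append, List.map_append,
      List.sum_append]
    change (onlineSplitPacking s S).costFrom (onlineSplitPacking s S).init ω + total [] +
      potential s N ((onlineSplitPacking s S).run ω).tree +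
      3 / ε * total (((onlineSplitPacking s S).run ω).tree 0).contents ≤ _
    rw [total_nil, add_zero]
    simpa [Request.charge] using h3

theorem hasAmortisedCost {s ε : ℝ} {S : Shape} (hSS : S.IsSShape s) (hε : 0 < ε) :
    HasAmortisedCost (onlineSplitPacking s S) ((1 - ε) * S.capacity) fun c =>
      4 * (c * ((1 + s ^ 2) * Real.logb (1 + s ^ 2) (S.capacity / c) + 1 / ε)) := by
  intro ω act h
  have ha : 0 < S.capacity := hSS.hasCap.pos (by linarith [hSS.one_le])
  obtain ⟨N, hN⟩ := cost_bound hSS hε h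
  have hσ := stateOK_run hSS (by nlinarith) h
  have h1 := hσ.tree.potential_nonneg N
  have h2 := hσ.tree.pos.total_nonneg
  have h3 : 0 ≤ 3 / ε * total (((onlineSplitPacking s S).run ω).tree 0).contents := by positivity
  linarith [hN N le_rfl]

theorem logb_capacity_le {w a c : ℝ} (hw : 1 < w) (ha : 0 < a) (hc : 0 < c) (hac : c * a ≤ 1) :
    Real.logb w (a / c) ≤ 2 * Real.logb w (1 / c) := by
  have h1 : a ≤ 1 / c := by rw [le_div_iff₀ hc]; linarith
  have h2 : a / c ≤ (1 / c) ^ 2 := by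
    rw [div_eq_mul_one_div, sq]; gcongr
  have h3 := Real.logb_le_logb_of_le hw (by positivity) h2
  rwa [Real.logb_pow, Nat.cast_ofNat] at h3

end OnlineSplitPacking

end

/-! ### Assembly of the bounds. -/

open OnlineSplitPacking
/-- The Online Split Packing Algorithm with lazy deletions. The constant `K` is absolute.
The last two bounds, for squares, are the bounds with `log₂`. -/
theorem mainTheorem3 :
    ∃ K : ℝ, 0 < K ∧ ∀ (s : ℝ) (S : Shape), S.IsSShape s →
      IsCapacity S.region S.capacity ∧
      ∀ ε : ℝ, 0 < ε →
        HasPackingDensity (onlineSplitPacking s S) S.region ((1 - ε) * S.capacity) ∧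
        ∃ f : ℝ → ℝ,
          HasAmortisedCost (onlineSplitPacking s S) ((1 - ε) * S.capacity) f ∧
          (∀ c : ℝ, 0 < c → c ≤ S.capacity →
            f c ≤ K * (c * ((1 + s ^ 2) * Real.logb (1 + s ^ 2) (S.capacity / c) + 1 / ε))) ∧
          (∀ c : ℝ, 0 < c → c ≤ S.capacity → c * S.capacity ≤ 1 →
            f c ≤ K * (c * ((1 + s ^ 2) * Real.logb (1 + s ^ 2) (1 / c) + 1 / ε))) ∧
          (S.IsSquare →
            (∀ c : ℝ, 0 < c → c ≤ S.capacity →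
              f c ≤ K * (c * (Real.logb 2 (S.capacity / c) + 1 / ε))) ∧
            (∀ c : ℝ, 0 < c → c ≤ S.capacity → c * S.capacity ≤ 1 →
              f c ≤ K * (c * (Real.logb 2 (1 / c) + 1 / ε)))) := by
  -- The constant is 4 from the amortisation, times 2 for replacing `a / c` by `1 / c` (as `a / c ≤
  -- (1 / c) ^ 2`), times 2 for the factor `1 + s ^ 2 = 2` that is dropped for squares.
  refine ⟨16, by norm_num, fun s S hSS => ⟨isCapacity hSS, fun ε hε => ?_⟩⟩
  have ha : 0 < S.capacity := hSS.hasCap.pos (by linarith [hSS.one_le])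
  have hw : 1 < 1 + s ^ 2 := by
    have : 1 ≤ s ^ 2 := one_le_pow₀ hSS.one_le
    linarith
  have key : ∀ w : ℝ, 1 < w → ∀ c : ℝ, 0 < c → c ≤ S.capacity →
      0 ≤ Real.logb w (S.capacity / c) := fun w hw c hc hca =>
    Real.logb_nonneg hw ((one_le_div hc).2 hca)
  have hε' : 0 < 1 / ε := by positivity
  refine ⟨hasPackingDensity hSS (by nlinarith), _, hasAmortisedCost hSS hε, ?_, ?_, ?_⟩
  · intro c hc hca
    have := key _ hw c hc hca
    gcongr
    norm_num
  · intro c hc hca hac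
    have h1 := key _ hw c hc hca
    have h2 := mul_le_mul_of_nonneg_left (logb_capacity_le hw ha hc hac)
      (show 0 ≤ c * (1 + s ^ 2) by positivity)
    have h3 : 0 ≤ c * (1 / ε) := by positivity
    have h4 : 0 ≤ c * (1 + s ^ 2) * Real.logb (1 + s ^ 2) (S.capacity / c) := by positivity
    linarith
  · intro hsq
    obtain rfl : s = 1 := by
      cases S with
      | square O X Y => exact hSS.1
      | triangle T => exact hsq.elim
    rw [show (1 : ℝ) + 1 ^ 2 = 2 by norm_num]
    refine ⟨fun c hc hca => ?_, fun c hc hca hac => ?_⟩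
    · have h1 := key 2 one_lt_two c hc hca
      have h3 : 0 ≤ c * (1 / ε) := by positivity
      have h4 : 0 ≤ c * Real.logb 2 (S.capacity / c) := by positivity
      linarith
    · have h1 := key 2 one_lt_two c hc hca
      have h2 := mul_le_mul_of_nonneg_left (logb_capacity_le one_lt_two ha hc hac) hc.le
      have h3 : 0 ≤ c * (1 / ε) := by positivity
      have h4 : 0 ≤ c * Real.logb 2 (S.capacity / c) := by positivity
      linarith
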